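/- Let $G=(V,E)$ be a connected simple undirected graph with $n=|V|\ge 2$ vertices and $m=|E|$ edges, and let $\pi$ be a vertex order, i.e. a bijection from the ranks onto $V$. Contracting a vertex $v$ means removing $v$ with its incident edges and joining all pairs of neighbors of $v$ by an edge, unless they are already adjacent. Let $G_{\pi,i}$ be the core graph obtained from $G$ by contracting the vertices of rank smaller than $i$ in order of their rank, let $G^*_\pi=\bigcup_i G_{\pi,i}$, and let $G^\wedge_\pi$ be the directed graph that is obtained from $G^*_\pi$ by orienting every edge from its endpoint of lower rank to its endpoint of higher rank (the metric-independent contraction hierarchy). Let $\hat m$ be the number of arcs of $G^\wedge_\pi$, and let $\alpha(n)=\min\{k : A(k,k)\ge n\}$, where $A$ is the two-argument Ackermann function. The contraction graph algorithm described below, run on a random access machine with unit costs and words of bounded size, with a list of the edges of $G$ (in any order and orientation) and the order $\pi$ as its input, outputs every arc of $G^\wedge_\pi$ exactly once and nothing else. Its running time is $O(\hat m\,\alpha(n))$, and its memory, which includes the input but not the write-only output, consists of $O(m)$ words, each holding a number of size $O(m)$. The constants do not depend on $G$, $n$, $\pi$ or the edge list. The algorithm maintains a graph $H$ that contains the uncontracted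 vertices and an independent set of super vertices (marked by a bit). It stores a linked list of neighbor references for each vertex of $H$, and a union-find structure (linking by rank, path compression) that maps the target of each reference to the vertex of $H$ that it now stands for. Initially $H=G$ and all vertices are singletons of the union-find structure. To enumerate the neighbors of $x$ in $H$, it scans the list of $x$, looks up the representative of each reference, deletes the reference if the representative is $x$ or is already marked, and otherwise marks the representative and reports it; a second scan resets the markers. For each vertex $x$ in the order $\pi$, it turns $x$ into a super vertex, enumerates the neighbors of $x$ to find the neighboring super vertices, merges each of these into $x$ by concatenating the neighbor lists and uniting the sets (with $x$ as the representative), then enumerates the neighbors of $x$ again, and outputs the arc $(x,z)$ for each neighbor $z$. -/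

import Mathlib

/-! ### Contraction hierarchies of undirected, unweighted graphs -/

/-- Unweighted vertex contraction: `v` and its incident edges are removed, and edges are inserted
between all pairs of neighbors of `v`. The vertex type is kept, so that the removed vertex `v`
stays behind as an isolated vertex. -/
def SimpleGraph.contractVertex {V : Type*} (G : SimpleGraph V) (v : V) : SimpleGraph V where
  Adj x y := x ≠ y ∧ x ≠ v ∧ y ≠ v ∧ (G.Adj x y ∨ (G.Adj v x ∧ G.Adj v y))
  symm := ⟨fun _ _ h => ⟨h.1.symm, h.2.2.1, h.2.1,
    h.2.2.2.imp (fun e => e.symm) (fun e => ⟨e.2, e.1⟩)⟩⟩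
  loopless := ⟨fun _ h => h.1 rfl⟩

/-- The core graph after the contraction of the `i` vertices of lowest rank, in order of their
rank. An order `π` maps the rank `i` to the vertex `π i` (ranks start at `0`). -/
def coreGraph {n : ℕ} (G : SimpleGraph (Fin n)) (π : Equiv.Perm (Fin n)) : ℕ → SimpleGraph (Fin n)
  | 0 => G
  | i + 1 => if h : i < n then (coreGraph G π i).contractVertex (π ⟨i, h⟩) else coreGraph G π i

/-- The union of all core graphs: `G` augmented by all shortcuts. -/
def contractionHierarchy {n : ℕ} (G : SimpleGraph (Fin n)) (π : Equiv.Perm (Fin n)) :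
    SimpleGraph (Fin n) :=
  ⨆ i : ℕ, coreGraph G π i

/-- The upward directed graph of the contraction hierarchy: every edge becomes an arc from its
endpoint of lower rank to its endpoint of higher rank. -/
def upwardHierarchy {n : ℕ} (G : SimpleGraph (Fin n)) (π : Equiv.Perm (Fin n)) :
    Digraph (Fin n) where
  Adj x y := (contractionHierarchy G π).Adj x y ∧ π.symm x < π.symm y

/-- The number of arcs of the upward directed contraction hierarchy. -/
noncomputable def numHierarchyArcs {n : ℕ} (G : SimpleGraph (Fin n)) (π : Equiv.Perm (Fin n)) : ℕ :=
  {p : Fin n × Fin n | (upwardHierarchy G π).Adj p.1 p.2}.ncard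

theorem exists_le_ack_diag (n : ℕ) : ∃ k, n ≤ ack k k := ⟨n, (lt_ack_left n n).le⟩

/-- The inverse of the diagonal `k ↦ A(k, k)` of the Ackermann function: the least `k` such that
`n ≤ A(k, k)`. -/
def inverseAckermann (n : ℕ) : ℕ := Nat.find (exists_le_ack_diag n)

/-! ### A random access machine with bounded words and unit costs

A program works on finitely many registers (named by `R`), each of which holds one word, and
finitely many arrays (named by `A`). For a machine of size `N`, the words are the numbers below `N`
and every array has `N` cells. The only arithmetic operation is addition. -/

namespace RAM

/-- Expressions: constants, registers, array cells, and sums. -/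
inductive Expr (R A : Type) where
  | const (k : ℕ)
  | reg (r : R)
  | load (a : A) (i : Expr R A)
  | add (e f : Expr R A)

/-- Tests on words. -/
inductive Cond (R A : Type) where
  | eq (e f : Expr R A)
  | ne (e f : Expr R A)
  | lt (e f : Expr R A)
  | or (b c : Cond R A)

/-- Programs. The command `emit e f` appends the pair `(e, f)` to the write-only output. -/
inductive Cmd (R A : Type) where
  | skip
  | assign (r : R) (e : Expr R A)
  | store (a : A) (i e : Expr R A)
  | emit (e f : Expr R A)
  | seq (c d : Cmd R A)
  | ite (b : Cond R A) (c d : Cmd R A)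
  | while (b : Cond R A) (c : Cmd R A)

/-- The contents of the registers, of the arrays, and of the output. -/
structure State (R A : Type) where
  reg : R → ℕ
  arr : A → ℕ → ℕ
  out : List (ℕ × ℕ)

variable {R A : Type}

namespace Expr

def eval (s : State R A) : Expr R A → ℕ
  | const k => k
  | reg r => s.reg r
  | load a i => s.arr a (i.eval s)
  | add e f => e.eval s + f.eval s

/-- On a machine of size `N`, the expression evaluates without overflow and without an access out
of bounds: the value of every subexpression (in particular every array index) is below `N`. -/
def Fits (N : ℕ) (s : State R A) : Expr R A → Prop
  | const k => k < N
  | reg r => s.reg r < N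
  | load a i => i.Fits N s ∧ s.arr a (i.eval s) < N
  | add e f => e.Fits N s ∧ f.Fits N s ∧ e.eval s + f.eval s < N

/-- One unit of time per constant, register access, array access and addition. -/
def cost : Expr R A → ℕ
  | const _ => 1
  | reg _ => 1
  | load _ i => i.cost + 1
  | add e f => e.cost + f.cost + 1

end Expr

namespace Cond

def Holds (s : State R A) : Cond R A → Prop
  | eq e f => e.eval s = f.eval s
  | ne e f => e.eval s ≠ f.eval s
  | lt e f => e.eval s < f.eval s
  | or b c => b.Holds s ∨ c.Holds s

def Fits (N : ℕ) (s : State R A) : Cond R A → Prop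
  | eq e f => e.Fits N s ∧ f.Fits N s
  | ne e f => e.Fits N s ∧ f.Fits N s
  | lt e f => e.Fits N s ∧ f.Fits N s
  | or b c => b.Fits N s ∧ c.Fits N s

def cost : Cond R A → ℕ
  | eq e f => e.cost + f.cost + 1
  | ne e f => e.cost + f.cost + 1
  | lt e f => e.cost + f.cost + 1
  | or b c => b.cost + c.cost + 1

end Cond

/-- `Exec N c s t s'`: on a machine of size `N`, the program `c` started in the state `s` halts in
the state `s'` after `t` units of time. A program that leaves its memory, overflows a word, or runs
forever has no execution. -/
inductive Exec [DecidableEq R] [DecidableEq A] (N : ℕ) :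
    Cmd R A → State R A → ℕ → State R A → Prop
  | skip (s : State R A) : Exec N .skip s 1 s
  | assign (s : State R A) (r : R) (e : Expr R A) (he : e.Fits N s) :
      Exec N (.assign r e) s (e.cost + 1)
        { s with reg := Function.update s.reg r (e.eval s) }
  | store (s : State R A) (a : A) (i e : Expr R A) (hi : i.Fits N s) (he : e.Fits N s) :
      Exec N (.store a i e) s (i.cost + e.cost + 1)
        { s with arr := Function.update s.arr a
                          (Function.update (s.arr a) (i.eval s) (e.eval s)) }
  | emit (s : State R A) (e f : Expr R A) (he : e.Fits N s) (hf : f.Fits N s) :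
      Exec N (.emit e f) s (e.cost + f.cost + 1)
        { s with out := s.out ++ [(e.eval s, f.eval s)] }
  | seq {c d : Cmd R A} {s s' s'' : State R A} {t t' : ℕ}
      (hc : Exec N c s t s') (hd : Exec N d s' t' s'') :
      Exec N (.seq c d) s (t + t') s''
  | iteTrue {b : Cond R A} {c d : Cmd R A} {s s' : State R A} {t : ℕ}
      (hf : b.Fits N s) (hb : b.Holds s) (hc : Exec N c s t s') :
      Exec N (.ite b c d) s (b.cost + t) s'
  | iteFalse {b : Cond R A} {c d : Cmd R A} {s s' : State R A} {t : ℕ}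
      (hf : b.Fits N s) (hb : ¬ b.Holds s) (hd : Exec N d s t s') :
      Exec N (.ite b c d) s (b.cost + t) s'
  | whileTrue {b : Cond R A} {c : Cmd R A} {s s' s'' : State R A} {t t' : ℕ}
      (hf : b.Fits N s) (hb : b.Holds s) (hc : Exec N c s t s')
      (hw : Exec N (.while b c) s' t' s'') :
      Exec N (.while b c) s (b.cost + t + t') s''
  | whileFalse {b : Cond R A} {c : Cmd R A} {s : State R A}
      (hf : b.Fits N s) (hb : ¬ b.Holds s) :
      Exec N (.while b c) s b.cost s

/-- The total number of words in the memory of a machine of size `N`, with the part of the memory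
that holds the input, and without the write-only output. -/
def memoryWords (R A : Type) [Fintype R] [Fintype A] (N : ℕ) : ℕ :=
  Fintype.card R + Fintype.card A * N

/-- Run a list of commands one after the other. -/
def Cmd.block (cs : List (Cmd R A)) : Cmd R A := cs.foldr Cmd.seq Cmd.skip

end RAM

/-! ### The algorithm

The contraction graph `H` stores, for every vertex, a singly linked list of references to its
neighbors. References are numbered from `1`, and `0` is the null reference. A union-find forest
(linking by rank, two-pass path compression) maps the target of a reference to the vertex of `H` that
it now stands for. -/

namespace ContractionGraph

open RAM

/-- Registers. -/
inductive Reg where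
  /-- input: number of vertices -/
  | numVertices
  /-- input: number of edges -/
  | numEdges
  /-- index of the current vertex, edge or rank -/
  | i
  /-- next unused reference -/
  | fresh
  /-- the vertex that is being contracted -/
  | x
  /-- a super vertex that is merged into `x` -/
  | y
  /-- reference at which a neighborhood list is read -/
  | e
  /-- last reference before `e` that was kept, or null -/
  | prev
  /-- result of a representative lookup -/
  | v
  /-- root found by a lookup -/
  | root
  /-- position on a path in the union-find forest -/
  | cur
  /-- parent of `cur` -/
  | up
  /-- root of the set of `x` -/
  | rootX
  /-- number of super vertices that were found next to `x` -/
  | numSupers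
  /-- index into the super vertices that were found next to `x` -/
  | j
  deriving DecidableEq

instance : Fintype Reg where
  elems := {.numVertices, .numEdges, .i, .fresh, .x, .y, .e, .prev, .v, .root, .cur, .up,
    .rootX, .numSupers, .j}
  complete r := by cases r <;> decide

/-- Arrays. -/
inductive Arr where
  /-- input: first endpoint of an edge -/
  | edgeFst
  /-- input: second endpoint of an edge -/
  | edgeSnd
  /-- input: vertex of a rank -/
  | order
  /-- vertex that a reference points to -/
  | target
  /-- successor of a reference in its neighborhood list, or null -/
  | succ
  /-- first reference in the neighborhood list of a vertex, or null -/
  | head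
  /-- last reference in the neighborhood list of a vertex (if the list is not empty) -/
  | last
  /-- parent in the union-find forest; the parent of a root is the root itself -/
  | parent
  /-- rank in the union-find forest -/
  | ufRank
  /-- vertex of `H` that represents the set of a root -/
  | name
  /-- marker bit: the vertex is a super vertex -/
  | isSuper
  /-- marker bit: the neighbor has already been enumerated -/
  | marked
  /-- the super vertices that were found next to `x` -/
  | supers
  deriving DecidableEq

instance : Fintype Arr where
  elems := {.edgeFst, .edgeSnd, .order, .target, .succ, .head, .last, .parent, .ufRank,
    .name, .isSuper, .marked, .supers}
  complete r := by cases r <;> decide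

abbrev Program := Cmd Reg Arr

abbrev Term := Expr Reg Arr

/-- The content of a register. -/
def val (r : Reg) : Term := .reg r

/-- The cell of the array `a` whose index is in the register `r`. -/
def at' (a : Arr) (r : Reg) : Term := .load a (.reg r)

def zero : Term := .const 0

def one : Term := .const 1

def increment (r : Reg) : Program := .assign r (.add (val r) one)

/-- Make all vertices singletons of the union-find forest with an empty neighborhood list and
without markers. -/
def initVertices : Program :=
  .block
    [ .assign .i zero,
      .while (.lt (val .i) (val .numVertices)) (.block
        [ .store .head (val .i) zero,
          .store .last (val .i) zero,
          .store .parent (val .i) (val .i),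
          .store .ufRank (val .i) zero,
          .store .name (val .i) (val .i),
          .store .isSuper (val .i) zero,
          .store .marked (val .i) zero,
          increment .i ]) ]

/-- Put a new reference to the vertex `w` in front of the neighborhood list of the vertex `u`. -/
def insertReference (u w : Term) : Program :=
  .block
    [ .store .target (val .fresh) w,
      .store .succ (val .fresh) (.load .head u),
      .ite (.eq (.load .head u) zero)
        (.store .last u (val .fresh))
        .skip,
      .store .head u (val .fresh),
      increment .fresh ]

/-- Build the neighborhood lists of the input graph. -/
def initLists : Program :=
  .block
    [ .assign .i zero,
      .assign .fresh one,
      .while (.lt (val .i) (val .numEdges)) (.block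
        [ insertReference (at' .edgeFst .i) (at' .edgeSnd .i),
          insertReference (at' .edgeSnd .i) (at' .edgeFst .i),
          increment .i ]) ]

/-- Find the root of the set of the vertex `w` and compress the path that leads to it. -/
def findRoot (w : Term) : Program :=
  .block
    [ .assign .root w,
      .while (.ne (at' .parent .root) (val .root))
        (.assign .root (at' .parent .root)),
      .assign .cur w,
      .while (.ne (at' .parent .cur) (val .root)) (.block
        [ .assign .up (at' .parent .cur),
          .store .parent (val .cur) (val .root),
          .assign .cur (val .up) ]) ]

/-- Look up the vertex of `H` that the reference `e` stands for. -/
def lookup : Program :=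
  .block
    [ findRoot (at' .target .e),
      .assign .v (at' .name .root) ]

/-- Enumerate the neighbors of `x` in `H`: run `report` for every neighbor `v`, remove duplicate
references and loops from the list of `x`, and reset all markers in a second pass. -/
def enumerateNeighbors (report : Program) : Program :=
  .block
    [ .assign .prev zero,
      .assign .e (at' .head .x),
      .while (.ne (val .e) zero) (.block
        [ lookup,
          .ite (.or (.eq (val .v) (val .x)) (.eq (at' .marked .v) one))
            (.ite (.eq (val .prev) zero)
              (.store .head (val .x) (at' .succ .e))
              (.store .succ (val .prev) (at' .succ .e)))
            (.block
              [ .store .marked (val .v) one,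
                report,
                .assign .prev (val .e) ]),
          .assign .e (at' .succ .e) ]),
      .store .last (val .x) (val .prev),
      .assign .e (at' .head .x),
      .while (.ne (val .e) zero) (.block
        [ lookup,
          .store .marked (val .v) zero,
          .assign .e (at' .succ .e) ]) ]

/-- Record the neighbor `v` if it is a super vertex. -/
def collectSuper : Program :=
  .ite (.eq (at' .isSuper .v) one)
    (.block
      [ .store .supers (val .numSupers) (val .v),
        increment .numSupers ])
    .skip

/-- Merge the super vertex `y` into `x`: link the list of `y` to the end of the list of `x` and
unite their sets, with `x` as the representative. -/
def merge : Program :=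
  .block
    [ .ite (.eq (at' .head .y) zero)
        .skip
        (.block
          [ .ite (.eq (at' .head .x) zero)
              (.store .head (val .x) (at' .head .y))
              (.store .succ (at' .last .x) (at' .head .y)),
            .store .last (val .x) (at' .last .y) ]),
      findRoot (val .x),
      .assign .rootX (val .root),
      findRoot (val .y),
      .ite (.lt (at' .ufRank .rootX) (at' .ufRank .root))
        (.block
          [ .store .parent (val .rootX) (val .root),
            .store .name (val .root) (val .x) ])
        (.block
          [ .store .parent (val .root) (val .rootX),
            .store .name (val .rootX) (val .x),
            .ite (.eq (at' .ufRank .rootX) (at' .ufRank .root))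
              (.store .ufRank (val .rootX) (.add (at' .ufRank .rootX) one))
              .skip ]) ]

/-- Contract `x`: turn it into a super vertex and merge all neighboring super vertices into it. -/
def contract : Program :=
  .block
    [ .store .isSuper (val .x) one,
      .assign .numSupers zero,
      enumerateNeighbors collectSuper,
      .assign .j zero,
      .while (.lt (val .j) (val .numSupers)) (.block
        [ .assign .y (at' .supers .j),
          merge,
          increment .j ]) ]

/-- The whole algorithm: contract the vertices in the given order, and output after each
contraction the arcs from the contracted vertex to its neighbors in `H`. -/
def enumerateArcs : Program :=
  .block
    [ initVertices,
      initLists,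
      .assign .i zero,
      .while (.lt (val .i) (val .numVertices)) (.block
        [ .assign .x (at' .order .i),
          contract,
          enumerateNeighbors (.emit (val .x) (val .v)),
          increment .i ]) ]

/-- The list `E` contains every edge of `G` exactly once, in one of its two orientations. -/
def IsEdgeList {n : ℕ} (G : SimpleGraph (Fin n)) (E : List (Fin n × Fin n)) : Prop :=
  (E.map fun p => s(p.1, p.2)).Nodup ∧ ∀ e, e ∈ (E.map fun p => s(p.1, p.2)) ↔ e ∈ G.edgeSet

/-- The state `s` holds the edge list `E` of a graph on `n` vertices and the order `π`. The content
of the rest of the memory is arbitrary. -/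
def IsInput {n : ℕ} (E : List (Fin n × Fin n)) (π : Equiv.Perm (Fin n))
    (s : State Reg Arr) : Prop :=
  s.reg .numVertices = n ∧ s.reg .numEdges = E.length ∧
    (∀ k : Fin E.length, s.arr .edgeFst k = (E.get k).1 ∧ s.arr .edgeSnd k = (E.get k).2) ∧
    (∀ i : Fin n, s.arr .order i = π i) ∧ s.out = []

/-- The list `L` enumerates the arcs of the digraph `D`: it contains every arc exactly once, and
nothing else. -/
def EnumeratesArcs {n : ℕ} (D : Digraph (Fin n)) (L : List (ℕ × ℕ)) : Prop :=
  L.Nodup ∧ ∀ p : ℕ × ℕ, p ∈ L ↔ ∃ x y : Fin n, D.Adj x y ∧ p = ((x : ℕ), (y : ℕ))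

end ContractionGraph

/-!
The algorithm is correct because the contraction graph `H` determines the core graphs. After the
contraction of a set `S` of vertices, let `rep` map every vertex to the vertex of `H` that it now
stands for. Two vertices outside `S` are adjacent in the core graph if and only if they are adjacent
in `G` or to a common super vertex (`IsContraction`). Merging all super vertices next to `x` into
`x` preserves this, and afterwards the neighbors of `x` in `H` are exactly its neighbors in the core
graph (`IsContraction.contract`), i.e. the heads of the arcs that leave `x` in the upward hierarchy
(`upwardHierarchy_adj_iff`). The neighborhood lists only lose loops and duplicates (`Cleaned`), so
that they go on representing the edges of `H` (`Refs`).

For the running time, programs are verified with time credits: `Runs N c T s Q` says that `c`,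
started in `s` with `T` units of time, halts in time and leaves a state and a remaining time that
satisfy `Q`. Savings are part of the invariants.

* Every reference in a list carries enough time for one enumeration if it belongs to a super vertex,
  and for two enumerations and a merge otherwise (`refCredit`). An enumeration consumes the
  savings of the scanned references, and the references that it keeps need new savings. In the first
  enumeration for `x` these are covered because `x` has just become a super vertex; in the second one
  they are charged to the arcs that are output, one per reference. Since the lists initially hold
  `2 * m` references, there are `O(m̂)` lookups and merges.
* A lookup costs `O(α(n))` amortized time (`runs_findRoot`). The potential of a node of rank `a`
  whose parent has rank `b` is the number of pairs `(k, i)` with `k < A` and `1 ≤ i ≤ a` for which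
  `b` is below the `i`-fold iterate of a fast growing function `F k` at `a`. Path compression only
  increases `b`. If a later node of the path has the same level, i.e. the same largest `k` with
  `F k a ≤ b`, then a pair drops out (`nodePotential_lt`), so that on every path at most one node per
  level is not paid for by its own loss of potential (`Forest.exists_compress`). Finally
  `A(k, k) ≤ F (k + 1) 1`, so that `A = α(n) + 1` levels suffice (`ack_diag_le_fastGrowing`).
-/

/-! ### The amortized cost of path compression -/

namespace UnionFind

/-- The functions `F 0 j = j + 1` and `F (k + 1) j = F k (F k (⋯ j))`, with `j + 1` applications
of `F k`. They measure how far the rank of a node is below the rank of its parent. -/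
def fastGrowing : ℕ → ℕ → ℕ
  | 0, j => j + 1
  | k + 1, j => (fastGrowing k)^[j + 1] j

theorem fastGrowing_succ (k j : ℕ) : fastGrowing (k + 1) j = (fastGrowing k)^[j + 1] j := rfl

theorem strictMono_and_lt_fastGrowing (k : ℕ) :
    StrictMono (fastGrowing k) ∧ ∀ j, j < fastGrowing k j := by
  induction k with
  | zero => exact ⟨fun a b h => by simpa [fastGrowing] using h, fun j => by simp [fastGrowing]⟩
  | succ k ih =>
    obtain ⟨hm, hl⟩ := ih
    have hit : ∀ i j, j ≤ (fastGrowing k)^[i] j := fun i j =>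
      Function.id_le_iterate_of_id_le (fun x => (hl x).le) i j
    refine ⟨strictMono_nat_of_lt_succ fun j => ?_, fun j => ?_⟩
    · rw [fastGrowing_succ, fastGrowing_succ, Function.iterate_succ_apply']
      rw [Function.iterate_succ_apply]
      refine (hm.iterate (j + 1) (hl j)).trans_le' ?_ |>.trans_le
        ((hm.iterate (j + 1)).monotone (hm.monotone (Nat.le_succ j)))
      rw [← Function.iterate_succ_apply' (fastGrowing k)]
    · rw [fastGrowing_succ, Function.iterate_succ_apply']
      exact (hit j j).trans_lt (hl _)

theorem fastGrowing_strictMono (k : ℕ) : StrictMono (fastGrowing k) :=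
  (strictMono_and_lt_fastGrowing k).1

theorem lt_fastGrowing (k j : ℕ) : j < fastGrowing k j :=
  (strictMono_and_lt_fastGrowing k).2 j

theorem le_iterate_fastGrowing (k i j : ℕ) : j ≤ (fastGrowing k)^[i] j :=
  Function.id_le_iterate_of_id_le (fun x => (lt_fastGrowing k x).le) i j

theorem fastGrowing_le_succ (k j : ℕ) : fastGrowing k j ≤ fastGrowing (k + 1) j := by
  rw [fastGrowing_succ, Function.iterate_succ_apply]
  exact le_iterate_fastGrowing k j _

theorem fastGrowing_mono_left (j : ℕ) : Monotone fun k => fastGrowing k j :=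
  monotone_nat_of_le_succ fun k => fastGrowing_le_succ k j

theorem ack_succ_eq_iterate (k j : ℕ) : ack (k + 1) j = (ack k)^[j + 1] 1 := by
  induction j with
  | zero => simp
  | succ j ih => rw [ack_succ_succ, ih, ← Function.iterate_succ_apply' (ack k)]

theorem ack_le_fastGrowing (k : ℕ) : ∀ j, 1 ≤ j → ack k j ≤ fastGrowing k j := by
  induction k with
  | zero => intro j _; simp [fastGrowing]
  | succ k ih =>
    intro j hj
    rw [ack_succ_eq_iterate, fastGrowing_succ]
    have key : ∀ i, (ack k)^[i] 1 ≤ (fastGrowing k)^[i] j := by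
      intro i
      induction i with
      | zero => simpa using hj
      | succ i hi =>
        rw [Function.iterate_succ_apply', Function.iterate_succ_apply']
        exact (ack_mono_right k hi).trans
          (ih _ (hj.trans (le_iterate_fastGrowing k i j)))
    exact key _

theorem ack_diag_le_fastGrowing (k : ℕ) : ack k k ≤ fastGrowing (k + 1) 1 := by
  have h1 : fastGrowing (k + 1) 1 = fastGrowing k (fastGrowing k 1) := rfl
  have h2 : k ≤ fastGrowing k 1 := (lt_ack_left k 1).le.trans (ack_le_fastGrowing k 1 le_rfl)
  rw [h1]
  exact (ack_mono_right k h2).trans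
    (ack_le_fastGrowing k _ (Nat.one_le_iff_ne_zero.2 (by have := lt_fastGrowing k 1; omega)))

/-- The potential of a node of rank `a` whose parent has rank `b`: the number of pairs `(k, i)`
with `k < A` and `1 ≤ i ≤ a` such that `b` is below the `i`-fold iterate of `F k` at `a`. For a root
(`b = a`) these are all pairs; the potential decreases as the rank of the parent grows. -/
def nodePotential (A a b : ℕ) : ℕ :=
  ((Finset.range A ×ˢ Finset.range a).filter fun q => b < (fastGrowing q.1)^[q.2 + 1] a).card

theorem nodePotential_anti (A a : ℕ) {b c : ℕ} (h : b ≤ c) :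
    nodePotential A a c ≤ nodePotential A a b :=
  Finset.card_le_card (Finset.monotone_filter_right _ fun _ _ hq => h.trans_lt hq)

theorem nodePotential_le (A a b : ℕ) : nodePotential A a b ≤ A * a :=
  (Finset.card_filter_le _ _).trans (by simp)

theorem nodePotential_self (A a : ℕ) : nodePotential A a a = A * a := by
  unfold nodePotential
  rw [Finset.filter_true_of_mem]
  · simp
  · intro q _
    rw [Function.iterate_succ_apply']
    exact (le_iterate_fastGrowing _ _ _).trans_lt (lt_fastGrowing _ _)

/-- A node loses potential when it is linked past a higher node of the same level `k`. Let `a`, `b`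
be the ranks of the node and of its parent, `a'` the rank of the higher node, and `c` the rank of
the new parent. -/
theorem nodePotential_lt {A k a b a' c : ℕ} (ha : 1 ≤ a) (hab : fastGrowing k a ≤ b)
    (hb : b < fastGrowing (k + 1) a) (hba : b ≤ a') (hc : fastGrowing k a' ≤ c)
    (hA : c < fastGrowing A 1) : nodePotential A a c < nodePotential A a b := by
  have hbc : b ≤ c := hba.trans ((lt_fastGrowing k a').le.trans hc)
  have hlt : ∀ k', fastGrowing k' a ≤ c → k' < A := by
    intro k' h
    by_contra hk
    have h1 := (fastGrowing_mono_left a) (not_lt.1 hk)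
    have h2 := (fastGrowing_strictMono A).monotone ha
    simp only at h1
    omega
  -- one pair that is counted for `b`, but not for `c`
  suffices h : ∃ k' i, k' < A ∧ i < a ∧ b < (fastGrowing k')^[i + 1] a ∧
      (fastGrowing k')^[i + 1] a ≤ c by
    obtain ⟨k', i, hk, hi, h1, h2⟩ := h
    refine Finset.card_lt_card ⟨Finset.monotone_filter_right _ fun _ _ hq => hbc.trans_lt hq,
      fun hss => ?_⟩
    have hm : (k', i) ∈ (Finset.range A ×ˢ Finset.range a).filter
        fun q => b < (fastGrowing q.1)^[q.2 + 1] a :=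
      Finset.mem_filter.2 ⟨by simp [hk, hi], h1⟩
    have := (Finset.mem_filter.1 (hss hm)).2
    exact absurd this (not_lt.2 h2)
  by_cases hex : ∃ i, i < a ∧ b < (fastGrowing k)^[i + 1] a
  · have hmin := fun j => Nat.find_min (m := j) hex
    obtain ⟨hi, hbi⟩ := Nat.find_spec hex
    generalize Nat.find hex = i at hi hbi hmin
    refine ⟨k, i, hlt k ?_, hi, hbi, ?_⟩
    · exact ((fastGrowing_strictMono k).monotone
        ((lt_fastGrowing k a).le.trans (hab.trans hba))).trans hc
    · obtain _ | i := i
      · simp only [zero_add, Function.iterate_one] at hbi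
        omega
      · have h3 : (fastGrowing k)^[i + 1] a ≤ b := by
          by_contra hcon
          exact hmin i (Nat.lt_succ_self i) ⟨by omega, not_le.1 hcon⟩
        rw [Function.iterate_succ_apply']
        exact ((fastGrowing_strictMono k).monotone (h3.trans hba)).trans hc
  · push Not at hex
    have h1 : (fastGrowing k)^[a] a ≤ b := by
      obtain ⟨a0, rfl⟩ : ∃ a0, a = a0 + 1 := ⟨a - 1, by omega⟩
      exact hex a0 (Nat.lt_succ_self _)
    have h2 : fastGrowing (k + 1) a ≤ c := by
      rw [fastGrowing_succ, Function.iterate_succ_apply']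
      exact ((fastGrowing_strictMono k).monotone (h1.trans hba)).trans hc
    exact ⟨k + 1, 0, hlt _ h2, ha, by simpa using hb, by simpa using h2⟩

/-- The level of a node of rank `a` whose parent has rank `b`: the largest `k` with `F k a ≤ b`.
Nodes of rank `0` get the extra level `A`. -/
def level (A a b : ℕ) : ℕ :=
  if a = 0 then A else Nat.findGreatest (fun k => fastGrowing k a ≤ b) A

theorem level_le (A a b : ℕ) : level A a b ≤ A := by
  unfold level
  split_ifs
  · exact le_rfl
  · exact Nat.findGreatest_le A

theorem level_spec {A a b : ℕ} (ha : 1 ≤ a) (hab : a < b) (hb : b < fastGrowing A 1) :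
    level A a b < A ∧ fastGrowing (level A a b) a ≤ b ∧ b < fastGrowing (level A a b + 1) a := by
  have h0 : level A a b = Nat.findGreatest (fun k => fastGrowing k a ≤ b) A := by
    simp [level, Nat.one_le_iff_ne_zero.1 ha]
  have h1 : fastGrowing (level A a b) a ≤ b := by
    rw [h0]
    exact Nat.findGreatest_spec (P := fun k => fastGrowing k a ≤ b) (Nat.zero_le A)
      (by simpa [fastGrowing] using hab)
  have h2 : level A a b < A := by
    refine lt_of_le_of_ne (level_le A a b) fun h => ?_
    have := (fastGrowing_strictMono A).monotone ha
    rw [h] at h1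
    omega
  refine ⟨h2, h1, ?_⟩
  by_contra hcon
  have := Nat.le_findGreatest (P := fun k => fastGrowing k a ≤ b) (Nat.succ_le_of_lt h2)
    (not_lt.1 hcon)
  omega

/-- `p` and `rk` are the parents and ranks of a union-find forest on the nodes below `n`, and `rt`
maps every node to its root. Ranks are bounded by the number of links made so far, i.e. the number
of nodes that are not roots. -/
structure Forest (n : ℕ) (p rk rt : ℕ → ℕ) : Prop where
  parent_lt : ∀ v < n, p v < n
  root_lt : ∀ v < n, rt v < n
  root_parent : ∀ v < n, rt (p v) = rt v
  parent_root : ∀ v < n, p (rt v) = rt v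
  root_eq : ∀ v < n, p v = v → rt v = v
  rank_lt : ∀ v < n, p v ≠ v → rk v < rk (p v)
  rank_le : ∀ v < n, rk v ≤ ((Finset.range n).filter fun u => p u ≠ u).card

/-- The potential of a forest on the nodes below `n`. -/
def potential (A n : ℕ) (p rk : ℕ → ℕ) : ℕ :=
  ∑ v ∈ Finset.range n, nodePotential A (rk v) (rk (p v))

/-- `RootPath p d u r`: the path from `u` to its root `r` has `d` edges. -/
inductive RootPath (p : ℕ → ℕ) : ℕ → ℕ → ℕ → Prop
  | root {r : ℕ} (h : p r = r) : RootPath p 0 r r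
  | step {d u r : ℕ} (h : p u ≠ u) (hp : RootPath p d (p u) r) : RootPath p (d + 1) u r

/-- `Compress r p u p' k`: compressing the path from `u` to the root `r` changes the parents from
`p` to `p'` and takes `k` changes. -/
inductive Compress (r : ℕ) : (ℕ → ℕ) → ℕ → (ℕ → ℕ) → ℕ → Prop
  | done {p : ℕ → ℕ} {u : ℕ} (h : p u = r) : Compress r p u p 0
  | step {p p' : ℕ → ℕ} {u k : ℕ} (h : p u ≠ r)
      (hc : Compress r (Function.update p u r) (p u) p' k) : Compress r p u p' (k + 1)

namespace Forest

variable {n : ℕ} {p rk rt : ℕ → ℕ}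

theorem rank_lt_size (h : Forest n p rk rt) {v : ℕ} (hv : v < n) : rk v < n := by
  refine (h.rank_le v hv).trans_lt ?_
  calc _ < (Finset.range n).card := Finset.card_lt_card ⟨Finset.filter_subset _ _, fun hss => by
          have := (Finset.mem_filter.1 (hss (Finset.mem_range.2 (h.root_lt v hv)))).2
          exact this (h.parent_root v hv)⟩
    _ = n := Finset.card_range n

theorem root_root (h : Forest n p rk rt) {v : ℕ} (hv : v < n) : rt (rt v) = rt v :=
  h.root_eq _ (h.root_lt v hv) (h.parent_root v hv)

theorem exists_rootPath (h : Forest n p rk rt) {u : ℕ} (hu : u < n) :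
    ∃ d, RootPath p d u (rt u) := by
  induction hk : n - rk u using Nat.strong_induction_on generalizing u with
  | _ k ih =>
    by_cases hp : p u = u
    · exact ⟨0, by rw [h.root_eq u hu hp]; exact .root hp⟩
    · have h1 := h.rank_lt u hu hp
      have h2 := h.rank_lt_size (h.parent_lt u hu)
      obtain ⟨d, hd⟩ := ih (n - rk (p u)) (by omega) (h.parent_lt u hu) rfl
      rw [h.root_parent u hu] at hd
      exact ⟨d + 1, .step hp hd⟩

theorem rank_le_rank_root (h : Forest n p rk rt) {u : ℕ} (hu : u < n) : rk u ≤ rk (rt u) := by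
  obtain ⟨d, hd⟩ := h.exists_rootPath hu
  generalize rt u = r at hd
  induction hd with
  | root => exact le_rfl
  | step hp _ ih => exact (h.rank_lt _ hu hp).le.trans (ih (h.parent_lt _ hu))

theorem rank_lt_rank_root (h : Forest n p rk rt) {u : ℕ} (hu : u < n) (hp : p u ≠ u) :
    rk u < rk (rt u) := by
  have := h.rank_le_rank_root (h.parent_lt u hu)
  rw [h.root_parent u hu] at this
  exact (h.rank_lt u hu hp).trans_le this

theorem iterate_lt (h : Forest n p rk rt) {u : ℕ} (hu : u < n) (j : ℕ) : p^[j] u < n := by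
  induction j with
  | zero => exact hu
  | succ j ih => rw [Function.iterate_succ_apply']; exact h.parent_lt _ ih

theorem root_iterate (h : Forest n p rk rt) {u : ℕ} (hu : u < n) (j : ℕ) :
    rt (p^[j] u) = rt u := by
  induction j with
  | zero => rfl
  | succ j ih => rw [Function.iterate_succ_apply', h.root_parent _ (h.iterate_lt hu j), ih]

theorem rank_le_iterate (h : Forest n p rk rt) {u : ℕ} (hu : u < n) (j : ℕ) :
    rk u ≤ rk (p^[j] u) := by
  induction j with
  | zero => rfl
  | succ j ih =>
    rw [Function.iterate_succ_apply']
    by_cases hp : p (p^[j] u) = p^[j] u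
    · rwa [hp]
    · exact ih.trans (h.rank_lt _ (h.iterate_lt hu j) hp).le

/-- A single step of path compression. -/
theorem update_root (h : Forest n p rk rt) {u : ℕ} (hu : u < n) (hp : p u ≠ u) :
    Forest n (Function.update p u (rt u)) rk rt := by
  have hru : rt u ≠ u := fun e => hp (by rw [← e]; exact h.parent_root u hu)
  have hfix : ∀ v, Function.update p u (rt u) v ≠ v ↔ p v ≠ v := by
    intro v
    by_cases hv : v = u
    · subst hv; simp [hru, hp]
    · simp [hv]
  refine ⟨fun v hv => ?_, h.root_lt, fun v hv => ?_, fun v hv => ?_, fun v hv hv' => ?_,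
    fun v hv hv' => ?_, fun v hv => ?_⟩
  · by_cases e : v = u
    · subst e; simpa using h.root_lt v hv
    · simpa [e] using h.parent_lt v hv
  · by_cases e : v = u
    · subst e; simpa using h.root_root hv
    · simpa [e] using h.root_parent v hv
  · exact not_not.1 fun hcon => (hfix _).1 hcon (h.parent_root v hv)
  · exact h.root_eq v hv (not_not.1 fun hcon => (hfix v).2 hcon hv')
  · by_cases e : v = u
    · subst e; simpa using h.rank_lt_rank_root hv hp
    · simpa [e] using h.rank_lt v hv (by simpa [e] using hv')
  · simpa only [hfix] using h.rank_le v hv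

theorem iterate_update (h : Forest n p rk rt) {u : ℕ} (hu : u < n) (hp : p u ≠ u) (r j : ℕ) :
    (Function.update p u r)^[j] (p u) = p^[j] (p u) := by
  induction j with
  | zero => rfl
  | succ j ih =>
    rw [Function.iterate_succ_apply', Function.iterate_succ_apply', ih, Function.update_of_ne]
    intro e
    have h1 := h.rank_le_iterate (h.parent_lt u hu) j
    have h2 := h.rank_lt u hu hp
    rw [e] at h1
    omega

theorem rootPath_update (h : Forest n p rk rt) {u d r' : ℕ} (hu : u < n) (hp : p u ≠ u) (r : ℕ)
    (hd : RootPath p d (p u) r') : RootPath (Function.update p u r) d (p u) r' := by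
  have h1 : ∀ d w r', w < n → rk u < rk w → RootPath p d w r' →
      RootPath (Function.update p u r) d w r' := by
    intro d w r' hw hr hd
    induction hd with
    | @root w hp' =>
      have : w ≠ u := fun e => by simp [e] at hr
      exact .root (by simpa [this] using hp')
    | @step d w r' hp' _ ih =>
      have hne : w ≠ u := fun e => by simp [e] at hr
      refine .step (by simpa [hne] using hp') ?_
      simpa [hne] using ih (h.parent_lt w hw) (hr.trans (h.rank_lt w hw hp'))
  exact h1 _ _ _ (h.parent_lt u hu) (h.rank_lt u hu hp) hd

theorem potential_update (A : ℕ) {u : ℕ} (hu : u < n) (r : ℕ) :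
    potential A n (Function.update p u r) rk + nodePotential A (rk u) (rk (p u)) =
      potential A n p rk + nodePotential A (rk u) (rk r) := by
  unfold potential
  rw [← Finset.add_sum_erase _ _ (Finset.mem_range.2 hu),
    ← Finset.add_sum_erase (f := fun v => nodePotential A (rk v) (rk (p v))) _
      (Finset.mem_range.2 hu)]
  have : ∑ x ∈ (Finset.range n).erase u,
      nodePotential A (rk x) (rk (Function.update p u r x)) =
      ∑ x ∈ (Finset.range n).erase u, nodePotential A (rk x) (rk (p x)) :=
    Finset.sum_congr rfl fun x hx => by rw [Function.update_of_ne (Finset.ne_of_mem_erase hx)]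
  rw [this, Function.update_self]
  ring

/-- Path compression pays for itself, up to one unit per level: a node whose level occurs again
further up on the path loses potential, and the other nodes have distinct levels. The set `S`
contains the levels of all nodes on the path. -/
theorem exists_compress_aux {A : ℕ} (hA : n ≤ fastGrowing A 1) {d u r : ℕ}
    (hd : RootPath p d u r) (h : Forest n p rk rt) (hu : u < n) (hr : rt u = r) (S : Finset ℕ)
    (hS : ∀ j, p (p^[j] u) ≠ p^[j] u → level A (rk (p^[j] u)) (rk (p (p^[j] u))) ∈ S) :
    ∃ p' k, Compress r p u p' k ∧ d ≤ k + 1 ∧ k ≤ d ∧ Forest n p' rk rt ∧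
      potential A n p' rk + k ≤ potential A n p rk + S.card := by
  induction d generalizing p u S with
  | zero =>
    cases hd with
    | root hp => exact ⟨p, 0, .done hp, by omega, by omega, h, by omega⟩
  | succ d ih =>
    cases hd with
    | step hp hd =>
    by_cases hpr : p u = r
    · refine ⟨p, 0, .done hpr, ?_, by omega, h, by omega⟩
      cases hd with
      | root => omega
      | step hne _ =>
        have := h.parent_root u hu
        rw [hr, ← hpr] at this
        exact absurd this hne
    · have hF : Forest n (Function.update p u r) rk rt := hr ▸ h.update_root hu hp
      have hit := h.iterate_update hu hp r
      have hpu := h.parent_lt u hu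
      have hlev : ∀ j, Function.update p u r (p^[j] (p u)) = p (p^[j] (p u)) := by
        intro j
        have := hit (j + 1)
        rwa [Function.iterate_succ_apply', Function.iterate_succ_apply', hit] at this
      have hrank := h.rank_lt u hu hp
      have hle : rk (p u) ≤ rk r := by
        rw [← hr, ← h.root_parent u hu]; exact h.rank_le_rank_root hpu
      have hrn : rk r < n := hr ▸ h.rank_lt_size (h.root_lt u hu)
      have hpot := potential_update (p := p) (rk := rk) A hu r
      have hanti := nodePotential_anti A (rk u) hle
      have hShead := hS 0 hp
      simp only [Function.iterate_zero, id_eq] at hShead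
      by_cases hex : ∃ j, p (p^[j] (p u)) ≠ p^[j] (p u) ∧
          level A (rk (p^[j] (p u))) (rk (p (p^[j] (p u)))) = level A (rk u) (rk (p u))
      · obtain ⟨p', k, hc, h1, h2, h3, h4⟩ := ih (h.rootPath_update hu hp r hd) hF hpu
          (by rw [h.root_parent u hu, hr]) S (by
            intro j hj
            rw [hit, hlev] at hj ⊢
            exact hS (j + 1) hj)
        refine ⟨p', k + 1, .step hpr hc, by omega, by omega, h3, ?_⟩
        obtain ⟨j, hj1, hj2⟩ := hex
        have hyn := h.iterate_lt hpu j
        have hypn := h.parent_lt _ hyn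
        have hry := h.rank_lt _ hyn hj1
        have hrk0 := h.rank_le_iterate hpu j
        have hyr : rk (p (p^[j] (p u))) ≤ rk r := by
          have := h.rank_le_rank_root hypn
          rwa [h.root_parent _ hyn, h.root_iterate hpu, h.root_parent u hu, hr] at this
        obtain ⟨l1, l2, l3⟩ := level_spec (A := A) (a := rk (p^[j] (p u))) (by omega) hry
          (by omega)
        -- a later node has positive rank, so that its level is not the one of rank zero
        have hu1 : 1 ≤ rk u := by
          by_contra hcon
          have h0 : rk u = 0 := by omega
          rw [hj2, h0] at l1
          simp [level] at l1
        obtain ⟨m1, m2, m3⟩ := level_spec (A := A) hu1 hrank (by omega)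
        rw [hj2] at l2
        have hdrop := nodePotential_lt (A := A) hu1 m2 m3 hrk0 (l2.trans hyr) (by omega)
        omega
      · obtain ⟨p', k, hc, h1, h2, h3, h4⟩ := ih (h.rootPath_update hu hp r hd) hF hpu
          (by rw [h.root_parent u hu, hr]) (S.erase (level A (rk u) (rk (p u)))) (by
            intro j hj
            rw [hit, hlev] at hj ⊢
            exact Finset.mem_erase.2 ⟨fun e => hex ⟨j, hj, e⟩, hS (j + 1) hj⟩)
        refine ⟨p', k + 1, .step hpr hc, by omega, by omega, h3, ?_⟩
        have := Finset.card_erase_add_one hShead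
        omega

theorem exists_compress {A : ℕ} (hA : n ≤ fastGrowing A 1) {d u : ℕ}
    (h : Forest n p rk rt) (hu : u < n) (hd : RootPath p d u (rt u)) :
    ∃ p' k, Compress (rt u) p u p' k ∧ d ≤ k + 1 ∧ k ≤ d ∧ Forest n p' rk rt ∧
      potential A n p' rk + k ≤ potential A n p rk + (A + 1) := by
  simpa using exists_compress_aux hA hd h hu rfl (Finset.range (A + 1))
    fun j _ => Finset.mem_range.2 (Nat.lt_succ_of_le (level_le _ _ _))

/-- Linking the root `a` below the root `b` of no smaller rank. -/
theorem link (h : Forest n p rk rt) {a b : ℕ} (ha : a < n) (hb : b < n) (hpa : p a = a)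
    (hpb : p b = b) (hab : a ≠ b) {rk' : ℕ → ℕ} (hrk' : rk a < rk' b) (hle : rk b ≤ rk' b)
    (hle' : rk' b ≤ rk b + 1) (hne : ∀ v, v ≠ b → rk' v = rk v) :
    Forest n (Function.update p a b) rk' fun v => if rt v = a then b else rt v := by
  have hra := h.root_eq a ha hpa
  have hrb := h.root_eq b hb hpb
  have hmono : ∀ v, rk v ≤ rk' v := fun v => by
    by_cases e : v = b
    · rwa [e]
    · rw [hne v e]
  have hcard : ((Finset.range n).filter fun u => Function.update p a b u ≠ u).card =
      ((Finset.range n).filter fun u => p u ≠ u).card + 1 := by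
    rw [← Finset.card_insert_of_notMem (a := a) (by simp [hpa])]
    congr 1
    ext v
    by_cases e : v = a
    · subst e; simp [ha, hab.symm]
    · simp [e]
  refine ⟨fun v hv => ?_, fun v hv => ?_, fun v hv => ?_, fun v hv => ?_, fun v hv hv' => ?_,
    fun v hv hv' => ?_, fun v hv => ?_⟩
  · by_cases e : v = a
    · subst e; simpa using hb
    · simpa [e] using h.parent_lt v hv
  · split_ifs
    · exact hb
    · exact h.root_lt v hv
  · by_cases e : v = a
    · subst e; simp [hra, hrb]
    · simp [e, h.root_parent v hv]
  · split_ifs with e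
    · rw [Function.update_of_ne hab.symm, hpb]
    · rw [Function.update_of_ne e, h.parent_root v hv]
  · by_cases e : v = a
    · subst e; simp at hv'; exact absurd hv'.symm hab
    · rw [Function.update_of_ne e] at hv'
      simp [h.root_eq v hv hv', e]
  · by_cases e : v = a
    · subst e
      simpa [hne v hab] using hrk'
    · rw [Function.update_of_ne e] at hv' ⊢
      have hvb : v ≠ b := fun e => hv' (e ▸ hpb)
      rw [hne v hvb]
      exact (h.rank_lt v hv hv').trans_le (hmono _)
  · rw [hcard]
    by_cases e : v = b
    · subst e; exact hle'.trans (Nat.succ_le_succ (h.rank_le v hv))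
    · rw [hne v e]; exact (h.rank_le v hv).trans (Nat.le_succ _)

/-- Linking costs at most `A` units of potential, for the rank of the new root. -/
theorem potential_link (A : ℕ) {a b : ℕ} (hb : b < n)
    (hpa : p a = a) (hpb : p b = b) (hab : a ≠ b) {rk' : ℕ → ℕ} (hrk' : rk a < rk' b)
    (hle : rk b ≤ rk' b) (hle' : rk' b ≤ rk b + 1) (hne : ∀ v, v ≠ b → rk' v = rk v) :
    potential A n (Function.update p a b) rk' ≤ potential A n p rk + A := by
  unfold potential
  rw [← Finset.add_sum_erase _ _ (Finset.mem_range.2 hb),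
    ← Finset.add_sum_erase (f := fun v => nodePotential A (rk v) (rk (p v))) _
      (Finset.mem_range.2 hb)]
  have h1 : nodePotential A (rk' b) (rk' (Function.update p a b b)) ≤
      nodePotential A (rk b) (rk (p b)) + A := by
    rw [Function.update_of_ne hab.symm, hpb, nodePotential_self, nodePotential_self]
    calc A * rk' b ≤ A * (rk b + 1) := Nat.mul_le_mul_left _ hle'
      _ = A * rk b + A := by ring
  have h2 : ∑ x ∈ (Finset.range n).erase b,
      nodePotential A (rk' x) (rk' (Function.update p a b x)) ≤
      ∑ x ∈ (Finset.range n).erase b, nodePotential A (rk x) (rk (p x)) := by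
    refine Finset.sum_le_sum fun x hx => ?_
    rw [hne x (Finset.ne_of_mem_erase hx)]
    refine nodePotential_anti _ _ ?_
    by_cases e : x = a
    · subst e; rw [Function.update_self, hpa]; exact hrk'.le
    · rw [Function.update_of_ne e]
      by_cases e' : p x = b
      · rw [e']; exact hle
      · rw [hne _ e']
  omega

end Forest

theorem potential_zero (A n : ℕ) (p rk : ℕ → ℕ) (h : ∀ v < n, rk v = 0) :
    potential A n p rk = 0 := by
  refine Finset.sum_eq_zero fun v hv => ?_
  have := nodePotential_le A (rk v) (rk (p v))
  rw [h v (Finset.mem_range.1 hv)] at this ⊢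
  omega

theorem forest_init {n : ℕ} {p rk : ℕ → ℕ} (hp : ∀ v < n, p v = v) (hrk : ∀ v < n, rk v = 0) :
    Forest n p rk id :=
  ⟨fun v hv => by rwa [hp v hv], fun v hv => hv, hp, hp, fun _ _ _ => rfl,
    fun v hv h => absurd (hp v hv) h, fun v hv => by rw [hrk v hv]; exact Nat.zero_le _⟩

/-- The union-find structure with parents `p`, ranks `rk` and representatives `name` of the roots
represents the partition of the numbers below `n` into the fibers of `rep`; the representative of
the set of `v` is `rep v`, which need not be the root. -/
def Represents (n : ℕ) (p rk name rep : ℕ → ℕ) : Prop :=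
  ∃ rt, Forest n p rk rt ∧ (∀ v < n, rep v < n) ∧ (∀ v < n, name (rt v) = rep v) ∧
    ∀ u < n, ∀ v < n, rep u = rep v → rt u = rt v

end UnionFind

/-! ### Time credits for programs -/

namespace RAM

variable {R A : Type} [DecidableEq R] [DecidableEq A] {N : ℕ}

/-- The program `c`, started in the state `s` with `T` units of time to spend, halts in time, in a
state that satisfies the postcondition `Q` together with the time that is left. -/
def Runs (N : ℕ) (c : Cmd R A) (T : ℕ) (s : State R A) (Q : ℕ → State R A → Prop) : Prop :=
  ∃ t s' T', Exec N c s t s' ∧ t + T' = T ∧ Q T' s'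

theorem runs_skip {T : ℕ} {s : State R A} {Q : ℕ → State R A → Prop} :
    Runs N .skip T s Q ↔ 1 ≤ T ∧ Q (T - 1) s := by
  constructor
  · rintro ⟨t, s', T', h1, h2, h3⟩
    cases h1
    exact ⟨by omega, by rwa [← h2, Nat.add_sub_cancel_left]⟩
  · rintro ⟨h1, h2⟩
    exact ⟨_, _, _, .skip s, by omega, h2⟩

theorem runs_assign {r : R} {e : Expr R A} {T : ℕ} {s : State R A}
    {Q : ℕ → State R A → Prop} :
    Runs N (.assign r e) T s Q ↔ e.Fits N s ∧ e.cost + 1 ≤ T ∧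
      Q (T - (e.cost + 1)) ⟨Function.update s.reg r (e.eval s), s.arr, s.out⟩ := by
  constructor
  · rintro ⟨t, s', T', h1, h2, h3⟩
    cases h1
    exact ⟨by assumption, by omega, by rwa [← h2, Nat.add_sub_cancel_left]⟩
  · rintro ⟨h0, h1, h2⟩
    exact ⟨_, _, _, .assign s r e h0, by omega, h2⟩

theorem runs_store {a : A} {i e : Expr R A} {T : ℕ} {s : State R A}
    {Q : ℕ → State R A → Prop} :
    Runs N (.store a i e) T s Q ↔ i.Fits N s ∧ e.Fits N s ∧ i.cost + e.cost + 1 ≤ T ∧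
      Q (T - (i.cost + e.cost + 1)) ⟨s.reg, Function.update s.arr a
        (Function.update (s.arr a) (i.eval s) (e.eval s)), s.out⟩ := by
  constructor
  · rintro ⟨t, s', T', h1, h2, h3⟩
    cases h1
    exact ⟨by assumption, by assumption, by omega, by rwa [← h2, Nat.add_sub_cancel_left]⟩
  · rintro ⟨h0, h0', h1, h2⟩
    exact ⟨_, _, _, .store s a i e h0 h0', by omega, h2⟩

theorem runs_emit {e f : Expr R A} {T : ℕ} {s : State R A} {Q : ℕ → State R A → Prop} :
    Runs N (.emit e f) T s Q ↔ e.Fits N s ∧ f.Fits N s ∧ e.cost + f.cost + 1 ≤ T ∧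
      Q (T - (e.cost + f.cost + 1)) ⟨s.reg, s.arr, s.out ++ [(e.eval s, f.eval s)]⟩ := by
  constructor
  · rintro ⟨t, s', T', h1, h2, h3⟩
    cases h1
    exact ⟨by assumption, by assumption, by omega, by rwa [← h2, Nat.add_sub_cancel_left]⟩
  · rintro ⟨h0, h0', h1, h2⟩
    exact ⟨_, _, _, .emit s e f h0 h0', by omega, h2⟩

theorem runs_seq {c d : Cmd R A} {T : ℕ} {s : State R A} {Q : ℕ → State R A → Prop} :
    Runs N (.seq c d) T s Q ↔ Runs N c T s fun T' s' => Runs N d T' s' Q := by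
  constructor
  · rintro ⟨t, s', T', h1, h2, h3⟩
    cases h1 with
    | @seq _ _ _ s1 _ t t' hc hd =>
      exact ⟨t, s1, t' + T', hc, by omega, t', s', T', hd, rfl, h3⟩
  · rintro ⟨t, s1, T', hc, h2, t', s', T'', hd, h3, h4⟩
    exact ⟨_, _, _, .seq hc hd, by omega, h4⟩

theorem runs_ite {b : Cond R A} {c d : Cmd R A} {T : ℕ} {s : State R A}
    {Q : ℕ → State R A → Prop} :
    Runs N (.ite b c d) T s Q ↔ b.Fits N s ∧ b.cost ≤ T ∧
      (b.Holds s → Runs N c (T - b.cost) s Q) ∧ (¬ b.Holds s → Runs N d (T - b.cost) s Q) := by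
  constructor
  · rintro ⟨t, s', T', h1, h2, h3⟩
    cases h1 with
    | @iteTrue _ _ _ _ _ t hf hb hc =>
      exact ⟨hf, by omega, fun _ => ⟨t, s', T', hc, by omega, h3⟩, fun h => absurd hb h⟩
    | @iteFalse _ _ _ _ _ t hf hb hc =>
      exact ⟨hf, by omega, fun h => absurd h hb, fun _ => ⟨t, s', T', hc, by omega, h3⟩⟩
  · rintro ⟨hf, h1, h2, h3⟩
    by_cases hb : b.Holds s
    · obtain ⟨t, s', T', h4, h5, h6⟩ := h2 hb
      exact ⟨_, _, T', .iteTrue hf hb h4, by omega, h6⟩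
    · obtain ⟨t, s', T', h4, h5, h6⟩ := h3 hb
      exact ⟨_, _, T', .iteFalse hf hb h4, by omega, h6⟩

/-- A loop with the invariant `I`, which relates the state to the time that is left. Every test
takes time, so that the loop terminates. -/
theorem runs_while {b : Cond R A} {c : Cmd R A} {Q : ℕ → State R A → Prop}
    (I : ℕ → State R A → Prop)
    (hI : ∀ T s, I T s → b.Fits N s ∧ b.cost ≤ T ∧
      (b.Holds s → Runs N c (T - b.cost) s I) ∧ (¬ b.Holds s → Q (T - b.cost) s))
    {T : ℕ} {s : State R A} (h : I T s) : Runs N (.while b c) T s Q := by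
  induction T using Nat.strong_induction_on generalizing s with
  | _ T ih =>
    obtain ⟨hf, h1, h2, h3⟩ := hI T s h
    have hpos : 0 < b.cost := by cases b <;> simp [Cond.cost]
    by_cases hb : b.Holds s
    · obtain ⟨t, s1, T1, h4, h5, h6⟩ := h2 hb
      obtain ⟨t', s', T', h7, h8, h9⟩ := ih T1 (by omega) h6
      exact ⟨_, s', T', .whileTrue hf hb h4 h7, by omega, h9⟩
    · exact ⟨_, _, _, .whileFalse hf hb, by omega, h3 hb⟩

@[simp] theorem runs_block_nil {T : ℕ} {s : State R A} {Q : ℕ → State R A → Prop} :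
    Runs N (Cmd.block []) T s Q ↔ 1 ≤ T ∧ Q (T - 1) s := runs_skip

@[simp] theorem runs_block_cons {c : Cmd R A} {cs : List (Cmd R A)} {T : ℕ} {s : State R A}
    {Q : ℕ → State R A → Prop} :
    Runs N (Cmd.block (c :: cs)) T s Q ↔
      Runs N c T s fun T' s' => Runs N (Cmd.block cs) T' s' Q := runs_seq

attribute [simp] runs_skip runs_assign runs_store runs_emit runs_ite Expr.eval Expr.cost
  Expr.Fits Cond.Holds Cond.cost Cond.Fits

end RAM

/-! ### Lookups -/

namespace ContractionGraph

open RAM UnionFind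

attribute [simp] val at' zero one increment

variable {n N M A : ℕ} {rk rt : ℕ → ℕ}

/-- The first loop of `findRoot`, on a path with `d` edges. -/
theorem runs_walkToRoot {p : ℕ → ℕ} {d u r : ℕ} (hd : RootPath p d u r) (hN : n ≤ N)
    (hp : ∀ v < n, p v < n) (hu : u < n) {T : ℕ} {s : State Reg Arr} (hs : s.reg .root = u)
    (ha : s.arr .parent = p) (hT : 7 * d + 4 ≤ T) {Q : ℕ → State Reg Arr → Prop}
    (hQ : Q (T - (7 * d + 4)) ⟨Function.update s.reg .root r, s.arr, s.out⟩) :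
    Runs N (.while (.ne (at' .parent .root) (val .root)) (.assign .root (at' .parent .root)))
      T s Q := by
  refine runs_while (fun T s' => ∃ d u, RootPath p d u r ∧ u < n ∧ 7 * d + 4 ≤ T ∧
    s' = ⟨Function.update s.reg .root u, s.arr, s.out⟩ ∧
    Q (T - (7 * d + 4)) ⟨Function.update s.reg .root r, s.arr, s.out⟩) ?_
    ⟨d, u, hd, hu, hT, by rw [← hs, Function.update_eq_self], hQ⟩
  rintro T s' ⟨d, u, hd, hu, hT, rfl, hQ⟩
  have h1 := hp u hu
  cases hd with
  | root h =>
    simp [ha, h]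
    exact ⟨by omega, by omega, by simpa using hQ⟩
  | @step d _ _ h hd =>
    simp [ha, h]
    refine ⟨by omega, by omega, by omega, by omega, d, p u, hd, h1, by omega, rfl, ?_⟩
    convert hQ using 1
    omega

/-- The second loop of `findRoot`, where `k` parents change. -/
theorem runs_compress {r : ℕ} {p p' : ℕ → ℕ} {u k : ℕ} (hc : Compress r p u p' k) (hN : n ≤ N)
    (hp : ∀ v < n, p v < n) (hu : u < n) (hr : r < n) {T : ℕ} {s : State Reg Arr}
    (hs : s.reg .cur = u) (hs' : s.reg .root = r)
    (ha : s.arr .parent = p) (hT : 13 * k + 4 ≤ T) {Q : ℕ → State Reg Arr → Prop}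
    (hQ : ∀ s', (∀ r, r ≠ .cur → r ≠ .up → s'.reg r = s.reg r) → s'.arr .parent = p' →
      (∀ a, a ≠ .parent → s'.arr a = s.arr a) → s'.out = s.out → Q (T - (13 * k + 4)) s') :
    Runs N (.while (.ne (at' .parent .cur) (val .root)) (.block
        [ .assign .up (at' .parent .cur),
          .store .parent (val .cur) (val .root),
          .assign .cur (val .up) ])) T s Q := by
  refine runs_while (fun T₁ s' => ∃ u k, Compress r (s'.arr .parent) u p' k ∧
    (∀ v < n, s'.arr .parent v < n) ∧ u < n ∧ s'.reg .cur = u ∧ 13 * k + 4 ≤ T₁ ∧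
    (∀ r, r ≠ .cur → r ≠ .up → s'.reg r = s.reg r) ∧
    (∀ a, a ≠ .parent → s'.arr a = s.arr a) ∧ s'.out = s.out ∧
    ∀ s', (∀ r, r ≠ .cur → r ≠ .up → s'.reg r = s.reg r) → s'.arr .parent = p' →
      (∀ a, a ≠ .parent → s'.arr a = s.arr a) → s'.out = s.out → Q (T₁ - (13 * k + 4)) s') ?_
    ⟨u, k, ?_⟩
  swap
  · exact ⟨by rwa [ha], by rwa [ha], hu, hs, hT, fun _ _ _ => rfl, fun _ _ => rfl, rfl, hQ⟩
  rintro T₁ s' ⟨u, k, hc, hp, hu, hcur, hT, hreg, harr, hout, hQ⟩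
  have h1 := hp u hu
  have hroot : s'.reg .root = r := by simp [hreg, hs']
  cases hc with
  | done h =>
    simp [hroot, hcur, h]
    exact ⟨by omega, by omega, hQ _ hreg rfl harr hout⟩
  | @step _ _ _ k h hc =>
    simp [hroot, hcur, h]
    and_intros
    all_goals try omega
    refine ⟨k, hc, ?_, h1, by omega, ?_, ?_, hout, ?_⟩
    · intro v hv
      by_cases e : v = u
      · subst e; simpa using hr
      · simpa [e] using hp v hv
    · intro r h1 h2
      simpa [h1, h2] using hreg r h1 h2
    · intro a h1
      simpa [h1] using harr a h1
    · intro s'' h1 h2 h3 h4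
      convert hQ s'' h1 h2 h3 h4 using 1
      omega

/-- A lookup of the vertex `u` costs `O(A)` amortized time, where `20` is the number of steps per
edge of the path. The credit `C` is left to the caller. -/
theorem runs_findRoot {p : ℕ → ℕ} (hA : n ≤ fastGrowing A 1) (h : Forest n p rk rt) {u : ℕ}
    (hu : u < n) {T C : ℕ} {s : State Reg Arr} (hN : n ≤ N) (ha : s.arr .parent = p) {w : Term}
    (hw : ∀ v, w.eval ⟨Function.update s.reg .root v, s.arr, s.out⟩ = u)
    (hwf : ∀ v, w.Fits N ⟨Function.update s.reg .root v, s.arr, s.out⟩)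
    (hw' : w.cost ≤ 3)
    (hT : 20 * potential A n p rk + 20 * (A + 3) + C ≤ T)
    {Q : ℕ → State Reg Arr → Prop}
    (hQ : ∀ T' s', Forest n (s'.arr .parent) rk rt →
      20 * potential A n (s'.arr .parent) rk + C ≤ T' → s'.reg .root = rt u →
      (∀ r, r ≠ .root → r ≠ .cur → r ≠ .up → s'.reg r = s.reg r) →
      (∀ a, a ≠ .parent → s'.arr a = s.arr a) → s'.out = s.out → Q T' s') :
    Runs N (findRoot w) T s Q := by
  obtain ⟨d, hd⟩ := h.exists_rootPath hu
  obtain ⟨p', k, hc, h1, h2, h3, h4⟩ := h.exists_compress hA hu hd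
  have hs : s = ⟨Function.update s.reg .root (s.reg .root), s.arr, s.out⟩ := by simp
  have e1 : w.eval s = u := by rw [hs]; exact hw _
  have e2 : w.Fits N s := by rw [hs]; exact hwf _
  unfold findRoot
  rw [runs_block_cons, runs_assign]
  refine ⟨e2, by omega, ?_⟩
  rw [runs_block_cons, e1]
  refine runs_walkToRoot hd hN h.parent_lt hu (by simp) (by exact ha) (by omega) ?_
  rw [runs_block_cons, runs_assign]
  simp only [Function.update_idem]
  refine ⟨hwf _, by omega, ?_⟩
  rw [runs_block_cons, hw]
  refine runs_compress hc hN h.parent_lt hu (h.root_lt u hu) (by simp) (by simp)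
    (by exact ha) (by omega) ?_
  intro s' g1 g2 g3 g4
  simp
  refine ⟨by omega, hQ _ s' (g2 ▸ h3) (by rw [g2]; omega) (by simp [g1]) ?_ g3 g4⟩
  intro r i1 i2 i3
  simp [g1 r i2 i3, i1, i2]

/-- The union-find part of the memory represents the partition into the fibers of `rep`. -/
def Sets (n : ℕ) (a : Arr → ℕ → ℕ) (rep : ℕ → ℕ) : Prop :=
  Represents n (a .parent) (a .ufRank) (a .name) rep

/-- The time that is saved in the union-find part of the memory. -/
def setCredit (A n : ℕ) (a : Arr → ℕ → ℕ) : ℕ := 20 * potential A n (a .parent) (a .ufRank)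

theorem runs_lookup {rep : ℕ → ℕ} (hA : n ≤ fastGrowing A 1) (hN : n ≤ N) {T C : ℕ}
    {s : State Reg Arr} (h : Sets n s.arr rep) (he : s.reg .e < N)
    (ht : s.arr .target (s.reg .e) < n)
    (hT : setCredit A n s.arr + 20 * (A + 4) + C ≤ T) {Q : ℕ → State Reg Arr → Prop}
    (hQ : ∀ T' s', Sets n s'.arr rep → setCredit A n s'.arr + C ≤ T' →
      s'.reg .v = rep (s.arr .target (s.reg .e)) →
      (∀ r, r ≠ .root → r ≠ .cur → r ≠ .up → r ≠ .v → s'.reg r = s.reg r) →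
      (∀ a, a ≠ .parent → s'.arr a = s.arr a) → s'.out = s.out → Q T' s') :
    Runs N lookup T s Q := by
  obtain ⟨rt, h1, h2, h3, h4⟩ := h
  have hlt := h2 _ ht
  unfold lookup
  unfold setCredit at hT
  rw [runs_block_cons]
  refine runs_findRoot hA (C := C + 20) h1 ht hN rfl (by simp) ?_ (by simp) (by omega) ?_
  · intro v
    simp
    omega
  intro T' s' i1 i2 i3 i4 i5 i6
  simp [i3, i5, h3 _ ht]
  refine ⟨⟨?_, by omega⟩, by omega, by omega, hQ _ _ ⟨rt, ?_, h2, ?_, h4⟩ ?_ (by simp) ?_ i5 i6⟩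
  · have := h1.root_lt _ ht
    omega
  · simpa [i5] using i1
  · simpa [i5] using h3
  · simp only [setCredit, i5, ne_eq, reduceCtorEq, not_false_eq_true]
    omega
  · intro r j1 j2 j3 j4
    simp [j4, i4 r j1 j2 j3]

/-! ### Linked lists of references -/

/-- The references `l` form a linked list that starts at the reference `h` (or is empty, if `h` is
null). -/
def Linked (succ : ℕ → ℕ) : ℕ → List ℕ → Prop
  | h, [] => h = 0
  | h, e :: l => h = e ∧ e ≠ 0 ∧ Linked succ (succ e) l

theorem Linked.head_eq {succ : ℕ → ℕ} {h : ℕ} {l : List ℕ} (hl : Linked succ h l) :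
    h = l.headD 0 := by
  cases l with
  | nil => exact hl
  | cons e l => exact hl.1

theorem Linked.of_append {succ : ℕ → ℕ} {h : ℕ} {l l' : List ℕ} (hl : Linked succ h (l ++ l')) :
    Linked succ (l'.headD 0) l' := by
  induction l generalizing h with
  | nil => exact hl.head_eq ▸ hl
  | cons e l ih => exact ih hl.2.2

theorem Linked.update {succ : ℕ → ℕ} {h e w : ℕ} {l : List ℕ} (hl : Linked succ h l)
    (he : e ∉ l) : Linked (Function.update succ e w) h l := by
  induction l generalizing h with
  | nil => exact hl
  | cons a l ih =>
    simp only [List.mem_cons, not_or] at he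
    refine ⟨hl.1, hl.2.1, ?_⟩
    rw [Function.update_of_ne (Ne.symm he.1)]
    exact ih hl.2.2 he.2

/-- Replacing the tail `l₁` of a linked list by `l₂`. -/
theorem Linked.append {succ : ℕ → ℕ} {h h₂ : ℕ} {l l₁ l₂ : List ℕ} (hl : Linked succ h (l ++ l₁))
    (hne : l ≠ []) (h₂l : Linked succ h₂ l₂) (hd : (l ++ l₂).Nodup) :
    Linked (Function.update succ (l.getLastD 0) h₂) h (l ++ l₂) := by
  induction l generalizing h with
  | nil => exact absurd rfl hne
  | cons a l ih =>
    rw [List.cons_append, List.nodup_cons] at hd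
    refine ⟨hl.1, hl.2.1, ?_⟩
    cases l with
    | nil =>
      change Linked (Function.update succ a h₂) (Function.update succ a h₂ a) l₂
      rw [Function.update_self]
      exact h₂l.update hd.1
    | cons b l =>
      have := ih hl.2.2 (by simp) hd.2
      rw [List.getLastD_cons] at this ⊢
      rw [List.getLastD_cons, Function.update_of_ne]
      · exact this
      · rintro rfl
        exact hd.1 (List.mem_append_left _ List.getLastD_mem_cons)

/-! ### Enumerating the neighbors of a vertex -/

/-- For every vertex `v` of `H`, i.e. every fixed point of `rep`, the list of `v` consists of the
references `ℓ v`. The other lists `ℓ v` are empty. -/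
structure Lists (n M : ℕ) (a : Arr → ℕ → ℕ) (rep : ℕ → ℕ) (ℓ : ℕ → List ℕ) : Prop where
  linked : ∀ v < n, rep v = v → Linked (a .succ) (a .head v) (ℓ v)
  nodup : ∀ v, (ℓ v).Nodup
  disjoint : ∀ u v e, e ∈ ℓ u → e ∈ ℓ v → u = v
  le : ∀ v e, e ∈ ℓ v → e ≤ M
  target_lt : ∀ v e, e ∈ ℓ v → a .target e < n
  dead : ∀ v, rep v ≠ v → ℓ v = []

/-- The array `last` is correct for the vertex `v`. -/
def LastOK (a : Arr → ℕ → ℕ) (ℓ : ℕ → List ℕ) (v : ℕ) : Prop :=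
  ℓ v ≠ [] → a .last v = (ℓ v).getLastD 0

theorem Lists.congr {a a' : Arr → ℕ → ℕ} {rep : ℕ → ℕ} {ℓ : ℕ → List ℕ} (h : Lists n M a rep ℓ)
    (h1 : a' .succ = a .succ) (h2 : a' .head = a .head) (h3 : a' .target = a .target) :
    Lists n M a' rep ℓ :=
  ⟨by rw [h1, h2]; exact h.linked, h.nodup, h.disjoint, h.le, by rw [h3]; exact h.target_lt,
    h.dead⟩

theorem Lists.succ_eq {a : Arr → ℕ → ℕ} {rep : ℕ → ℕ} {ℓ : ℕ → List ℕ} (h : Lists n M a rep ℓ)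
    {x e : ℕ} (hx : x < n) (hr : rep x = x) {l l' : List ℕ} (hl : ℓ x = l ++ e :: l') :
    a .succ e = l'.headD 0 ∧ e ≠ 0 := by
  have := (hl ▸ h.linked x hx hr).of_append
  exact ⟨this.2.2.head_eq, this.2.1⟩

/-- Deletion of a reference from the list of `x`, as done by `enumerateNeighbors`. -/
theorem Lists.delete {a a' : Arr → ℕ → ℕ} {rep : ℕ → ℕ} {ℓ : ℕ → List ℕ} (h : Lists n M a rep ℓ)
    {x e : ℕ} (hx : x < n) (hr : rep x = x) {l l' : List ℕ} (hl : ℓ x = l ++ e :: l')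
    (h1 : a' .succ = if l = [] then a .succ else Function.update (a .succ) (l.getLastD 0)
      (a .succ e))
    (h2 : a' .head = if l = [] then Function.update (a .head) x (a .succ e) else a .head)
    (h3 : a' .target = a .target) :
    Lists n M a' rep (Function.update ℓ x (l ++ l')) := by
  have hsub : (l ++ l').Sublist (ℓ x) := by
    rw [hl]; exact (List.Sublist.refl l).append (List.sublist_cons_self e l')
  have hmem : ∀ v f, f ∈ Function.update ℓ x (l ++ l') v → f ∈ ℓ v := by
    intro v f hf
    by_cases e : v = x
    · subst e; exact hsub.subset (by simpa using hf)
    · simpa [e] using hf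
  have hnd : (l ++ l').Nodup := hsub.nodup (h.nodup x)
  have hlk := h.linked x hx hr
  rw [hl] at hlk
  refine ⟨fun v hv hrv => ?_, fun v => ?_, fun u v f hu hv => h.disjoint u v f (hmem u f hu)
    (hmem v f hv), fun v f hf => h.le v f (hmem v f hf), fun v f hf => by
      rw [h3]; exact h.target_lt v f (hmem v f hf), fun v hv => ?_⟩
  · by_cases e' : v = x
    · subst e'
      rw [Function.update_self, h1, h2]
      by_cases hl0 : l = []
      · subst hl0
        simp only [if_true, Function.update_self, List.nil_append]
        exact hlk.2.2
      · rw [if_neg hl0, if_neg hl0]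
        exact hlk.append hl0 (hlk.of_append).2.2 hnd
    · rw [Function.update_of_ne e', h1, h2]
      have := h.linked v hv hrv
      by_cases hl0 : l = []
      · simpa [hl0, e'] using this
      · rw [if_neg hl0, if_neg hl0]
        refine this.update fun hm => e' (h.disjoint v x _ hm ?_)
        refine hsub.subset (List.mem_append_left _ ?_)
        obtain ⟨b, l0, rfl⟩ := List.exists_cons_of_ne_nil hl0
        rw [List.getLastD_cons]
        exact List.getLastD_mem_cons
  · by_cases e : v = x
    · subst e; simpa using hnd
    · simpa [e] using h.nodup v
  · have : v ≠ x := fun e => hv (e ▸ hr)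
    rw [Function.update_of_ne this, h.dead v hv]

/-- The part of the memory that `enumerateNeighbors` leaves alone. -/
structure Frame (s s' : State Reg Arr) : Prop where
  numVertices : s'.reg .numVertices = s.reg .numVertices
  i : s'.reg .i = s.reg .i
  x : s'.reg .x = s.reg .x
  order : s'.arr .order = s.arr .order
  target : s'.arr .target = s.arr .target
  ufRank : s'.arr .ufRank = s.arr .ufRank
  name : s'.arr .name = s.arr .name
  isSuper : s'.arr .isSuper = s.arr .isSuper

theorem Frame.trans {s₁ s₂ s₃ : State Reg Arr} (h : Frame s₁ s₂) (h' : Frame s₂ s₃) :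
    Frame s₁ s₃ :=
  ⟨h'.1.trans h.1, h'.2.trans h.2, h'.3.trans h.3, h'.4.trans h.4, h'.5.trans h.5,
    h'.6.trans h.6, h'.7.trans h.7, h'.8.trans h.8⟩

/-- The relation `J` holds for the part of the state in which `report` leaves its results: the array
`supers` with its length, and the output. -/
def View (J : ℕ → (ℕ → ℕ) → List (ℕ × ℕ) → Prop) (s : State Reg Arr) : Prop :=
  J (s.reg .numSupers) (s.arr .supers) s.out

/-- The program `report` for a new neighbor `v` takes at most `12` units of time. The relation `J ks` describes
its results after the neighbors `ks` have been reported. -/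
def Reports (N n : ℕ) (report : Program) (s₀ : State Reg Arr)
    (J : List ℕ → ℕ → (ℕ → ℕ) → List (ℕ × ℕ) → Prop) : Prop :=
  ∀ (ks : List ℕ) (s : State Reg Arr) (T : ℕ) (Q : ℕ → State Reg Arr → Prop), Frame s₀ s →
    View (J ks) s → s.reg .v < n → ks.length < n → 12 ≤ T →
    (∀ T' s', T ≤ T' + 12 → View (J (ks ++ [s.reg .v])) s' →
      (∀ r, r ≠ .numSupers → s'.reg r = s.reg r) →
      (∀ a, a ≠ .supers → s'.arr a = s.arr a) → Q T' s') →
    Runs N report T s Q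

/-- The cost of the lookup of a reference and of what `enumerateNeighbors` does with it. -/
def refCost (A : ℕ) : ℕ := 20 * (A + 6)

/-- The second pass of `enumerateNeighbors`, which resets the markers. -/
theorem runs_resetMarkers (hA : n ≤ fastGrowing A 1) (hN : n ≤ N) (hN2 : 2 ≤ N) (hM : M < N)
    {rep : ℕ → ℕ} {ℓ : ℕ → List ℕ} {s : State Reg Arr} {x : ℕ} (hx : x < n)
    (hrx : rep x = x) (hL : Lists n M s.arr rep ℓ) (hS : Sets n s.arr rep)
    (he : s.reg .e = (ℓ x).headD 0)
    (hm : ∀ v < n, v ∉ (ℓ x).map (fun e => rep (s.arr .target e)) → s.arr .marked v = 0)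
    {T C : ℕ} (hT : setCredit A n s.arr + refCost A * (ℓ x).length + 3 + C ≤ T)
    {Q : ℕ → State Reg Arr → Prop}
    (hQ : ∀ T' s', setCredit A n s'.arr + C ≤ T' → Frame s s' → Sets n s'.arr rep →
      (∀ v < n, s'.arr .marked v = 0) → s'.reg .numSupers = s.reg .numSupers →
      s'.arr .supers = s.arr .supers → s'.out = s.out → s'.arr .succ = s.arr .succ →
      s'.arr .head = s.arr .head → s'.arr .last = s.arr .last → Q T' s') :
    Runs N (.while (.ne (val .e) zero) (.block
        [ lookup,
          .store .marked (val .v) zero,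
          .assign .e (at' .succ .e) ])) T s Q := by
  refine runs_while (fun T s' => ∃ l l', ℓ x = l ++ l' ∧ s'.reg .e = l'.headD 0 ∧
    setCredit A n s'.arr + refCost A * l'.length + 3 + C ≤ T ∧ Frame s s' ∧ Sets n s'.arr rep ∧
    (∀ v < n, v ∉ l'.map (fun e => rep (s.arr .target e)) → s'.arr .marked v = 0) ∧
    s'.reg .numSupers = s.reg .numSupers ∧
    s'.arr .supers = s.arr .supers ∧ s'.out = s.out ∧ s'.arr .succ = s.arr .succ ∧
    s'.arr .head = s.arr .head ∧ s'.arr .last = s.arr .last) ?_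
    ⟨[], ℓ x, rfl, he, hT, ⟨rfl, rfl, rfl, rfl, rfl, rfl, rfl, rfl⟩, hS, hm, rfl, rfl, rfl, rfl,
      rfl, rfl⟩
  rintro T s' ⟨l, l', hl, he, hT, hF, hS, hm, h1, h2, h3, h4, h5, h6⟩
  cases l' with
  | nil =>
    simp only [List.headD_nil] at he
    simp only [List.map_nil, List.not_mem_nil, not_false_eq_true, forall_true_left] at hm
    simp [he]
    refine ⟨by omega, by omega, hQ _ _ (by simp at hT; omega) hF hS hm h1 h2 h3 h4 h5 h6⟩
  | cons e l' =>
    obtain ⟨g1, g2⟩ := hL.succ_eq hx hrx hl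
    have hmem : e ∈ ℓ x := by rw [hl]; simp
    have he1 := hL.le x e hmem
    have hte := hL.target_lt x e hmem
    simp only [List.headD_cons] at he
    simp only [List.length_cons, Nat.mul_add, mul_one] at hT
    have hc : refCost A = 20 * (A + 6) := rfl
    have hg1 : l'.headD 0 < N := by
      rw [← h4] at g1
      cases l' with
      | nil => simp; omega
      | cons f l' =>
        have := hL.le x f (by rw [hl]; simp)
        simp
        omega
    refine ⟨by simp [he]; omega, by simp; omega, fun _ => ?_, fun h => absurd (by simp [he, g2]) h⟩
    rw [runs_block_cons]
    refine runs_lookup hA hN (C := refCost A * l'.length + 3 + C + 14) hS (by omega)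
      (by rw [he, hF.target]; exact hte) (by simp; omega) ?_
    intro T' s'' i1 i2 i3 i4 i5 i6
    rw [he, hF.target] at i3
    have hrl : rep (s.arr .target e) < n := by
      obtain ⟨_, _, hh, _⟩ := hS
      exact hh _ hte
    have ie : s''.reg .e = e := by simp [i4, he]
    have isucc : s''.arr .succ e = l'.headD 0 := by simp [i5, h4, g1]
    simp only [runs_block_cons, runs_store, runs_assign, runs_block_nil, val, at', zero, Expr.Fits,
      Expr.eval, Expr.cost, i3, ie, Function.update_self, ne_eq, reduceCtorEq, not_false_eq_true,
      Function.update_of_ne, isucc]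
    refine ⟨by omega, by omega, by omega, ⟨by omega, hg1⟩, by omega, by omega,
      l ++ [e], l', by simp [hl], rfl, ?_, ?_, ?_, ?_, ?_⟩
    · simp [setCredit] at i2 ⊢
      omega
    · exact hF.trans ⟨by simp [i4], by simp [i4], by simp [i4], by simp [i5], by simp [i5],
        by simp [i5], by simp [i5], by simp [i5]⟩
    · simpa [Sets] using i1
    · intro v hv hvl
      by_cases ev : v = rep (s.arr .target e)
      · simp [ev]
      · simp only [Function.update_of_ne ev]
        rw [i5 _ (by simp)]
        exact hm v hv (by simpa [ev] using hvl)
    · simp [i4, i5, i6, h1, h2, h3, h4, h5, h6]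

theorem length_lt_of_nodup {l : List ℕ} {x : ℕ} (h : l.Nodup) (hl : ∀ v ∈ l, v < n) (hx : x < n)
    (hxl : x ∉ l) : l.length < n := by
  have h1 : (x :: l).toFinset ⊆ Finset.range n := by
    intro v hv
    simp only [List.toFinset_cons, Finset.mem_insert, List.mem_toFinset] at hv
    rcases hv with rfl | hv
    · simpa using hx
    · simpa using hl v hv
  have h2 := Finset.card_le_card h1
  rw [List.toFinset_card_of_nodup (List.nodup_cons.2 ⟨hxl, h⟩)] at h2
  simpa using h2

/-- The first pass of `enumerateNeighbors` reports the representatives of the references, except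
`x`, once each, and keeps one reference for each of them. -/
theorem runs_scan (hA : n ≤ fastGrowing A 1) (hN : n ≤ N) (hN2 : 2 ≤ N) (hM : M < N)
    {rep : ℕ → ℕ} {ℓ : ℕ → List ℕ} {s : State Reg Arr} {x : ℕ} (hxs : s.reg .x = x) (hx : x < n)
    (hrx : rep x = x) (hL : Lists n M s.arr rep ℓ) (hS : Sets n s.arr rep)
    (he : s.reg .e = (ℓ x).headD 0) (hprev : s.reg .prev = 0)
    (hm : ∀ v < n, s.arr .marked v = 0)
    {report : Program} {J : List ℕ → ℕ → (ℕ → ℕ) → List (ℕ × ℕ) → Prop}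
    (hrep : Reports N n report s J) (hJ : View (J []) s)
    {T C : ℕ} (hT : setCredit A n s.arr + refCost A * (ℓ x).length + 3 + C ≤ T)
    {Q : ℕ → State Reg Arr → Prop}
    (hQ : ∀ T' s' l, setCredit A n s'.arr + C ≤ T' → Frame s s' → Sets n s'.arr rep →
      l.Sublist (ℓ x) → (l.map fun e => rep (s.arr .target e)).Nodup →
      x ∉ l.map (fun e => rep (s.arr .target e)) →
      (∀ e ∈ ℓ x, rep (s.arr .target e) = x ∨
        rep (s.arr .target e) ∈ l.map fun e => rep (s.arr .target e)) →
      Lists n M s'.arr rep (Function.update ℓ x l) →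
      (∀ v < n, v ∉ l.map (fun e => rep (s.arr .target e)) → s'.arr .marked v = 0) →
      s'.reg .prev = l.getLastD 0 → View (J (l.map fun e => rep (s.arr .target e))) s' →
      s'.arr .last = s.arr .last → Q T' s') :
    Runs N (.while (.ne (val .e) zero) (.block
        [ lookup,
          .ite (.or (.eq (val .v) (val .x)) (.eq (at' .marked .v) one))
            (.ite (.eq (val .prev) zero)
              (.store .head (val .x) (at' .succ .e))
              (.store .succ (val .prev) (at' .succ .e)))
            (.block
              [ .store .marked (val .v) one,
                report,
                .assign .prev (val .e) ]),
          .assign .e (at' .succ .e) ])) T s Q := by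
  obtain ⟨f, hf⟩ : ∃ f : ℕ → ℕ, f = fun e => rep (s.arr .target e) := ⟨_, rfl⟩
  simp only [← hf] at hQ
  have hf' : ∀ e, rep (s.arr .target e) = f e := fun e => by rw [hf]
  simp only [hf'] at hQ
  refine runs_while (fun T s' => ∃ l l', (l ++ l').Sublist (ℓ x) ∧ s'.reg .e = l'.headD 0 ∧
    s'.reg .prev = l.getLastD 0 ∧ setCredit A n s'.arr + refCost A * l'.length + 3 + C ≤ T ∧
    Frame s s' ∧ Sets n s'.arr rep ∧ (l.map f).Nodup ∧ x ∉ l.map f ∧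
    (∀ e ∈ ℓ x, e ∈ l' ∨ f e = x ∨ f e ∈ l.map f) ∧
    Lists n M s'.arr rep (Function.update ℓ x (l ++ l')) ∧
    (∀ v < n, s'.arr .marked v = if v ∈ l.map f then 1 else 0) ∧ View (J (l.map f)) s' ∧
    s'.arr .last = s.arr .last) ?_
    ⟨[], ℓ x, by simp, he, hprev, hT, ⟨rfl, rfl, rfl, rfl, rfl, rfl, rfl, rfl⟩, hS, by simp,
      by simp, fun e he => .inl he, by simpa using hL, by simpa using hm, by simpa using hJ, rfl⟩
  rintro T s' ⟨l, l', hl, he, hprev, hT, hF, hS, hnd, hxl, hcov, hL', hm, hJ, hlast⟩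
  cases l' with
  | nil =>
    simp only [List.headD_nil] at he
    simp only [List.append_nil] at hL' hl
    simp only [List.not_mem_nil, false_or] at hcov
    simp [he]
    exact ⟨by omega, by omega, hQ _ _ l (by simp at hT; omega) hF hS hl hnd hxl hcov hL'
      (fun v hv hvl => by rw [hm v hv, if_neg hvl]) hprev hJ hlast⟩
  | cons e l' =>
    have hup : Function.update ℓ x (l ++ e :: l') x = l ++ e :: l' := Function.update_self _ _ _
    obtain ⟨g1, g2⟩ := hL'.succ_eq hx hrx hup
    have hmem : e ∈ ℓ x := hl.subset (by simp)
    have he1 := hL.le x e hmem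
    have hte := hL.target_lt x e hmem
    simp only [List.headD_cons] at he
    simp only [List.length_cons, Nat.mul_add, mul_one] at hT
    have hc : refCost A = 20 * (A + 6) := rfl
    have hg1 : l'.headD 0 < N := by
      cases l' with
      | nil => simp; omega
      | cons f l' =>
        have := hL.le x f (hl.subset (by simp))
        simp
        omega
    refine ⟨by simp [he]; omega, by simp; omega, fun _ => ?_, fun h => absurd (by simp [he, g2]) h⟩
    rw [runs_block_cons]
    refine runs_lookup hA hN (C := refCost A * l'.length + 3 + C + 36) hS (by omega)
      (by rw [he, hF.target]; exact hte) (by simp; omega) ?_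
    intro T' s'' i1 i2 i3 i4 i5 i6
    rw [he, hF.target, hf'] at i3
    have hrl : f e < n := by
      obtain ⟨_, _, hh, _⟩ := hS
      exact hf' e ▸ hh _ hte
    have ie : s''.reg .e = e := by simp [i4, he]
    have ix : s''.reg .x = x := by simp [i4, hF.x, hxs]
    have ip : s''.reg .prev = l.getLastD 0 := by rw [i4 _ (by simp) (by simp) (by simp) (by simp), hprev]
    have isucc : s''.arr .succ e = l'.headD 0 := by rw [i5 _ (by simp), g1]
    have im : ∀ v < n, s''.arr .marked v = if v ∈ l.map f then 1 else 0 := by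
      rw [i5 _ (by simp)]; exact hm
    have hF' : Frame s s'' := hF.trans ⟨by simp [i4], by simp [i4], by simp [i4], by simp [i5],
      by simp [i5], by simp [i5], by simp [i5], by simp [i5]⟩
    have hL'' : Lists n M s''.arr rep (Function.update ℓ x (l ++ e :: l')) :=
      hL'.congr (i5 _ (by simp)) (i5 _ (by simp)) (i5 _ (by simp))
    have hJ'' : View (J (l.map f)) s'' := by
      unfold View at hJ ⊢
      rwa [i4 _ (by simp) (by simp) (by simp) (by simp), i5 _ (by simp), i6]
    have hlast'' : s''.arr .last = s.arr .last := by rw [i5 _ (by simp), hlast]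
    have hpN : l.getLastD 0 < N ∧ (l.getLastD 0 = 0 ↔ l = []) ∧ (l ≠ [] → l.getLastD 0 ∈ l) := by
      rcases List.eq_nil_or_concat l with rfl | ⟨l0, b, rfl⟩
      · simp; omega
      · have hb : b ∈ ℓ x := hl.subset (by simp)
        obtain ⟨_, hb'⟩ := hL'.succ_eq (e := b) (l := l0) (l' := e :: l') hx hrx (by simp)
        have := hL.le x b hb
        simp [hb']
        omega
    have heN : e < N := by omega
    clear hL' hJ hm hF hS hlast i4 i5 i6 g1 hT he1
    rw [runs_block_cons, runs_ite]
    refine ⟨?_, by simp; omega, ?_, ?_⟩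
    · have hmk : s''.arr .marked (f e) < N := by rw [im _ hrl]; split_ifs <;> omega
      simp [i3, ix]
      omega
    -- first case: the reference is a loop or a duplicate
    · intro hdel
      have hdel' : f e = x ∨ f e ∈ l.map f := by
        simpa [i3, ix, im _ hrl] using hdel
      have hnd' : (l ++ e :: l').Nodup := hl.nodup (hL.nodup x)
      have hcov' : ∀ e ∈ ℓ x, e ∈ l' ∨ f e = x ∨ f e ∈ l.map f := by
        intro e' he'
        rcases hcov e' he' with h | h
        · rcases List.mem_cons.1 h with rfl | h
          · exact .inr hdel'
          · exact .inl h
        · exact .inr h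
      have hsub : (l ++ l').Sublist (ℓ x) :=
        ((List.Sublist.refl l).append (List.sublist_cons_self e l')).trans hl
      rw [runs_ite]
      refine ⟨by simp [ip] ; simp at hpN; omega, by simp; omega, fun hp => ?_, fun hp => ?_⟩
      · have hl0 : l = [] := hpN.2.1.1 (by simpa [ip] using hp)
        subst hl0
        simp only [runs_block_cons, runs_store, runs_assign, runs_block_nil, val, at', zero, one,
          Expr.Fits, Expr.eval, Expr.cost, ie, ix, Function.update_self, ne_eq, reduceCtorEq,
          not_false_eq_true, Function.update_of_ne, isucc, Cond.cost]
        refine ⟨by omega, ⟨by omega, hg1⟩, by omega, ⟨by omega, hg1⟩, by omega, by omega,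
          [], l', hsub, rfl, ?_, ?_, ?_, ?_, hnd, hxl, hcov', ?_, ?_, ?_, ?_⟩
        · simpa using ip
        · simp [setCredit] at i2 ⊢
          omega
        · exact hF'.trans ⟨by simp, by simp, by simp, by simp, by simp, by simp, by simp, by simp⟩
        · simpa [Sets] using i1
        · have := hL''.delete (a' := Function.update s''.arr .head
            (Function.update (s''.arr .head) x (l'.headD 0))) hx hrx hup (by simp)
            (by simp [isucc]) (by simp)
          simpa using this
        · simpa using im
        · simpa [View] using hJ''
        · simpa using hlast''
      · have hl0 : l ≠ [] := fun h => hp (by simp [ip, h])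
        have hne : l.getLastD 0 ≠ e := fun h => by
          have h1 := hpN.2.2 hl0
          rw [h] at h1
          exact (List.nodup_append.1 hnd').2.2 e h1 e (by simp) rfl
        simp only [runs_block_cons, runs_store, runs_assign, runs_block_nil, val, at', zero, one,
          Expr.Fits, Expr.eval, Expr.cost, ie, ip, Function.update_self, ne_eq, reduceCtorEq,
          not_false_eq_true, Function.update_of_ne, isucc, Cond.cost, Function.update_of_ne hne.symm]
        refine ⟨by omega, ⟨by omega, hg1⟩, by omega, ⟨by omega, hg1⟩, by omega, by omega,
          l, l', hsub, rfl, ?_, ?_, ?_, ?_, hnd, hxl, hcov', ?_, ?_, ?_, ?_⟩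
        · rfl
        · simp [setCredit] at i2 ⊢
          omega
        · exact hF'.trans ⟨by simp, by simp, by simp, by simp, by simp, by simp, by simp, by simp⟩
        · simpa [Sets] using i1
        · have := hL''.delete (a' := Function.update s''.arr .succ
            (Function.update (s''.arr .succ) (l.getLastD 0) (l'.headD 0))) hx hrx hup
            (by rw [if_neg hl0, isucc]; simp) (by rw [if_neg hl0]; simp) (by simp)
          simpa using this
        · simpa using im
        · simpa [View] using hJ''
        · simpa using hlast''
    · intro hkeep
      have hkeep' : f e ≠ x ∧ f e ∉ l.map f := by
        simpa [i3, ix, im _ hrl] using hkeep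
      have hlt : ∀ v ∈ l.map f, v < n := by
        intro v hv
        obtain ⟨e', he', rfl⟩ := List.mem_map.1 hv
        obtain ⟨_, _, hh, _⟩ := i1
        rw [← hf']
        exact hh _ (hL.target_lt x e' (hl.subset (by simp [he'])))
      have hlen := length_lt_of_nodup hnd hlt hx hxl
      rw [runs_block_cons, runs_store]
      refine ⟨by simp [i3]; omega, by simp; omega, by simp; omega, ?_⟩
      rw [runs_block_cons]
      refine hrep (l.map f) _ _ _ (hF'.trans ⟨by simp, by simp, by simp, by simp, by simp,
        by simp, by simp, by simp⟩) (by simpa [View] using hJ'') (by simpa [i3] using hrl) hlen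
        (by simp; omega) ?_
      intro T₃ s₃ j1 j2 j3 j4
      simp only [i3] at j2
      have je : s₃.reg .e = e := by simp [j3, ie]
      have jsucc : s₃.arr .succ e = l'.headD 0 := by rw [j4 _ (by simp)]; simp [isucc]
      simp only [runs_block_cons, runs_assign, runs_block_nil, val, at',
          Expr.Fits, Expr.eval, Expr.cost, je, ne_eq, reduceCtorEq,
          not_false_eq_true, Function.update_of_ne, jsucc]
      simp [setCredit] at i2 j1
      refine ⟨by omega, by omega, by omega, ⟨by omega, hg1⟩, by omega, by omega,
        l ++ [e], l', by simpa using hl, by simp, by simp, ?_, ?_, ?_, ?_, ?_, ?_, ?_, ?_, ?_, ?_⟩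
      · simp [setCredit, j4]
        omega
      · exact hF'.trans ⟨by simp [j3], by simp [j3], by simp [j3], by simp [j4], by simp [j4],
          by simp [j4], by simp [j4], by simp [j4]⟩
      · simpa [Sets, j4] using i1
      · rw [List.map_append, List.nodup_append]
        refine ⟨hnd, by simp, ?_⟩
        rintro a ha b hb rfl
        simp only [List.map_cons, List.map_nil, List.mem_singleton] at hb
        exact hkeep'.2 (hb ▸ ha)
      · rw [List.map_append, List.mem_append, not_or]
        exact ⟨hxl, by simpa using hkeep'.1.symm⟩
      · intro e' he'
        rw [List.map_append, List.mem_append]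
        rcases hcov e' he' with h | h | h
        · rcases List.mem_cons.1 h with rfl | h
          · simp
          · exact .inl h
        · exact .inr (.inl h)
        · exact .inr (.inr (.inl h))
      · rw [List.append_assoc]
        exact hL''.congr (by simp [j4]) (by simp [j4]) (by simp [j4])
      · intro v hv
        rw [j4 _ (by simp)]
        simp only [Function.update_self]
        by_cases ev : v = f e
        · subst ev; simp [i3]
        · simp [i3, ev, im v hv]
      · simpa [View] using j2
      · simp [j4, hlast'']

theorem Frame.refl (s : State Reg Arr) : Frame s s := ⟨rfl, rfl, rfl, rfl, rfl, rfl, rfl, rfl⟩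

theorem Lists.head_lt {a : Arr → ℕ → ℕ} {rep : ℕ → ℕ} {ℓ : ℕ → List ℕ} (h : Lists n M a rep ℓ)
    (hM : M < N) {x : ℕ} (hx : x < n) (hr : rep x = x) : a .head x < N := by
  rw [(h.linked x hx hr).head_eq]
  have := h.le x
  cases hl : ℓ x with
  | nil => simp; omega
  | cons e l =>
    have := this e (by simp [hl])
    simp
    omega

/-- The memory between two enumerations of neighbors. -/
structure Tidy (n M : ℕ) (a : Arr → ℕ → ℕ) (rep : ℕ → ℕ) (ℓ : ℕ → List ℕ) : Prop where
  sets : Sets n a rep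
  lists : Lists n M a rep ℓ
  last : ∀ v < n, LastOK a ℓ v
  unmarked : ∀ v < n, a .marked v = 0

/-- The references `l` are what remains of the list of `x` after an enumeration of its neighbors.
The map `f` takes a reference to the vertex of `H` that it stands for. -/
structure Cleaned (f : ℕ → ℕ) (x : ℕ) (l₀ l : List ℕ) : Prop where
  sublist : l.Sublist l₀
  nodup : (l.map f).Nodup
  notMem : x ∉ l.map f
  cover : ∀ e ∈ l₀, f e = x ∨ f e ∈ l.map f

theorem Cleaned.mem_iff {f : ℕ → ℕ} {x : ℕ} {l₀ l : List ℕ} (h : Cleaned f x l₀ l) (v : ℕ) :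
    v ∈ l.map f ↔ v ≠ x ∧ ∃ e ∈ l₀, f e = v := by
  constructor
  · intro hv
    refine ⟨fun e => h.notMem (e ▸ hv), ?_⟩
    obtain ⟨e, he, rfl⟩ := List.mem_map.1 hv
    exact ⟨e, h.sublist.subset he, rfl⟩
  · rintro ⟨hv, e, he, rfl⟩
    exact (h.cover e he).resolve_left hv

/-- An enumeration of the neighbors of `x` looks up every reference at most twice, and leaves one
reference per neighbor. -/
theorem runs_enumerateNeighbors (hA : n ≤ fastGrowing A 1) (hN : n ≤ N) (hN2 : 2 ≤ N) (hM : M < N)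
    {rep : ℕ → ℕ} {ℓ : ℕ → List ℕ} {s : State Reg Arr} {x : ℕ} (hxs : s.reg .x = x) (hx : x < n)
    (hrx : rep x = x) (h : Tidy n M s.arr rep ℓ)
    {report : Program} {J : List ℕ → ℕ → (ℕ → ℕ) → List (ℕ × ℕ) → Prop}
    (hrep : Reports N n report s J) (hJ : View (J []) s)
    {T C : ℕ} (hT : setCredit A n s.arr + 2 * (refCost A * (ℓ x).length) + 24 + C ≤ T)
    {Q : ℕ → State Reg Arr → Prop}
    (hQ : ∀ T' s' l, setCredit A n s'.arr + C ≤ T' → Frame s s' →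
      Cleaned (fun e => rep (s.arr .target e)) x (ℓ x) l →
      Tidy n M s'.arr rep (Function.update ℓ x l) →
      View (J (l.map fun e => rep (s.arr .target e))) s' → Q T' s') :
    Runs N (enumerateNeighbors report) T s Q := by
  unfold enumerateNeighbors
  have hh := h.lists.head_lt hM hx hrx
  have hhd := (h.lists.linked x hx hrx).head_eq
  simp only [runs_block_cons, runs_assign, runs_store, val, at', zero, Expr.Fits,
    Expr.eval, Expr.cost, ne_eq, reduceCtorEq, not_false_eq_true, Function.update_of_ne, hxs]
  refine ⟨by omega, by omega, ⟨by omega, hh⟩, by omega, ?_⟩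
  refine runs_scan hA hN hN2 hM (by simpa using hxs) hx hrx (by exact h.lists) (by exact h.sets)
    (by simpa using hhd) (by simp) (by exact h.unmarked)
    (J := J) ?_ (by simpa [View] using hJ) (C := refCost A * (ℓ x).length + 12 + C)
    (by simp only; omega) ?_
  · intro ks s' T Q hF
    refine hrep ks s' T Q (Frame.trans ⟨?_, ?_, ?_, ?_, ?_, ?_, ?_, ?_⟩ hF) <;> simp
  intro T' s' l i1 i2 i3 i4 i5 i6 i7 i8 i9 i10 i11 i12
  have jx : s'.reg .x = x := by simp [i2.x, hxs]
  have jlen := Nat.mul_le_mul_left (refCost A) i4.length_le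
  have jh := i8.head_lt hM hx hrx
  have jhd := (i8.linked x hx hrx).head_eq
  have jp : s'.reg .prev < N := by
    rw [i10]
    rcases List.eq_nil_or_concat l with rfl | ⟨l0, b, rfl⟩
    · simp; omega
    · have := h.lists.le x b (i4.subset (by simp))
      simp
      omega
  simp only [jx]
  refine ⟨by omega, jp, by omega, ⟨by omega, jh⟩, by omega, ?_⟩
  have hup : Function.update ℓ x l x = l := Function.update_self _ _ _
  refine runs_resetMarkers hA hN hN2 hM hx hrx (i8.congr (by simp) (by simp) (by simp))
    (by simpa [Sets] using i3) (by simpa using jhd) ?_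
    (C := C + 1) (by rw [hup]; simp [setCredit] at i1 ⊢; omega) ?_
  · rw [hup]
    simpa [i2.target] using i9
  intro T'' s'' k1 k2 k3 k4 k5 k6 k7 k8 k9 k10
  rw [runs_block_nil]
  have hF : Frame s s'' := by
    refine Frame.trans ?_ (Frame.trans i2 (Frame.trans ?_ k2)) <;>
    exact ⟨by simp, by simp, by simp, by simp, by simp, by simp, by simp, by simp⟩
  refine ⟨by omega, hQ _ _ l (by omega) hF ⟨i4, i5, i6, i7⟩ ⟨k3, ?_, ?_, k4⟩ ?_⟩
  · exact i8.congr (by simp [k8]) (by simp [k9]) (by simp [k2.target])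
  · intro v hv hl
    rw [k10]
    by_cases e : v = x
    · subst e
      simpa using i10
    · simp only [Function.update_self, Function.update_of_ne e, i12] at hl ⊢
      exact h.last v hv hl
  · unfold View at i11 ⊢
    rw [k5, k6, k7]
    simpa using i11

end ContractionGraph

/-! ### Merging super vertices -/

namespace UnionFind

/-- The representatives after the set of `y` has been merged into the set of `x`. -/
def mergeRep (rep : ℕ → ℕ) (x y : ℕ) : ℕ → ℕ := fun v => if rep v = y then x else rep v

/-- Linking the roots `c` and `d` of the sets of `x` and `y`, in either direction, and making `x` the
representative of the new root `d`. -/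
theorem Forest.represents_link {n : ℕ} {p rk rt name rep rk' : ℕ → ℕ} (h : Forest n p rk rt)
    (hlt : ∀ v < n, rep v < n) (hname : ∀ v < n, name (rt v) = rep v)
    (hinj : ∀ u < n, ∀ v < n, rep u = rep v → rt u = rt v) {x y c d : ℕ} (hx : x < n) (hy : y < n)
    (hrx : rep x = x) (hry : rep y = y) (hxy : x ≠ y)
    (hcd : c = rt x ∧ d = rt y ∨ c = rt y ∧ d = rt x) (hrk : rk c < rk' d)
    (hle : rk d ≤ rk' d) (hle' : rk' d ≤ rk d + 1) (hne : ∀ v, v ≠ d → rk' v = rk v) :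
    Represents n (Function.update p c d) rk' (Function.update name d x) (mergeRep rep x y) ∧
      ∀ A, potential A n (Function.update p c d) rk' ≤ potential A n p rk + A := by
  have hx' : ∀ v < n, rt v = rt x ↔ rep v = x := fun v hv =>
    ⟨fun e => by rw [← hname v hv, e, hname x hx, hrx], fun e => hinj v hv x hx (by rw [e, hrx])⟩
  have hy' : ∀ v < n, rt v = rt y ↔ rep v = y := fun v hv =>
    ⟨fun e => by rw [← hname v hv, e, hname y hy, hry], fun e => hinj v hv y hy (by rw [e, hry])⟩
  have hne' : rt x ≠ rt y := fun e => hxy (by rw [← hrx, (hy' x hx).1 e])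
  have hmem : ∀ v < n, (rt v = c ∨ rt v = d) ↔ (rep v = x ∨ rep v = y) := by
    intro v hv
    rw [← hx' v hv, ← hy' v hv]
    rcases hcd with ⟨rfl, rfl⟩ | ⟨rfl, rfl⟩
    · rfl
    · exact or_comm
  have hc : c < n ∧ d < n ∧ p c = c ∧ p d = d ∧ c ≠ d := by
    rcases hcd with ⟨rfl, rfl⟩ | ⟨rfl, rfl⟩
    · exact ⟨h.root_lt x hx, h.root_lt y hy, h.parent_root x hx, h.parent_root y hy, hne'⟩
    · exact ⟨h.root_lt y hy, h.root_lt x hx, h.parent_root y hy, h.parent_root x hx, hne'.symm⟩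
  obtain ⟨hcn, hdn, hpc, hpd, hne''⟩ := hc
  refine ⟨⟨_, h.link hcn hdn hpc hpd hne'' hrk hle hle' hne, fun v hv => ?_, fun v hv => ?_,
    fun u hu v hv huv => ?_⟩, fun A => Forest.potential_link A hdn hpc hpd hne'' hrk hle hle' hne⟩
  · unfold mergeRep
    split_ifs
    exacts [hx, hlt v hv]
  · have := hmem v hv
    unfold mergeRep
    split_ifs with h1 h2 h2
    · simp
    · rw [Function.update_self]
      exact ((this.1 (.inl h1)).resolve_right h2).symm
    · rw [(this.2 (.inr h2)).resolve_left h1, Function.update_self]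
    · by_cases h3 : rt v = d
      · rw [h3, Function.update_self]
        exact ((this.1 (.inr h3)).resolve_right h2).symm
      · rw [Function.update_of_ne h3, hname v hv]
  · have h1 := hmem u hu
    have h2 := hmem v hv
    have h3 : (rep u = x ∨ rep u = y) ↔ (rep v = x ∨ rep v = y) := by
      unfold mergeRep at huv
      split_ifs at huv with g1 g2 g2
      · simp [g1, g2]
      · simp [g1, huv.symm]
      · simp [g2, huv]
      · rw [huv]
    by_cases h4 : rt u = c ∨ rt u = d
    · have h5 := h2.2 (h3.1 (h1.1 h4))
      rcases h4 with h4 | h4 <;> rcases h5 with h5 | h5 <;> simp [h4, h5]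
    · have h5 : ¬ (rt v = c ∨ rt v = d) := fun h5 => h4 (h1.2 (h3.2 (h2.1 h5)))
      have h6 : ¬ (rep u = x ∨ rep u = y) := fun h6 => h4 (h1.2 h6)
      have h7 : ¬ (rep v = x ∨ rep v = y) := fun h7 => h5 (h2.2 h7)
      push Not at h4 h5 h6 h7
      unfold mergeRep at huv
      rw [if_neg h6.2, if_neg h7.2] at huv
      rw [if_neg h4.1, if_neg h5.1]
      exact hinj u hu v hv huv

end UnionFind

namespace ContractionGraph

open RAM UnionFind

variable {n N M A : ℕ}

/-- The neighborhood lists after the list of `y` has been appended to the list of `x`. -/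
def mergeLists (ℓ : ℕ → List ℕ) (x y : ℕ) : ℕ → List ℕ :=
  Function.update (Function.update ℓ x (ℓ x ++ ℓ y)) y []

theorem mem_mergeLists {ℓ : ℕ → List ℕ} {x y v e : ℕ} (hxy : x ≠ y) :
    e ∈ mergeLists ℓ x y v ↔ v ≠ y ∧ (e ∈ ℓ v ∨ v = x ∧ e ∈ ℓ y) := by
  unfold mergeLists
  by_cases h1 : v = y
  · subst h1; simp
  · by_cases h2 : v = x
    · subst h2; simp [hxy]
    · simp [h1, h2]

theorem Lists.merge {a a' : Arr → ℕ → ℕ} {rep : ℕ → ℕ} {ℓ : ℕ → List ℕ} (h : Lists n M a rep ℓ)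
    {x y : ℕ} (hx : x < n) (hy : y < n) (hrx : rep x = x) (hry : rep y = y) (hxy : x ≠ y)
    (h1 : a' .succ = if ℓ x = [] ∨ ℓ y = [] then a .succ else
      Function.update (a .succ) ((ℓ x).getLastD 0) (a .head y))
    (h2 : a' .head = if ℓ x = [] ∧ ℓ y ≠ [] then Function.update (a .head) x (a .head y)
      else a .head) (h3 : a' .target = a .target) :
    Lists n M a' (mergeRep rep x y) (mergeLists ℓ x y) := by
  have hrep : ∀ v, v ≠ x → v ≠ y → (mergeRep rep x y v = v ↔ rep v = v) := by
    intro v hvx hvy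
    unfold mergeRep
    split_ifs with e
    · simp [e, hvx.symm, hvy.symm]
    · rfl
  have hrepx : mergeRep rep x y x = x := by simp [mergeRep, hrx, hxy]
  have hrepy : mergeRep rep x y y = x := by simp [mergeRep, hry]
  have hself : mergeLists ℓ x y x = ℓ x ++ ℓ y := by simp [mergeLists, hxy]
  have hnd : (ℓ x ++ ℓ y).Nodup := List.nodup_append.2 ⟨h.nodup x, h.nodup y,
    fun e he f hf hef => hxy (h.disjoint x y e he (hef ▸ hf))⟩
  refine ⟨fun v hv hrv => ?_, fun v => ?_, fun u v e hu hv => ?_, fun v e he => ?_,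
    fun v e he => ?_, fun v hv => ?_⟩
  · have hvy : v ≠ y := by
      rintro rfl
      exact hxy (hrepy.symm.trans hrv)
    by_cases hvx : v = x
    · subst hvx
      rw [hself]
      have l1 := h.linked v hx hrx
      have l2 := h.linked y hy hry
      by_cases e1 : ℓ v = [] <;> by_cases e2 : ℓ y = []
      · simpa [h1, h2, e1, e2] using l1
      · simpa [h1, h2, e1, e2] using l2
      · simpa [h1, h2, e1, e2] using l1
      · simp only [h1, h2, e1, e2, or_self, if_false, false_and]
        exact Linked.append (l₁ := []) (by simpa using l1) e1 l2 hnd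
    · have l := h.linked v hv ((hrep v hvx hvy).1 hrv)
      have e : mergeLists ℓ x y v = ℓ v := by simp [mergeLists, hvx, hvy]
      rw [e, h1, h2]
      have e2 : (if ℓ x = [] ∧ ℓ y ≠ [] then Function.update (a .head) x (a .head y)
          else a .head) v = a .head v := by
        split_ifs <;> simp [hvx]
      rw [e2]
      split_ifs with e1
      · exact l
      · push Not at e1
        refine l.update fun hm => hvx (h.disjoint v x _ hm ?_)
        obtain ⟨b, l0, hb⟩ := List.exists_cons_of_ne_nil e1.1
        rw [hb, List.getLastD_cons]
        exact List.getLastD_mem_cons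
  · by_cases hvy : v = y
    · subst hvy; simp [mergeLists]
    · by_cases hvx : v = x
      · subst hvx; rwa [hself]
      · simpa [mergeLists, hvx, hvy] using h.nodup v
  · rw [mem_mergeLists hxy] at hu hv
    obtain ⟨huy, hu⟩ := hu
    obtain ⟨hvy, hv⟩ := hv
    rcases hu with hu | ⟨rfl, hu⟩ <;> rcases hv with hv | ⟨rfl, hv⟩
    · exact h.disjoint u v e hu hv
    · exact absurd (h.disjoint u y e hu hv) huy
    · exact absurd (h.disjoint v y e hv hu) hvy
    · rfl
  · rcases ((mem_mergeLists hxy).1 he).2 with he | ⟨_, he⟩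
    exacts [h.le _ _ he, h.le _ _ he]
  · rw [h3]
    rcases ((mem_mergeLists hxy).1 he).2 with he | ⟨_, he⟩
    exacts [h.target_lt _ _ he, h.target_lt _ _ he]
  · by_cases hvy : v = y
    · subst hvy; simp [mergeLists]
    · by_cases hvx : v = x
      · subst hvx; exact absurd hrepx hv
      · simpa [mergeLists, hvx, hvy] using h.dead v fun e => hv ((hrep v hvx hvy).2 e)

/-- The part of `merge` that appends the list of `y` to the list of `x`. -/
theorem runs_linkLists (hN2 : 2 ≤ N) (hM : M < N) (hN : n ≤ N)
    {rep : ℕ → ℕ} {ℓ : ℕ → List ℕ} {s : State Reg Arr} {x y : ℕ} (hxs : s.reg .x = x)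
    (hys : s.reg .y = y) (hx : x < n) (hy : y < n) (hrx : rep x = x) (hry : rep y = y)
    (hxy : x ≠ y) (hL : Lists n M s.arr rep ℓ) (hlast : ∀ v < n, LastOK s.arr ℓ v) {T : ℕ}
    (hT : 20 ≤ T) {Q : ℕ → State Reg Arr → Prop}
    (hQ : ∀ T' s', T ≤ T' + 20 → Lists n M s'.arr (mergeRep rep x y) (mergeLists ℓ x y) →
      (∀ v < n, LastOK s'.arr (mergeLists ℓ x y) v) → s'.reg = s.reg →
      (∀ a, a ≠ .head → a ≠ .succ → a ≠ .last → s'.arr a = s.arr a) → s'.out = s.out → Q T' s') :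
    Runs N (.ite (.eq (at' .head .y) zero)
        .skip
        (.block
          [ .ite (.eq (at' .head .x) zero)
              (.store .head (val .x) (at' .head .y))
              (.store .succ (at' .last .x) (at' .head .y)),
            .store .last (val .x) (at' .last .y) ])) T s Q := by
  have hnil : ∀ v < n, rep v = v → (s.arr .head v = 0 ↔ ℓ v = []) := by
    intro v hv hr
    have := hL.linked v hv hr
    cases hl : ℓ v with
    | nil => rw [hl] at this; exact iff_of_true this rfl
    | cons e l => rw [hl] at this; simp [this.1, this.2.1]
  have hlt : ∀ v < n, rep v = v → ℓ v ≠ [] → s.arr .last v < N := by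
    intro v hv hr hne
    rw [hlast v hv hne]
    obtain ⟨b, l0, hb⟩ := List.exists_cons_of_ne_nil hne
    have := hL.le v ((ℓ v).getLastD 0) (by
      rw [hb, List.getLastD_cons]; exact List.getLastD_mem_cons)
    omega
  have hhx := hL.head_lt hM hx hrx
  have hhy := hL.head_lt hM hy hry
  have hlast' : ∀ a' : Arr → ℕ → ℕ, (a' .last = if ℓ y = [] then s.arr .last else
      Function.update (s.arr .last) x (s.arr .last y)) → ∀ v < n,
      LastOK a' (mergeLists ℓ x y) v := by
    intro a' ha v hv hne
    by_cases hvy : v = y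
    · subst hvy; simp [mergeLists] at hne
    · by_cases hvx : v = x
      · subst hvx
        have hself : mergeLists ℓ v y v = ℓ v ++ ℓ y := by simp [mergeLists, hxy]
        rw [hself] at hne ⊢
        by_cases e : ℓ y = []
        · rw [ha, if_pos e, e, List.append_nil]
          exact hlast v hv (by simpa [e] using hne)
        · rw [ha, if_neg e, Function.update_self, hlast y hy e]
          rw [List.getLastD_eq_getLast?, List.getLastD_eq_getLast?, List.getLast?_append]
          cases h : (ℓ y).getLast? with
          | none => exact absurd (List.getLast?_eq_none_iff.1 h) e
          | some b => rfl
      · have e1 : mergeLists ℓ x y v = ℓ v := by simp [mergeLists, hvx, hvy]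
        rw [e1] at hne ⊢
        rw [ha, ← hlast v hv hne]
        split_ifs
        · rfl
        · simp [hvx]
  rw [runs_ite]
  refine ⟨by simp [hys]; omega, by simp; omega, fun hc => ?_, fun hc => ?_⟩
  · have e : ℓ y = [] := (hnil y hy hry).1 (by simpa [hys] using hc)
    rw [runs_skip]
    refine ⟨by simp; omega, hQ _ _ (by simp; omega) (hL.merge hx hy hrx hry hxy ?_ ?_ rfl)
      (hlast' _ ?_) rfl (fun _ _ _ _ => rfl) rfl⟩ <;> simp [e]
  · have e : ℓ y ≠ [] := fun e => hc (by simpa [hys] using (hnil y hy hry).2 e)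
    have hly := hlt y hy hry e
    rw [runs_block_cons, runs_ite]
    refine ⟨by simp [hxs]; omega, by simp; omega, fun hc' => ?_, fun hc' => ?_⟩
    · have e' : ℓ x = [] := (hnil x hx hrx).1 (by simpa [hxs] using hc')
      simp [hxs, hys]
      refine ⟨by omega, by omega, by omega, by omega, by omega, by omega, by omega, hQ _ _
        (by omega) (hL.merge hx hy hrx hry hxy ?_ ?_ (by simp)) (hlast' _ ?_) rfl ?_ rfl⟩
      · simp [e']
      · simp [e, e']
      · simp [e]
      · intro a a1 a2 a3
        simp [a1, a3]
    · have e' : ℓ x ≠ [] := fun e => hc' (by simpa [hxs] using (hnil x hx hrx).2 e)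
      have hlx := hlt x hx hrx e'
      have hlx' := hlast x hx e'
      simp [hxs, hys]
      refine ⟨by omega, by omega, by omega, by omega, by omega, by omega, by omega, hQ _ _
        (by omega) (hL.merge hx hy hrx hry hxy ?_ ?_ (by simp)) (hlast' _ ?_) rfl ?_ rfl⟩
      · simp only [e, e', or_self, if_false, ← hlx']; simp
      · simp [e']
      · simp [e]
      · intro a a1 a2 a3
        simp [a2, a3]

/-- The cost of a merge. -/
def mergeCost (A : ℕ) : ℕ := 20 * (3 * A + 10)

/-- The part of the memory that `merge` leaves alone. -/
structure MergeFrame (s s' : State Reg Arr) : Prop where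
  reg : ∀ r, r ≠ .y → r ≠ .j → r ≠ .root → r ≠ .cur → r ≠ .up → r ≠ .rootX → s'.reg r = s.reg r
  order : s'.arr .order = s.arr .order
  target : s'.arr .target = s.arr .target
  isSuper : s'.arr .isSuper = s.arr .isSuper
  supers : s'.arr .supers = s.arr .supers
  out : s'.out = s.out

theorem MergeFrame.trans {s₁ s₂ s₃ : State Reg Arr} (h : MergeFrame s₁ s₂)
    (h' : MergeFrame s₂ s₃) : MergeFrame s₁ s₃ :=
  ⟨fun r h1 h2 h3 h4 h5 h6 => (h'.reg r h1 h2 h3 h4 h5 h6).trans (h.reg r h1 h2 h3 h4 h5 h6),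
    h'.order.trans h.order, h'.target.trans h.target, h'.isSuper.trans h.isSuper,
    h'.supers.trans h.supers, h'.out.trans h.out⟩

/-- A merge consists of two lookups and a link; the link raises the potential by at most `A`. -/
theorem runs_merge (hA : n ≤ fastGrowing A 1) (hN : n < N) (hN2 : 2 ≤ N) (hM : M < N)
    {rep : ℕ → ℕ} {ℓ : ℕ → List ℕ} {s : State Reg Arr} {x y : ℕ} (hxs : s.reg .x = x)
    (hys : s.reg .y = y) (hx : x < n) (hy : y < n) (hrx : rep x = x) (hry : rep y = y)
    (hxy : x ≠ y) (h : Tidy n M s.arr rep ℓ) {T C : ℕ}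
    (hT : setCredit A n s.arr + mergeCost A + C ≤ T) {Q : ℕ → State Reg Arr → Prop}
    (hQ : ∀ T' s', setCredit A n s'.arr + C ≤ T' →
      Tidy n M s'.arr (mergeRep rep x y) (mergeLists ℓ x y) → MergeFrame s s' →
      s'.reg .j = s.reg .j → Q T' s') :
    Runs N merge T s Q := by
  obtain ⟨⟨rt, h1, h2, h3, h4⟩, hL, hlast, hm⟩ := h
  unfold merge
  unfold mergeCost setCredit at hT
  rw [runs_block_cons]
  refine runs_linkLists hN2 hM hN.le hxs hys hx hy hrx hry hxy hL hlast (by omega) ?_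
  intro T₁ s₁ a1 a2 a3 a4 a5 a6
  rw [runs_block_cons]
  have a7 : s₁.arr .parent = s.arr .parent := by simp [a5]
  refine runs_findRoot (C := C + 20 * (A + 3) + 20 * A + 60) hA (h := h1) hx hN.le a7
    (by simp [a4, hxs]) (by simp [a4, hxs]; omega) (by simp) (by omega) ?_
  intro T₂ s₂ b1 b2 b3 b4 b5 b6
  have hrtx := h1.root_lt x hx
  have hrty := h1.root_lt y hy
  rw [runs_block_cons, runs_assign]
  refine ⟨by simp [b3]; omega, by simp; omega, ?_⟩
  rw [runs_block_cons]
  refine runs_findRoot (C := C + 20 * A + 40) (rk := s.arr .ufRank) (p := s₂.arr .parent) hA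
    (h := b1) hy hN.le (by simp) (by simp [a4, b4, hys]) (by simp [a4, b4, hys]; omega)
    (by simp) (by simp; omega) ?_
  intro T₃ s₃ c1 c2 c3 c4 c5 c6
  have dX : s₃.reg .rootX = rt x := by simp [c4, b3]
  have dx : s₃.reg .x = x := by simp [c4, b4, a4, hxs]
  have drk : s₃.arr .ufRank = s.arr .ufRank := by simp [c5, b5, a5]
  have dname : s₃.arr .name = s.arr .name := by simp [c5, b5, a5]
  have hrkx := h1.rank_lt_size hrtx
  have hrky := h1.rank_lt_size hrty
  have hlast' : ∀ a' : Arr → ℕ → ℕ, a' .last = s₃.arr .last →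
      ∀ v < n, LastOK a' (mergeLists ℓ x y) v := by
    intro a' ha v hv hl
    rw [← a3 v hv hl, ha]
    simp [c5, b5]
  have hF : MergeFrame s s₃ := by
    refine ⟨fun r g1 g2 g3 g4 g5 g6 => ?_, ?_, ?_, ?_, ?_, ?_⟩
    · simp [c4 r g3 g4 g5, b4 r g3 g4 g5, a4, g6]
    all_goals simp [c5, b5, a5, c6, b6, a6]
  have hm' : s₃.arr .marked = s.arr .marked := by simp [c5, b5, a5]
  have hj : s₃.reg .j = s.reg .j := by simp [c4, b4, a4]
  have hL' : Lists n M s₃.arr (mergeRep rep x y) (mergeLists ℓ x y) :=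
    a2.congr (by simp [c5, b5]) (by simp [c5, b5]) (by simp [c5, b5])
  rw [runs_block_cons, runs_ite]
  refine ⟨by simp [dX, c3, drk]; omega, by simp; omega, fun hc => ?_, fun hc => ?_⟩
  · have hc' : s.arr .ufRank (rt x) < s.arr .ufRank (rt y) := by
      simpa [dX, c3, drk] using hc
    obtain ⟨e1, e2⟩ := c1.represents_link (rk' := s.arr .ufRank) h2 h3 h4 hx hy hrx hry hxy
      (.inl ⟨rfl, rfl⟩) hc' le_rfl (by omega) (fun _ _ => rfl)
    have e2 := e2 A
    simp only [runs_block_cons, runs_store, runs_block_nil, val, Expr.Fits,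
      Expr.eval, Expr.cost, dX, c3, dx, Cond.cost, at']
    refine ⟨by omega, by omega, by omega, by omega, by omega, by omega, by omega, by omega,
      hQ _ _ ?_ ⟨?_, hL'.congr (by simp) (by simp) (by simp), hlast' _ (by simp), ?_⟩
      (hF.trans ⟨fun _ _ _ _ _ _ _ => rfl, ?_, ?_, ?_, ?_, ?_⟩) hj⟩
    · simp [setCredit, drk]
      omega
    · simpa [Sets, drk, dname] using e1
    · simpa [hm'] using hm
    all_goals simp
  · have hc' : s.arr .ufRank (rt y) ≤ s.arr .ufRank (rt x) := by
      simpa [dX, c3, drk] using hc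
    rw [runs_block_cons, runs_store]
    refine ⟨by simp [c3]; omega, by simp [dX]; omega, by simp; omega, ?_⟩
    rw [runs_block_cons, runs_store]
    refine ⟨by simp [dX]; omega, by simp [dx]; omega, by simp; omega, ?_⟩
    rw [runs_block_cons, runs_ite]
    refine ⟨by simp [dX, c3, drk]; omega, by simp; omega, fun hd => ?_, fun hd => ?_⟩
    · have hd' : s.arr .ufRank (rt x) = s.arr .ufRank (rt y) := by
        simpa [dX, c3, drk] using hd
      obtain ⟨e1, e2⟩ := c1.represents_link (rk' := Function.update (s.arr .ufRank) (rt x)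
        (s.arr .ufRank (rt x) + 1)) h2 h3 h4 hx hy hrx hry hxy (.inr ⟨rfl, rfl⟩) (by simp [hd'])
        (by simp) (by simp) (fun v hv => by simp [hv])
      have e2 := e2 A
      simp only [runs_store, runs_block_nil, val, Expr.Fits, one,
        Expr.eval, Expr.cost, dX, c3, dx, drk, Cond.cost, at', Function.update_of_ne, ne_eq,
        reduceCtorEq, not_false_eq_true]
      refine ⟨by omega, ⟨by omega, by omega, by omega⟩, by omega, by omega, by omega,
        hQ _ _ ?_ ⟨?_, hL'.congr (by simp) (by simp) (by simp), hlast' _ (by simp), ?_⟩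
        (hF.trans ⟨fun _ _ _ _ _ _ _ => rfl, ?_, ?_, ?_, ?_, ?_⟩) hj⟩
      · simp [setCredit]
        omega
      · simpa [Sets, drk, dname] using e1
      · simpa [hm'] using hm
      all_goals simp
    · have hd' : s.arr .ufRank (rt x) ≠ s.arr .ufRank (rt y) := by
        simpa [dX, c3, drk] using hd
      obtain ⟨e1, e2⟩ := c1.represents_link (rk' := s.arr .ufRank) h2 h3 h4 hx hy hrx hry hxy
        (.inr ⟨rfl, rfl⟩) (by omega) le_rfl (by omega) (fun _ _ => rfl)
      have e2 := e2 A
      simp only [runs_skip, runs_block_nil, val,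
        Expr.eval, Expr.cost, dX, c3, dx, Cond.cost, at']
      refine ⟨by omega, by omega, by omega,
        hQ _ _ ?_ ⟨?_, hL'.congr (by simp) (by simp) (by simp), hlast' _ (by simp), ?_⟩
        (hF.trans ⟨fun _ _ _ _ _ _ _ => rfl, ?_, ?_, ?_, ?_, ?_⟩) hj⟩
      · simp [setCredit, drk]
        omega
      · simpa [Sets, drk, dname] using e1
      · simpa [hm'] using hm
      all_goals simp

end ContractionGraph

/-! ### The contraction graph and the core graphs -/

namespace ContractionGraph

open UnionFind

/-- `C` is the core graph that arises from the graph `adj` by the contraction of the vertices in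
`S`, and the fibers of `rep` are the vertices of the contraction graph: two vertices of the core
graph are adjacent if they are adjacent in the input graph, or to a common super vertex. -/
structure IsContraction (adj C : ℕ → ℕ → Prop) (S : Finset ℕ) (rep : ℕ → ℕ) : Prop where
  idem : ∀ v, rep (rep v) = rep v
  fix : ∀ v, v ∉ S → rep v = v
  rep_mem : ∀ v, v ∈ S → rep v ∈ S
  indep : ∀ a b, adj a b → a ∈ S → b ∈ S → rep a = rep b
  core : ∀ u w, C u w ↔ u ≠ w ∧ u ∉ S ∧ w ∉ S ∧
    (adj u w ∨ ∃ a b, rep a = rep b ∧ a ∈ S ∧ b ∈ S ∧ adj a u ∧ adj b w)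

theorem isContraction_empty {adj : ℕ → ℕ → Prop} (h : ∀ u w, adj u w → u ≠ w) :
    IsContraction adj adj ∅ id :=
  ⟨fun _ => rfl, fun _ _ => rfl, by simp, by simp, fun u w => by simpa using h u w⟩

namespace IsContraction

variable {adj C : ℕ → ℕ → Prop} {S : Finset ℕ} {rep rep' : ℕ → ℕ} {x : ℕ}

theorem mem_of_rep_mem (h : IsContraction adj C S rep) {v : ℕ} (hv : rep v ∈ S) : v ∈ S := by
  by_contra hcon
  rw [h.fix v hcon] at hv
  exact hcon hv

theorem rep_eq_iff (h : IsContraction adj C S rep) (hx : x ∉ S) (v : ℕ) : rep v = x ↔ v = x := by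
  constructor
  · intro e
    by_cases hv : v ∈ S
    · exact absurd (e ▸ h.rep_mem v hv) hx
    · rw [← e, h.fix v hv]
  · rintro rfl
    exact h.fix v hx

/-- The contraction of `x`: all super vertices next to `x` are merged into `x`. -/
theorem contract (h : IsContraction adj C S rep) (hsymm : ∀ a b, adj a b → adj b a) (hx : x ∉ S)
    (hrep : ∀ v, rep' v = x ∨ rep' v = rep v)
    (hrep' : ∀ v, rep' v = x ↔ v = x ∨ rep v ∈ S ∧ ∃ b, adj x b ∧ rep b = rep v) :
    IsContraction adj (fun u w => u ≠ w ∧ u ≠ x ∧ w ≠ x ∧ (C u w ∨ (C x u ∧ C x w)))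
        (insert x S) rep' ∧
      ∀ z, (z ≠ x ∧ ∃ a b, rep' a = x ∧ adj a b ∧ rep' b = z) ↔ C x z := by
  have hxx : rep' x = x := (hrep' x).2 (.inl rfl)
  have hmem : ∀ a, rep' a = x → a ∈ insert x S := by
    intro a ha
    rcases (hrep' a).1 ha with rfl | ⟨h1, _⟩
    · exact Finset.mem_insert_self _ _
    · exact Finset.mem_insert_of_mem (h.mem_of_rep_mem h1)
  have heq : ∀ a, rep' a ≠ x → rep' a = rep a := fun a ha => (hrep a).resolve_left ha
  have hcongr : ∀ a b, a ∈ S → b ∈ S → rep a = rep b → rep' a = rep' b := by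
    intro a b ha hb e
    have hax : a ≠ x := fun e => hx (e ▸ ha)
    have hbx : b ≠ x := fun e => hx (e ▸ hb)
    have : rep' a = x ↔ rep' b = x := by simp [hrep', hax, hbx, e]
    by_cases h1 : rep' a = x
    · rw [h1, this.1 h1]
    · rw [heq a h1, heq b fun h2 => h1 (this.2 h2), e]
  have hfix : ∀ v, v ∉ insert x S → rep' v = v := by
    intro v hv
    rw [heq v fun e => hv (hmem v e), h.fix v fun e => hv (Finset.mem_insert_of_mem e)]
  have hindep : ∀ a b, adj a b → a ∈ insert x S → b ∈ insert x S → rep' a = rep' b := by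
    have key : ∀ b, adj x b → b ∈ S → rep' b = x := fun b hb hbS =>
      (hrep' b).2 (.inr ⟨h.rep_mem b hbS, b, hb, rfl⟩)
    intro a b hab ha hb
    rcases Finset.mem_insert.1 ha with ha' | ha' <;> rcases Finset.mem_insert.1 hb with hb' | hb'
    · rw [ha', hb']
    · rw [ha', hxx, key b (ha' ▸ hab) hb']
    · rw [hb', hxx, key a (hsymm _ _ (hb' ▸ hab)) ha']
    · exact hcongr a b ha' hb' (h.indep a b hab ha' hb')
  have hC : ∀ z, C x z ↔ z ∉ insert x S ∧ ∃ b, rep' b = x ∧ adj b z := by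
    intro z
    rw [h.core, Finset.mem_insert, not_or]
    constructor
    · rintro ⟨h1, _, h3, h4 | ⟨a, b, e, ha, hb, hax, hbz⟩⟩
      · exact ⟨⟨Ne.symm h1, h3⟩, x, hxx, h4⟩
      · exact ⟨⟨Ne.symm h1, h3⟩, b, (hrep' b).2 (.inr ⟨h.rep_mem b hb, a, hsymm _ _ hax, e⟩), hbz⟩
    · rintro ⟨⟨h1, h3⟩, b, hb, hbz⟩
      refine ⟨Ne.symm h1, hx, h3, ?_⟩
      rcases (hrep' b).1 hb with rfl | ⟨h5, a, hxa, e⟩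
      · exact .inl hbz
      · exact .inr ⟨a, b, e, h.mem_of_rep_mem (e ▸ h5), h.mem_of_rep_mem h5, hsymm _ _ hxa, hbz⟩
  refine ⟨⟨fun v => ?_, hfix, fun v hv => ?_, hindep, fun u w => ?_⟩, fun z => ?_⟩
  · by_cases hv : rep' v = x
    · rw [hv, hxx]
    · have e := heq v hv
      have hv' : rep' (rep v) ≠ x := by
        intro h1
        rcases (hrep' _).1 h1 with h2 | ⟨h2, b, h3, h4⟩
        · exact hv (e.trans h2)
        · rw [h.idem] at h2 h4
          exact hv ((hrep' v).2 (.inr ⟨h2, b, h3, h4⟩))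
      rw [e, heq _ hv', h.idem]
  · by_cases hv' : rep' v = x
    · rw [hv']; exact Finset.mem_insert_self _ _
    · rw [heq v hv']
      rcases Finset.mem_insert.1 hv with rfl | hv
      · exact absurd hxx hv'
      · exact Finset.mem_insert_of_mem (h.rep_mem v hv)
  · constructor
    · rintro ⟨h1, h2, h3, h4 | ⟨h4, h5⟩⟩
      · obtain ⟨_, h6, h7, h8⟩ := (h.core u w).1 h4
        refine ⟨h1, by simp [h2, h6], by simp [h3, h7], h8.imp_right ?_⟩
        rintro ⟨a, b, e, ha, hb, hau, hbw⟩
        exact ⟨a, b, hcongr a b ha hb e, Finset.mem_insert_of_mem ha, Finset.mem_insert_of_mem hb,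
          hau, hbw⟩
      · obtain ⟨h6, a, ha, hau⟩ := (hC u).1 h4
        obtain ⟨h7, b, hb, hbw⟩ := (hC w).1 h5
        exact ⟨h1, h6, h7, .inr ⟨a, b, ha.trans hb.symm, hmem a ha, hmem b hb, hau, hbw⟩⟩
    · rintro ⟨h1, h2, h3, h4⟩
      have h2' := h2
      have h3' := h3
      rw [Finset.mem_insert, not_or] at h2' h3'
      refine ⟨h1, h2'.1, h3'.1, ?_⟩
      rcases h4 with h4 | ⟨a, b, e, ha, hb, hau, hbw⟩
      · exact .inl ((h.core u w).2 ⟨h1, h2'.2, h3'.2, .inl h4⟩)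
      · by_cases hax : rep' a = x
        · exact .inr ⟨(hC u).2 ⟨h2, a, hax, hau⟩, (hC w).2 ⟨h3, b, e ▸ hax, hbw⟩⟩
        · have hbx : rep' b ≠ x := e ▸ hax
          have haS := (Finset.mem_insert.1 ha).resolve_left fun e => hax (e ▸ hxx)
          have hbS := (Finset.mem_insert.1 hb).resolve_left fun e => hbx (e ▸ hxx)
          rw [heq a hax, heq b hbx] at e
          exact .inl ((h.core u w).2 ⟨h1, h2'.2, h3'.2, .inr ⟨a, b, e, haS, hbS, hau, hbw⟩⟩)
  · rw [hC]
    constructor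
    · rintro ⟨h1, a, b, ha, hab, hb⟩
      have hbS : b ∉ insert x S := fun hbS =>
        h1 (by rw [← hb, ← hindep a b hab (hmem a ha) hbS, ha])
      have : b = z := by rw [← hb, hfix b hbS]
      subst this
      exact ⟨hbS, a, ha, hab⟩
    · rintro ⟨h1, a, ha, haz⟩
      exact ⟨fun e => h1 (e ▸ Finset.mem_insert_self _ _), a, z, ha, haz, hfix z h1⟩

end IsContraction

/-- The references in the lists `ℓ` represent the edges of the contraction graph: every reference
stems from an edge of the input graph, and every edge whose endpoints have different
representatives has a reference in either direction. -/
structure Refs (adj : ℕ → ℕ → Prop) (target rep : ℕ → ℕ) (ℓ : ℕ → List ℕ) : Prop where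
  sound : ∀ v e, e ∈ ℓ v → ∃ a, rep a = v ∧ adj a (target e)
  complete : ∀ a b, adj a b → rep a ≠ rep b → ∃ e ∈ ℓ (rep a), rep (target e) = rep b

namespace Refs

variable {adj : ℕ → ℕ → Prop} {target rep : ℕ → ℕ} {ℓ : ℕ → List ℕ} {x y : ℕ}

theorem clean (h : Refs adj target rep ℓ) {l : List ℕ}
    (hl : Cleaned (fun e => rep (target e)) x (ℓ x) l) :
    Refs adj target rep (Function.update ℓ x l) := by
  refine ⟨fun v e he => h.sound v e ?_, fun a b hab hne => ?_⟩
  · by_cases hv : v = x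
    · subst hv
      exact hl.sublist.subset (by simpa using he)
    · simpa [hv] using he
  · obtain ⟨e, he, heb⟩ := h.complete a b hab hne
    by_cases hv : rep a = x
    · rw [hv] at he hne ⊢
      rw [Function.update_self]
      rcases hl.cover e he with h1 | h1
      · exact absurd (h1.symm.trans heb) hne
      · obtain ⟨e', he', h2⟩ := List.mem_map.1 h1
        exact ⟨e', he', h2.trans heb⟩
    · exact ⟨e, by simpa [hv] using he, heb⟩

theorem merge (h : Refs adj target rep ℓ) (hxy : x ≠ y) :
    Refs adj target (mergeRep rep x y) (mergeLists ℓ x y) := by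
  refine ⟨fun v e he => ?_, fun a b hab hne => ?_⟩
  · obtain ⟨hvy, he' | ⟨rfl, he'⟩⟩ := (mem_mergeLists hxy).1 he
    · obtain ⟨a, rfl, ha⟩ := h.sound v e he'
      exact ⟨a, by simp [mergeRep, hvy], ha⟩
    · obtain ⟨a, h1, ha⟩ := h.sound y e he'
      exact ⟨a, by simp [mergeRep, h1], ha⟩
  · have hne' : rep a ≠ rep b := fun e => hne (by simp [mergeRep, e])
    obtain ⟨e, he, heb⟩ := h.complete a b hab hne'
    refine ⟨e, (mem_mergeLists hxy).2 ?_, by simp [mergeRep, heb]⟩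
    by_cases hay : rep a = y
    · simp only [mergeRep, hay, if_true]
      exact ⟨hxy, .inr ⟨trivial, hay ▸ he⟩⟩
    · simp only [mergeRep, hay, if_false]
      exact ⟨hay, .inl he⟩

/-- The targets of the references of `x` are the neighbors of `x` in the contraction graph. -/
theorem exists_target_iff (h : Refs adj target rep ℓ) {z : ℕ} (hz : z ≠ x) :
    (∃ e ∈ ℓ x, rep (target e) = z) ↔ ∃ a b, rep a = x ∧ adj a b ∧ rep b = z := by
  constructor
  · rintro ⟨e, he, hez⟩
    obtain ⟨a, ha, hae⟩ := h.sound x e he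
    exact ⟨a, target e, ha, hae, hez⟩
  · rintro ⟨a, b, ha, hab, rfl⟩
    obtain ⟨e, he, heb⟩ := h.complete a b hab (by rw [ha]; exact hz.symm)
    exact ⟨e, ha ▸ he, heb⟩

end Refs

/-! ### Contracting a vertex -/

open RAM

variable {n N M A : ℕ}

/-- The time saved per reference in the list of the vertex `v`: enough for one enumeration of the
neighbors if `v` is a super vertex, and for two enumerations and the merges in between otherwise. -/
def refCredit (A : ℕ) (S : Finset ℕ) (v : ℕ) : ℕ :=
  if v ∈ S then 2 * refCost A else 4 * refCost A + (mergeCost A + 12)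

/-- The time saved in the neighborhood lists. -/
def listCredit (A n : ℕ) (S : Finset ℕ) (ℓ : ℕ → List ℕ) : ℕ :=
  ∑ v ∈ Finset.range n, refCredit A S v * (ℓ v).length

/-- The time saved in the neighborhood lists of the vertices other than `x`. -/
def listCreditExcept (A n : ℕ) (S : Finset ℕ) (ℓ : ℕ → List ℕ) (x : ℕ) : ℕ :=
  ∑ v ∈ (Finset.range n).erase x, refCredit A S v * (ℓ v).length

theorem listCredit_eq (S : Finset ℕ) (ℓ : ℕ → List ℕ) {x : ℕ} (hx : x < n) :
    listCredit A n S ℓ = refCredit A S x * (ℓ x).length + listCreditExcept A n S ℓ x :=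
  (Finset.add_sum_erase _ _ (Finset.mem_range.2 hx)).symm

theorem listCreditExcept_congr {S S' : Finset ℕ} {ℓ ℓ' : ℕ → List ℕ} {x : ℕ}
    (hS : ∀ v, v ≠ x → (v ∈ S ↔ v ∈ S')) (hℓ : ∀ v, v ≠ x → ℓ v = ℓ' v) :
    listCreditExcept A n S ℓ x = listCreditExcept A n S' ℓ' x := by
  refine Finset.sum_congr rfl fun v hv => ?_
  have hv' := Finset.ne_of_mem_erase hv
  rw [hℓ v hv', refCredit, refCredit]
  simp only [hS v hv']

theorem listCredit_merge {S : Finset ℕ} {ℓ : ℕ → List ℕ} {x y : ℕ} (hx : x < n) (hy : y < n)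
    (hxS : x ∈ S) (hyS : y ∈ S) (hxy : x ≠ y) :
    listCredit A n S (mergeLists ℓ x y) = listCredit A n S ℓ := by
  have hy' : y ∈ (Finset.range n).erase x := Finset.mem_erase.2 ⟨hxy.symm, Finset.mem_range.2 hy⟩
  rw [listCredit_eq _ _ hx, listCredit_eq _ _ hx, listCreditExcept, listCreditExcept,
    ← Finset.add_sum_erase _ _ hy', ← Finset.add_sum_erase _ _ hy']
  have h1 : mergeLists ℓ x y x = ℓ x ++ ℓ y := by simp [mergeLists, hxy]
  have h2 : mergeLists ℓ x y y = [] := by simp [mergeLists]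
  have h3 : ∑ v ∈ ((Finset.range n).erase x).erase y,
      refCredit A S v * (mergeLists ℓ x y v).length =
      ∑ v ∈ ((Finset.range n).erase x).erase y, refCredit A S v * (ℓ v).length := by
    refine Finset.sum_congr rfl fun v hv => ?_
    have g1 := Finset.ne_of_mem_erase hv
    have g2 := Finset.ne_of_mem_erase (Finset.mem_of_mem_erase hv)
    simp [mergeLists, g1, g2]
  have h4 : refCredit A S x = refCredit A S y := by simp [refCredit, hxS, hyS]
  rw [h1, h2, h3, h4, List.length_append, List.length_nil]
  ring

/-- The super vertices among the neighbors `ks` are collected in the array `supers`. -/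
def Collected (isSuper : ℕ → ℕ) (out₀ : List (ℕ × ℕ)) (ks : List ℕ) (k : ℕ) (supers : ℕ → ℕ)
    (out : List (ℕ × ℕ)) : Prop :=
  (List.range k).map supers = ks.filter (fun v => isSuper v = 1) ∧ out = out₀

theorem reports_collectSuper {s : State Reg Arr} {S : Finset ℕ} (hN : n < N) (hN2 : 2 ≤ N)
    (hb : ∀ v < n, s.arr .isSuper v = if v ∈ S then 1 else 0) :
    Reports N n collectSuper s (Collected (s.arr .isSuper) s.out) := by
  intro ks s' T Q hF hJ hv hlen hT hQ
  obtain ⟨h1, h2⟩ := hJ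
  have hk : s'.reg .numSupers < n := by
    have := congrArg List.length h1
    rw [List.length_map, List.length_range] at this
    have := List.length_filter_le (fun v => decide (s.arr .isSuper v = 1)) ks
    omega
  have hbv : s'.arr .isSuper (s'.reg .v) < N := by
    rw [hF.isSuper, hb _ hv]
    split_ifs <;> omega
  unfold collectSuper
  rw [runs_ite]
  refine ⟨by simp; omega, by simp; omega, fun hc => ?_, fun hc => ?_⟩
  · have hc' : s.arr .isSuper (s'.reg .v) = 1 := by simpa [hF.isSuper] using hc
    simp only [runs_block_cons, runs_store, runs_assign, runs_block_nil, val, one, increment,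
      Expr.Fits, Expr.eval, Expr.cost, Cond.cost, at']
    refine ⟨by omega, by omega, by omega, ⟨by omega, by omega, by omega⟩, by omega, by omega,
      hQ _ _ (by omega) ⟨?_, ?_⟩ ?_ ?_⟩
    · simp only [Function.update_self, List.range_succ, List.map_append, List.map_cons,
        List.map_nil, List.filter_append]
      congr 1
      · rw [← h1]
        refine List.map_congr_left fun j hj => ?_
        rw [Function.update_of_ne (List.mem_range.1 hj).ne]
      · simp [hc']
    · exact h2
    · intro r hr; simp [hr]
    · intro a ha; simp [ha]
  · have hc' : s.arr .isSuper (s'.reg .v) ≠ 1 := by simpa [hF.isSuper] using hc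
    rw [runs_skip]
    refine ⟨by simp; omega, hQ _ _ (by simp; omega) ⟨?_, h2⟩ (fun _ _ => rfl) fun _ _ => rfl⟩
    rw [List.filter_append, h1]
    simp [hc']

/-- The contraction of `x` is paid for by the references of `x`, which need fewer savings once `x` is a
super vertex. The representatives `rep'` and the lists `ℓ'` are those after all merges. -/
theorem runs_contract (hA : n ≤ fastGrowing A 1) (hN : n < N) (hN2 : 2 ≤ N) (hM : M < N)
    {adj : ℕ → ℕ → Prop} {rep : ℕ → ℕ} {ℓ : ℕ → List ℕ} {S : Finset ℕ} {s : State Reg Arr} {x : ℕ}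
    (hxs : s.reg .x = x) (hx : x < n) (hxS : x ∉ S) (hrx : rep x = x)
    (hidem : ∀ v, rep (rep v) = rep v) (h : Tidy n M s.arr rep ℓ)
    (hR : Refs adj (s.arr .target) rep ℓ)
    (hb : ∀ v < n, s.arr .isSuper v = if v ∈ S then 1 else 0)
    {T C : ℕ} (hT : setCredit A n s.arr + listCredit A n S ℓ + 50 + C ≤ T)
    {Q : ℕ → State Reg Arr → Prop}
    (hQ : ∀ T' s' rep' ℓ', setCredit A n s'.arr + listCredit A n (insert x S) ℓ' + C ≤ T' →
      Tidy n M s'.arr rep' ℓ' → Refs adj (s'.arr .target) rep' ℓ' →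
      (∀ v, rep' v = x ∨ rep' v = rep v) →
      (∀ v, rep' v = x ↔ rep v = x ∨ rep v ≠ x ∧ rep v ∈ S ∧
        ∃ e ∈ ℓ x, rep (s.arr .target e) = rep v) →
      (∀ v < n, s'.arr .isSuper v = if v ∈ insert x S then 1 else 0) →
      s'.reg .numVertices = s.reg .numVertices → s'.reg .i = s.reg .i → s'.reg .x = x →
      s'.arr .order = s.arr .order → s'.out = s.out → Q T' s') :
    Runs N contract T s Q := by
  unfold contract
  simp only [runs_block_cons, runs_assign, runs_store, val, zero, one, Expr.Fits,
    Expr.eval, Expr.cost, hxs]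
  have hb' : ∀ v < n, Function.update (s.arr .isSuper) x 1 v = if v ∈ insert x S then 1 else 0 := by
    intro v hv
    by_cases e : v = x
    · subst e; simp
    · simp [e, hb v hv]
  have hcx : refCredit A S x = 4 * refCost A + (mergeCost A + 12) := if_neg hxS
  have hcx' : refCredit A (insert x S) x = 2 * refCost A := if_pos (Finset.mem_insert_self _ _)
  rw [listCredit_eq S ℓ hx, hcx, Nat.add_mul, Nat.mul_assoc] at hT
  refine ⟨by omega, by omega, by omega, by omega, by omega, ?_⟩
  refine runs_enumerateNeighbors (C := listCreditExcept A n S ℓ x + 2 * (refCost A * (ℓ x).length) +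
    (mergeCost A + 12) * (ℓ x).length + 10 + C) hA hN.le hN2 hM (by simpa using hxs) hx hrx
    ⟨by simpa [Sets] using h.sets, h.lists.congr (by simp) (by simp) (by simp),
      fun v hv hl => by simpa using h.last v hv hl, by simpa using h.unmarked⟩
    (reports_collectSuper hN hN2 (S := insert x S) (by simpa using hb')) ⟨by simp, rfl⟩
    (by simp [setCredit] at hT ⊢; omega) ?_
  intro T₁ s₁ l i1 i2 i3 i4 i5
  obtain ⟨i5, i6⟩ := i5
  have htar : s₁.arr .target = s.arr .target := by simp [i2.target]
  simp only [ne_eq, reduceCtorEq, not_false_eq_true, Function.update_of_ne] at i3 i5 i6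
  set f : ℕ → ℕ := fun e => rep (s.arr .target e) with hf
  obtain ⟨ys, hys⟩ : ∃ ys, ys = (l.map f).filter
    (fun v => Function.update (s.arr .isSuper) x 1 v = 1) := ⟨_, rfl⟩
  simp only [Function.update_self] at i5
  rw [← hys] at i5
  have hlen : (List.length ys) = s₁.reg .numSupers := by
    rw [← i5, List.length_map, List.length_range]
  have hget : ∀ j, (hj : j < ys.length) → s₁.arr .supers j = ys[j] := by
    intro j hj
    simp [← i5]
  have hlen' : ys.length ≤ (ℓ x).length := by
    rw [hys]
    exact (List.length_filter_le _ _).trans (by simpa using i3.sublist.length_le)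
  have hysnd : ys.Nodup := hys ▸ i3.nodup.filter _
  have hmem : ∀ y, y ∈ ys ↔ y ≠ x ∧ y ∈ S ∧ ∃ e ∈ ℓ x, f e = y := by
    intro y
    rw [hys, List.mem_filter, i3.mem_iff, and_assoc, and_congr_right_iff]
    intro hyx
    rw [and_comm, and_congr_left_iff]
    rintro ⟨e, he, rfl⟩
    have hlt : f e < n := by
      obtain ⟨_, _, hh, _⟩ := h.sets
      exact hh _ (h.lists.target_lt x e he)
    rw [hb' _ hlt]
    simp [hyx]
  have hylt : ∀ y ∈ ys, y < n := by
    intro y hy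
    obtain ⟨_, _, e, he, rfl⟩ := (hmem y).1 hy
    obtain ⟨_, _, hh, _⟩ := h.sets
    exact hh _ (h.lists.target_lt x e he)
  have hxys : x ∉ ys := fun hy => ((hmem x).1 hy).1 rfl
  have hyslen := length_lt_of_nodup hysnd hylt hx hxys
  have hyrep : ∀ y ∈ ys, rep y = y := by
    intro y hy
    obtain ⟨_, _, e, he, rfl⟩ := (hmem y).1 hy
    exact hidem _
  have hlc : listCredit A n (insert x S) (Function.update ℓ x l) ≤
      2 * (refCost A * (ℓ x).length) + listCreditExcept A n S ℓ x := by
    rw [listCredit_eq _ _ hx, hcx', Function.update_self, Nat.mul_assoc]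
    have h1 := Nat.mul_le_mul_left (refCost A) i3.sublist.length_le
    have h2 : listCreditExcept A n (insert x S) (Function.update ℓ x l) x =
        listCreditExcept A n S ℓ x := by
      refine listCreditExcept_congr (fun v hv => ?_) fun v hv => ?_ <;> simp [hv]
    omega
  have hmul := Nat.mul_le_mul_left (mergeCost A + 12) hlen'
  have hout : s₁.out = s.out := i6
  have hR' : Refs adj (s₁.arr .target) rep (Function.update ℓ x l) := by
    rw [htar]
    exact hR.clean i3
  refine ⟨by omega, by omega, ?_⟩
  refine runs_while (fun T' s' => ∃ rep' ℓ' zs ys', ys = zs ++ ys' ∧ s'.reg .j = zs.length ∧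
    setCredit A n s'.arr + listCredit A n (insert x S) ℓ' +
      (mergeCost A + 12) * ys'.length + 4 + C ≤ T' ∧
    Tidy n M s'.arr rep' ℓ' ∧ Refs adj (s'.arr .target) rep' ℓ' ∧
    (∀ v, rep' v = if rep v ∈ zs then x else rep v) ∧ MergeFrame s₁ s') ?_
    ⟨rep, Function.update ℓ x l, [], ys, rfl, by simp, ?_, ?_, by simpa using hR', by simp,
      ⟨fun r _ h _ _ _ _ => by simp [h], rfl, rfl, rfl, rfl, rfl⟩⟩
  · rintro T' s' ⟨rep', ℓ', zs, ys', e1, e2, e3, e4, e5, e6, e7⟩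
    have hns : s'.reg .numSupers = ys.length := by
      rw [hlen, e7.reg _ (by simp) (by simp) (by simp) (by simp) (by simp) (by simp)]
    have hx' : s'.reg .x = x := by
      rw [e7.reg _ (by simp) (by simp) (by simp) (by simp) (by simp) (by simp), i2.x]
      simpa using hxs
    have hlen2 : ys.length = zs.length + ys'.length := by rw [e1, List.length_append]
    refine ⟨by simp [e2, hns]; omega, by simp; omega, fun hc => ?_, fun hc => ?_⟩
    · have hc' : zs.length < ys.length := by simpa [e2, hns] using hc
      cases ys' with
      | nil => simp at hlen2; omega
      | cons y ys' =>
        have hy : y ∈ ys := by rw [e1]; simp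
        obtain ⟨hyx, hyS, _⟩ := (hmem y).1 hy
        have hsup : s'.arr .supers zs.length = y := by
          rw [e7.supers, hget _ hc']
          simp [e1]
        have hynzs : y ∉ zs := by
          rw [e1, List.nodup_append] at hysnd
          exact fun hz => hysnd.2.2 y hz y (by simp) rfl
        have hxzs : x ∉ zs := fun hz => hxys (by rw [e1]; exact List.mem_append_left _ hz)
        have hrx' : rep' x = x := by rw [e6, hrx, if_neg hxzs]
        have hry' : rep' y = y := by rw [e6, hyrep y hy, if_neg hynzs]
        have hyn := hylt y hy
        simp only [List.length_cons, Nat.mul_add, mul_one] at e3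
        simp only [List.length_cons] at hlen2
        rw [runs_block_cons, runs_assign]
        refine ⟨by simp [e2, hsup]; omega, by simp; omega, ?_⟩
        rw [runs_block_cons]
        refine runs_merge hA hN hN2 hM (x := x) (y := y)
          (C := listCredit A n (insert x S) ℓ' + (mergeCost A + 12) * ys'.length + 4 + C + 5)
          (by simpa using hx') (by simp [e2, hsup]) hx hyn hrx' hry' hyx.symm (by exact e4)
          (by simp; omega) ?_
        intro T₂ s₂ g1 g2 g3 g4
        have g4' : s₂.reg .j = zs.length := by simp [g4, e2]
        simp only [increment, runs_block_cons, runs_assign, runs_block_nil, val, one, Expr.Fits,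
          Expr.eval, Expr.cost, g4']
        refine ⟨⟨by omega, by omega, by omega⟩, by omega, by omega, mergeRep rep' x y,
          mergeLists ℓ' x y, zs ++ [y], ys', by simp [e1], by simp, ?_, g2, ?_, ?_, ?_⟩
        · rw [listCredit_merge hx hyn (Finset.mem_insert_self _ _)
            (Finset.mem_insert_of_mem hyS) hyx.symm]
          omega
        · rw [g3.target]
          exact e5.merge hyx.symm
        · intro v
          have hv := e6 v
          unfold mergeRep
          by_cases k1 : rep v ∈ zs
          · rw [if_pos k1] at hv
            rw [hv, if_neg hyx.symm, if_pos (List.mem_append_left _ k1)]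
          · rw [if_neg k1] at hv
            rw [hv]
            simp [k1]
        · refine e7.trans (MergeFrame.trans ?_ (g3.trans ?_))
          · exact ⟨fun r h1 _ _ _ _ _ => by simp [h1], rfl, rfl, rfl, rfl, rfl⟩
          · exact ⟨fun r _ h1 _ _ _ _ => by simp [h1], rfl, rfl, rfl, rfl, rfl⟩
    · have hc' : ¬ zs.length < ys.length := by simpa [e2, hns] using hc
      have hnil : ys' = [] := List.eq_nil_of_length_eq_zero (by omega)
      subst hnil
      rw [List.append_nil] at e1
      subst e1
      simp only [List.length_nil, Nat.mul_zero] at e3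
      rw [runs_block_nil]
      refine ⟨by simp; omega, hQ _ s' rep' ℓ' ?_ e4 e5 (fun v => ?_) (fun v => ?_)
        ?_ ?_ ?_ hx' ?_ ?_⟩
      · simp only [Cond.cost, Expr.cost]
        omega
      · rw [e6]
        split_ifs <;> simp
      · rw [e6 v, ← hmem]
        split_ifs with k
        · simp [k]
        · simp [k]
      · rw [e7.isSuper, i2.isSuper]
        simpa using hb'
      · rw [e7.reg _ (by simp) (by simp) (by simp) (by simp) (by simp) (by simp), i2.numVertices]
        simp
      · rw [e7.reg _ (by simp) (by simp) (by simp) (by simp) (by simp) (by simp), i2.i]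
        simp
      · rw [e7.order, i2.order]
        simp
      · rw [e7.out, hout]
  · simp only
    omega
  · exact i4

end ContractionGraph

/-! ### Initialization -/

namespace ContractionGraph

open RAM UnionFind

variable {n N A : ℕ}

/-- The part of the memory that holds the input. -/
structure InputFrame (s s' : State Reg Arr) : Prop where
  numVertices : s'.reg .numVertices = s.reg .numVertices
  numEdges : s'.reg .numEdges = s.reg .numEdges
  edgeFst : s'.arr .edgeFst = s.arr .edgeFst
  edgeSnd : s'.arr .edgeSnd = s.arr .edgeSnd
  order : s'.arr .order = s.arr .order
  out : s'.out = s.out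

theorem InputFrame.trans {s₁ s₂ s₃ : State Reg Arr} (h : InputFrame s₁ s₂)
    (h' : InputFrame s₂ s₃) : InputFrame s₁ s₃ :=
  ⟨h'.1.trans h.1, h'.2.trans h.2, h'.3.trans h.3, h'.4.trans h.4, h'.5.trans h.5, h'.6.trans h.6⟩

/-- The arrays are initialized for the vertex `v`. -/
def Fresh (a : Arr → ℕ → ℕ) (v : ℕ) : Prop :=
  a .head v = 0 ∧ a .last v = 0 ∧ a .parent v = v ∧ a .ufRank v = 0 ∧ a .name v = v ∧
    a .isSuper v = 0 ∧ a .marked v = 0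

theorem runs_initVertices (hN : n + 1 < N) {s : State Reg Arr} (hs : s.reg .numVertices = n)
    {T C : ℕ} (hT : 30 * n + 10 + C ≤ T) {Q : ℕ → State Reg Arr → Prop}
    (hQ : ∀ T' s', C ≤ T' → InputFrame s s' → (∀ v < n, Fresh s'.arr v) → Q T' s') :
    Runs N initVertices T s Q := by
  unfold initVertices
  rw [runs_block_cons, runs_assign]
  refine ⟨by simp; omega, by simp; omega, ?_⟩
  rw [runs_block_cons]
  refine runs_while (fun T' s' => ∃ i k, i + k = n ∧ s'.reg .i = i ∧ 30 * k + 4 + C ≤ T' ∧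
    InputFrame s s' ∧ ∀ v < i, Fresh s'.arr v) ?_
    ⟨0, n, by omega, by simp, by simp; omega, ⟨by simp, by simp, rfl, rfl, rfl, rfl⟩, by simp⟩
  rintro T' s' ⟨i, k, e1, e2, e3, e4, e5⟩
  have hn := e4.numVertices
  rw [hs] at hn
  refine ⟨by simp [e2, hn]; omega, by simp; omega, fun hc => ?_, fun hc => ?_⟩
  · have hc' : i < n := by simpa [e2, hn] using hc
    simp only [increment, runs_block_cons, runs_assign, runs_store, runs_block_nil, val, one, zero,
      Expr.Fits, Expr.eval, Expr.cost, Cond.cost, e2]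
    refine ⟨by omega, by omega, by omega, by omega, by omega, by omega, by omega, by omega,
      by omega, by omega, by omega, by omega, by omega, by omega, by omega, by omega, by omega,
      by omega, by omega, by omega, by omega, by omega, by omega, by omega,
      i + 1, k - 1, by omega, by simp, by omega,
      e4.trans ⟨by simp, by simp, by simp, by simp, by simp, rfl⟩, fun v hv => ?_⟩
    by_cases e : v = i
    · simp [Fresh, e]
    · simpa [Fresh, e] using e5 v (by omega)
  · have hc' : ¬ i < n := by simpa [e2, hn] using hc
    have hin : i = n := by omega
    subst hin
    rw [runs_block_nil]
    refine ⟨by simp; omega, hQ _ _ (by simp; omega) e4 e5⟩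

/-- The lists after the reference `e` has been put in front of the list of `u`. -/
def pushRef (ℓ : ℕ → List ℕ) (u e : ℕ) : ℕ → List ℕ := Function.update ℓ u (e :: ℓ u)

theorem mem_pushRef {ℓ : ℕ → List ℕ} {u e v f : ℕ} :
    f ∈ pushRef ℓ u e v ↔ v = u ∧ f = e ∨ f ∈ ℓ v := by
  unfold pushRef
  by_cases h : v = u
  · subst h; simp
  · simp [h]

theorem Lists.push {k : ℕ} {a a' : Arr → ℕ → ℕ} {ℓ : ℕ → List ℕ} (h : Lists n k a id ℓ) {u w : ℕ}
    (hw : w < n) (h1 : a' .succ = Function.update (a .succ) (k + 1) (a .head u))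
    (h2 : a' .head = Function.update (a .head) u (k + 1))
    (h3 : a' .target = Function.update (a .target) (k + 1) w) :
    Lists n (k + 1) a' id (pushRef ℓ u (k + 1)) := by
  have hnew : ∀ v, k + 1 ∉ ℓ v := fun v hv => absurd (h.le v _ hv) (by omega)
  refine ⟨fun v hv hr => ?_, fun v => ?_, fun v v' e hv hv' => ?_, fun v e he => ?_,
    fun v e he => ?_, fun v hv => absurd rfl hv⟩
  · rw [h1, h2]
    have hl := (h.linked v hv hr).update (w := a .head u) (hnew v)
    by_cases e : v = u
    · subst e
      simp only [pushRef, Function.update_self]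
      exact ⟨rfl, by omega, by simpa using hl⟩
    · simpa [pushRef, e] using hl
  · by_cases e : v = u
    · subst e
      simpa [pushRef, hnew] using h.nodup v
    · simpa [pushRef, e] using h.nodup v
  · rw [mem_pushRef] at hv hv'
    rcases hv with ⟨rfl, rfl⟩ | hv <;> rcases hv' with ⟨h4, h5⟩ | hv'
    · exact h4.symm
    · exact absurd hv' (hnew _)
    · exact absurd (h5 ▸ hv) (hnew _)
    · exact h.disjoint v v' e hv hv'
  · rcases mem_pushRef.1 he with ⟨_, rfl⟩ | he
    · exact le_rfl
    · exact (h.le v e he).trans (Nat.le_succ k)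
  · rw [h3]
    rcases mem_pushRef.1 he with ⟨_, rfl⟩ | he
    · simpa using hw
    · rw [Function.update_of_ne (by rintro rfl; exact hnew v he)]
      exact h.target_lt v e he

theorem listCredit_pushRef (ℓ : ℕ → List ℕ) {u : ℕ} (hu : u < n) (e : ℕ) :
    listCredit A n ∅ (pushRef ℓ u e) =
      listCredit A n ∅ ℓ + (4 * refCost A + (mergeCost A + 12)) := by
  have h : listCreditExcept A n ∅ (pushRef ℓ u e) u = listCreditExcept A n ∅ ℓ u :=
    listCreditExcept_congr (fun _ _ => Iff.rfl) fun v hv => by simp [pushRef, hv]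
  rw [listCredit_eq _ _ hu, listCredit_eq _ _ hu, h, pushRef, Function.update_self,
    List.length_cons, refCredit, if_neg (Finset.notMem_empty u)]
  ring

/-- The memory while the neighborhood lists are built, after `k` references. -/
structure Building (n k : ℕ) (s : State Reg Arr) (ℓ : ℕ → List ℕ) : Prop where
  lists : Lists n k s.arr id ℓ
  last : ∀ v < n, LastOK s.arr ℓ v
  fresh : s.reg .fresh = k + 1

/-- The part of the memory that `insertReference` leaves alone. -/
structure InsertFrame (s s' : State Reg Arr) : Prop where
  reg : ∀ r, r ≠ .fresh → s'.reg r = s.reg r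
  arr : ∀ a, a ≠ .target → a ≠ .succ → a ≠ .head → a ≠ .last → s'.arr a = s.arr a
  out : s'.out = s.out

theorem runs_insertReference {k i u w : ℕ} (hN : n ≤ N) (hk : k + 2 < N) {s : State Reg Arr}
    {ℓ : ℕ → List ℕ} (h : Building n k s ℓ) (hu : u < n) (hw : w < n) (hi : s.reg .i = i)
    (hiN : i < N) {a b : Arr} (hab : a = .edgeFst ∧ b = .edgeSnd ∨ a = .edgeSnd ∧ b = .edgeFst)
    (ha : s.arr a i = u) (hb : s.arr b i = w) {T : ℕ} (hT : 40 ≤ T) {Q : ℕ → State Reg Arr → Prop}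
    (hQ : ∀ T' s', T ≤ T' + 40 → Building n (k + 1) s' (pushRef ℓ u (k + 1)) →
      s'.arr .target = Function.update (s.arr .target) (k + 1) w → InsertFrame s s' → Q T' s') :
    Runs N (insertReference (at' a .i) (at' b .i)) T s Q := by
  have hhead := h.lists.head_lt (N := N) (by omega) hu rfl
  have hnil : s.arr .head u = 0 ↔ ℓ u = [] := by
    have := h.lists.linked u hu rfl
    cases hl : ℓ u with
    | nil => rw [hl] at this; exact iff_of_true this rfl
    | cons e l => rw [hl] at this; simp [this.1, this.2.1]
  have hlast' : ∀ a' : Arr → ℕ → ℕ, (a' .last = if ℓ u = [] then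
      Function.update (s.arr .last) u (k + 1) else s.arr .last) → ∀ v < n,
      LastOK a' (pushRef ℓ u (k + 1)) v := by
    intro a' ha v hv hne
    by_cases hvu : v = u
    · subst hvu
      simp only [pushRef, Function.update_self]
      rw [ha, List.getLastD_cons]
      split_ifs with e
      · simp [e]
      · rw [h.last v hv e]
        obtain ⟨b, l, hbl⟩ := List.exists_cons_of_ne_nil e
        simp only [hbl, List.getLastD_cons]
    · have e1 : pushRef ℓ u (k + 1) v = ℓ v := by simp [pushRef, hvu]
      rw [e1] at hne ⊢
      rw [ha, ← h.last v hv hne]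
      split_ifs <;> simp [hvu]
  have ha1 : a ≠ .target ∧ a ≠ .succ ∧ a ≠ .head ∧ a ≠ .last := by
    rcases hab with ⟨rfl, _⟩ | ⟨rfl, _⟩ <;> simp
  obtain ⟨ha1, ha2, ha3, ha4⟩ := ha1
  unfold insertReference
  simp only [increment, runs_block_cons, runs_assign, runs_store, runs_ite, runs_skip,
    runs_block_nil, val, one, zero, at', Cond.Fits, Cond.Holds,
    Expr.Fits, Expr.eval, Expr.cost, Cond.cost, hi, h.fresh, ha, hb, Function.update_of_ne ha1,
    Function.update_of_ne ha2, Function.update_of_ne ha4, ne_eq,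
    reduceCtorEq, not_false_eq_true, Function.update_of_ne]
  refine ⟨by omega, ⟨by omega, by omega⟩, by omega, by omega, ⟨⟨by omega, by omega⟩, by omega⟩,
    by omega, ⟨⟨⟨by omega, by omega⟩, by omega⟩, by omega⟩, by omega, fun hc => ?_, fun hc => ?_⟩
  · have e := hnil.1 hc
    refine ⟨⟨by omega, by omega⟩, by omega, by omega, ⟨by omega, by omega⟩, by omega, by omega,
      ⟨by omega, by omega, by omega⟩, by omega, by omega,
      hQ _ _ (by omega) ⟨h.lists.push hw ?_ ?_ ?_, hlast' _ ?_, ?_⟩ ?_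
      ⟨fun r hr => ?_, fun a h1 h2 h3 h4 => ?_, rfl⟩⟩
    · simp
    · simp
    · simp
    · simp [e]
    · simp
    · simp
    · simp [hr]
    · simp [h1, h2, h3, h4]
  · have e : ℓ u ≠ [] := fun e => hc (hnil.2 e)
    refine ⟨by omega, ⟨by omega, by omega⟩, by omega, by omega,
      ⟨by omega, by omega, by omega⟩, by omega, by omega,
      hQ _ _ (by omega) ⟨h.lists.push hw ?_ ?_ ?_, hlast' _ ?_, ?_⟩ ?_
      ⟨fun r hr => ?_, fun a h1 h2 h3 h4 => ?_, rfl⟩⟩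
    · simp
    · simp
    · simp
    · simp [e]
    · simp
    · simp
    · simp [hr]
    · simp [h1, h2, h3]

theorem runs_initLists {m : ℕ} (hN : n ≤ N) (hmN : 2 * m + 1 < N) {s : State Reg Arr}
    (hm : s.reg .numEdges = m) {adj : ℕ → ℕ → Prop} (hadj : ∀ a b, adj a b → a < n ∧ b < n)
    (hsymm : ∀ a b, adj a b → adj b a)
    (hsound : ∀ j < m, adj (s.arr .edgeFst j) (s.arr .edgeSnd j))
    (hcomplete : ∀ a b, adj a b → ∃ j < m, s.arr .edgeFst j = a ∧ s.arr .edgeSnd j = b ∨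
      s.arr .edgeSnd j = a ∧ s.arr .edgeFst j = b)
    (hfresh : ∀ v < n, Fresh s.arr v) {T C : ℕ} (hT : 100 * m + 10 + C ≤ T)
    {Q : ℕ → State Reg Arr → Prop}
    (hQ : ∀ T' s' ℓ, C ≤ T' → Tidy n (2 * m) s'.arr id ℓ → Refs adj (s'.arr .target) id ℓ →
      listCredit A n ∅ ℓ = (4 * refCost A + (mergeCost A + 12)) * (2 * m) →
      setCredit A n s'.arr = 0 → (∀ v < n, s'.arr .isSuper v = 0) → InputFrame s s' → Q T' s') :
    Runs N initLists T s Q := by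
  unfold initLists
  simp only [runs_block_cons, runs_assign, val, one, zero, Expr.Fits, Expr.eval, Expr.cost]
  refine ⟨by omega, by omega, by omega, by omega, ?_⟩
  refine runs_while (fun T' s' => ∃ i k ℓ, i + k = m ∧ s'.reg .i = i ∧ 100 * k + 4 + C ≤ T' ∧
    Building n (2 * i) s' ℓ ∧ InputFrame s s' ∧
    (∀ a, a ≠ .target → a ≠ .succ → a ≠ .head → a ≠ .last → s'.arr a = s.arr a) ∧
    (∀ v e, e ∈ ℓ v → adj v (s'.arr .target e)) ∧
    (∀ j < i, (∃ e ∈ ℓ (s.arr .edgeFst j), s'.arr .target e = s.arr .edgeSnd j) ∧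
      ∃ e ∈ ℓ (s.arr .edgeSnd j), s'.arr .target e = s.arr .edgeFst j) ∧
    listCredit A n ∅ ℓ = (4 * refCost A + (mergeCost A + 12)) * (2 * i)) ?_
    ⟨0, m, fun _ => [], by omega, by simp, by omega, ⟨⟨fun v hv _ => (hfresh v hv).1, by simp,
      by simp, by simp, by simp, by simp⟩, fun v _ h => absurd rfl h, by simp⟩,
      ⟨by simp, by simp, rfl, rfl, rfl, rfl⟩, fun _ _ _ _ _ => rfl, by simp, by simp,
      by simp [listCredit]⟩
  rintro T' s' ⟨i, k, ℓ, e1, e2, e3, e4, e5, e6, e7, e8, e9⟩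
  have hm' := e5.numEdges
  rw [hm] at hm'
  refine ⟨by simp [e2, hm']; omega, by simp; omega, fun hc => ?_, fun hc => ?_⟩
  · have hc' : i < m := by simpa [e2, hm'] using hc
    obtain ⟨hu, hw⟩ := hadj _ _ (hsound i hc')
    rw [runs_block_cons]
    refine runs_insertReference (a := .edgeFst) (b := .edgeSnd) hN (by omega) e4 hu hw e2
      (by omega) (.inl ⟨rfl, rfl⟩) (by rw [e5.edgeFst]) (by rw [e5.edgeSnd]) (by simp; omega) ?_
    intro T₁ s₁ f1 f2 f3 f4
    rw [runs_block_cons]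
    refine runs_insertReference (a := .edgeSnd) (b := .edgeFst) hN (by omega) f2 hw hu
      (by rw [f4.reg _ (by simp), e2]) (by omega) (.inr ⟨rfl, rfl⟩)
      (by rw [f4.arr _ (by simp) (by simp) (by simp) (by simp), e5.edgeSnd])
      (by rw [f4.arr _ (by simp) (by simp) (by simp) (by simp), e5.edgeFst])
      (by simp at f1; omega) ?_
    intro T₂ s₂ g1 g2 g3 g4
    have hi₂ : s₂.reg .i = i := by rw [g4.reg _ (by simp), f4.reg _ (by simp), e2]
    have htar : ∀ v e, e ∈ ℓ v → s₂.arr .target e = s'.arr .target e := by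
      intro v e he
      have := e4.lists.le v e he
      rw [g3, f3, Function.update_of_ne (by omega), Function.update_of_ne (by omega)]
    have htar1 : s₂.arr .target (2 * i + 1) = s.arr .edgeSnd i := by
      rw [g3, f3, Function.update_of_ne (by omega), Function.update_self]
    have htar2 : s₂.arr .target (2 * i + 1 + 1) = s.arr .edgeFst i := by
      rw [g3, Function.update_self]
    simp only [increment, runs_block_cons, runs_assign, runs_block_nil, val, one, Expr.Fits,
      Expr.eval, Expr.cost, hi₂]
    simp only [Cond.cost, Expr.cost] at f1
    refine ⟨⟨by omega, by omega, by omega⟩, by omega, by omega, i + 1, k - 1, _, by omega,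
      by simp, by omega, ⟨g2.lists, g2.last, by simp [g2.fresh]; omega⟩, e5.trans ?_, ?_, ?_, ?_,
      ?_⟩
    · refine ⟨?_, ?_, ?_, ?_, ?_, ?_⟩
      · simp [g4.reg, f4.reg]
      · simp [g4.reg, f4.reg]
      · simp [g4.arr, f4.arr]
      · simp [g4.arr, f4.arr]
      · simp [g4.arr, f4.arr]
      · rw [g4.out, f4.out]
    · intro a h1 h2 h3 h4
      rw [← e6 a h1 h2 h3 h4]
      simp [g4.arr a h1 h2 h3 h4, f4.arr a h1 h2 h3 h4]
    · intro v e he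
      rcases mem_pushRef.1 he with ⟨rfl, rfl⟩ | he
      · simp only [htar2]
        exact hsymm _ _ (hsound i hc')
      · rcases mem_pushRef.1 he with ⟨rfl, rfl⟩ | he
        · simp only [htar1]
          exact hsound i hc'
        · simp only [htar v e he]
          exact e7 v e he
    · intro j hj
      by_cases hji : j = i
      · subst hji
        exact ⟨⟨2 * j + 1, mem_pushRef.2 (.inr (mem_pushRef.2 (.inl ⟨rfl, rfl⟩))), htar1⟩,
          ⟨2 * j + 1 + 1, mem_pushRef.2 (.inl ⟨rfl, rfl⟩), htar2⟩⟩
      · obtain ⟨⟨e, he, h1⟩, e', he', h2⟩ := e8 j (by omega)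
        exact ⟨⟨e, mem_pushRef.2 (.inr (mem_pushRef.2 (.inr he))), (htar _ e he).trans h1⟩,
          ⟨e', mem_pushRef.2 (.inr (mem_pushRef.2 (.inr he'))), (htar _ e' he').trans h2⟩⟩
    · rw [listCredit_pushRef _ hw, listCredit_pushRef _ hu, e9]
      ring
  · have hc' : ¬ i < m := by simpa [e2, hm'] using hc
    have him : i = m := by omega
    subst him
    have hpar : ∀ v < n, s'.arr .parent v = v := fun v hv => by
      rw [e6 _ (by simp) (by simp) (by simp) (by simp)]; exact (hfresh v hv).2.2.1
    have hrk : ∀ v < n, s'.arr .ufRank v = 0 := fun v hv => by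
      rw [e6 _ (by simp) (by simp) (by simp) (by simp)]; exact (hfresh v hv).2.2.2.1
    have hname : ∀ v < n, s'.arr .name v = v := fun v hv => by
      rw [e6 _ (by simp) (by simp) (by simp) (by simp)]; exact (hfresh v hv).2.2.2.2.1
    have hsup : ∀ v < n, s'.arr .isSuper v = 0 := fun v hv => by
      rw [e6 _ (by simp) (by simp) (by simp) (by simp)]; exact (hfresh v hv).2.2.2.2.2.1
    have hmark : ∀ v < n, s'.arr .marked v = 0 := fun v hv => by
      rw [e6 _ (by simp) (by simp) (by simp) (by simp)]; exact (hfresh v hv).2.2.2.2.2.2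
    rw [runs_block_nil]
    refine ⟨by simp; omega, hQ _ s' ℓ (by simp only [Cond.cost, Expr.cost]; omega)
      ⟨⟨id, forest_init hpar hrk, fun v hv => hv, hname, fun u _ v _ h => h⟩, e4.lists, e4.last,
        hmark⟩ ⟨fun v e he => ⟨v, rfl, e7 v e he⟩, fun a b hab _ => ?_⟩ e9 ?_ hsup e5⟩
    · obtain ⟨j, hj, h | h⟩ := hcomplete a b hab
      · obtain ⟨rfl, rfl⟩ := h
        exact (e8 j hj).1
      · obtain ⟨rfl, rfl⟩ := h
        exact (e8 j hj).2
    · rw [setCredit, potential_zero _ _ _ _ hrk]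

end ContractionGraph

/-! ### The arcs of the hierarchy -/

namespace ContractionGraph

/-- The adjacency of a graph on `Fin n`, as a relation on the words of the machine. -/
def wordAdj {n : ℕ} (G : SimpleGraph (Fin n)) (a b : ℕ) : Prop :=
  ∃ (ha : a < n) (hb : b < n), G.Adj ⟨a, ha⟩ ⟨b, hb⟩

variable {n : ℕ} {G : SimpleGraph (Fin n)} {π : Equiv.Perm (Fin n)}

theorem wordAdj_contractVertex (v : Fin n) :
    wordAdj (G.contractVertex v) = fun u w : ℕ => u ≠ w ∧ u ≠ (v : ℕ) ∧ w ≠ (v : ℕ) ∧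
      (wordAdj G u w ∨ (wordAdj G v u ∧ wordAdj G v w)) := by
  funext u w
  apply propext
  constructor
  · rintro ⟨hu, hw, h1, h2, h3, h4⟩
    refine ⟨fun e => h1 (Fin.ext e), fun e => h2 (Fin.ext e), fun e => h3 (Fin.ext e), ?_⟩
    exact h4.imp (fun h => ⟨hu, hw, h⟩) fun h => ⟨⟨v.2, hu, h.1⟩, ⟨v.2, hw, h.2⟩⟩
  · rintro ⟨h1, h2, h3, ⟨hu, hw, h⟩ | ⟨⟨_, hu, h⟩, ⟨_, hw, h'⟩⟩⟩
    · exact ⟨hu, hw, fun e => h1 (congrArg Fin.val e), fun e => h2 (congrArg Fin.val e),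
        fun e => h3 (congrArg Fin.val e), .inl h⟩
    · exact ⟨hu, hw, fun e => h1 (congrArg Fin.val e), fun e => h2 (congrArg Fin.val e),
        fun e => h3 (congrArg Fin.val e), .inr ⟨h, h'⟩⟩

theorem coreGraph_succ {i : ℕ} (hi : i < n) :
    coreGraph G π (i + 1) = (coreGraph G π i).contractVertex (π ⟨i, hi⟩) := by
  rw [coreGraph, dif_pos hi]

/-- Contracted vertices are isolated. -/
theorem le_rank_of_coreGraph_adj {i : ℕ} {x y : Fin n} (h : (coreGraph G π i).Adj x y) :
    i ≤ (π.symm x : ℕ) ∧ i ≤ (π.symm y : ℕ) := by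
  induction i generalizing x y with
  | zero => simp
  | succ i ih =>
    have key : ∀ (hi : i < n) (z : Fin n), z ≠ π ⟨i, hi⟩ → i ≤ (π.symm z : ℕ) →
        i + 1 ≤ (π.symm z : ℕ) := by
      intro hi z hz hle
      refine lt_of_le_of_ne hle fun e => hz ?_
      rw [← π.apply_symm_apply z]
      congr 1
      exact Fin.ext e.symm
    by_cases hi : i < n
    · rw [coreGraph_succ hi] at h
      obtain ⟨_, h2, h3, h4⟩ := h
      have h5 : i ≤ (π.symm x : ℕ) ∧ i ≤ (π.symm y : ℕ) := by
        rcases h4 with h4 | ⟨h4, h5⟩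
        exacts [ih h4, ⟨(ih h4).2, (ih h5).2⟩]
      exact ⟨key hi x h2 h5.1, key hi y h3 h5.2⟩
    · rw [coreGraph, dif_neg hi] at h
      have := (ih h).1
      omega

theorem coreGraph_adj_of_le {i j : ℕ} {x y : Fin n} (h : (coreGraph G π i).Adj x y) (hij : i ≤ j)
    (hx : j ≤ (π.symm x : ℕ)) (hy : j ≤ (π.symm y : ℕ)) : (coreGraph G π j).Adj x y := by
  induction j, hij using Nat.le_induction with
  | base => exact h
  | succ j _ ih =>
    have hj : j < n := by omega
    have key : ∀ z : Fin n, j + 1 ≤ (π.symm z : ℕ) → z ≠ π ⟨j, hj⟩ := by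
      rintro z hz rfl
      simp at hz
    rw [coreGraph_succ hj]
    exact ⟨h.ne, key x hx, key y hy, .inl (ih (by omega) (by omega))⟩

/-- The arcs that leave `x` are the edges of `x` in the core graph from which `x` is contracted. -/
theorem upwardHierarchy_adj_iff {x y : Fin n} :
    (upwardHierarchy G π).Adj x y ↔ (coreGraph G π (π.symm x)).Adj x y := by
  constructor
  · rintro ⟨h1, h2⟩
    obtain ⟨i, hi⟩ := SimpleGraph.iSup_adj.1 h1
    exact coreGraph_adj_of_le hi (le_rank_of_coreGraph_adj hi).1 le_rfl (Fin.lt_def.1 h2).le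
  · intro h
    refine ⟨SimpleGraph.iSup_adj.2 ⟨_, h⟩, lt_of_le_of_ne ?_ fun e => h.ne (π.symm.injective e)⟩
    exact (le_rank_of_coreGraph_adj h).2

/-- The arcs in the order in which the algorithm outputs them: `order j` is the vertex of
rank `j`. -/
theorem exists_rank_iff {order : ℕ → ℕ} (ho : ∀ i : Fin n, order i = π i) (p : ℕ × ℕ) :
    (∃ j < n, p.1 = order j ∧ wordAdj (coreGraph G π j) p.1 p.2) ↔
      ∃ x y : Fin n, (upwardHierarchy G π).Adj x y ∧ p = ((x : ℕ), (y : ℕ)) := by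
  constructor
  · rintro ⟨j, hj, h1, h2, h3, h4⟩
    refine ⟨⟨p.1, h2⟩, ⟨p.2, h3⟩, upwardHierarchy_adj_iff.2 ?_, rfl⟩
    have h5 : (⟨p.1, h2⟩ : Fin n) = π ⟨j, hj⟩ := Fin.ext (h1.trans (ho ⟨j, hj⟩))
    have h6 : ((π.symm ⟨p.1, h2⟩ : Fin n) : ℕ) = j := by rw [h5, π.symm_apply_apply]
    rwa [h6]
  · rintro ⟨x, y, h, rfl⟩
    refine ⟨π.symm x, (π.symm x).2, ?_, x.2, y.2, upwardHierarchy_adj_iff.1 h⟩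
    rw [ho (π.symm x), π.apply_symm_apply]

theorem length_le_numHierarchyArcs {L : List (ℕ × ℕ)} (hL : L.Nodup)
    (h : ∀ p ∈ L, ∃ x y : Fin n, (upwardHierarchy G π).Adj x y ∧ p = ((x : ℕ), (y : ℕ))) :
    L.length ≤ numHierarchyArcs G π := by
  have h1 : (L.toFinset : Set (ℕ × ℕ)) ⊆ (fun p : Fin n × Fin n => ((p.1 : ℕ), (p.2 : ℕ))) ''
      {p | (upwardHierarchy G π).Adj p.1 p.2} := by
    intro p hp
    obtain ⟨x, y, hxy, rfl⟩ := h p (by simpa using hp)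
    exact ⟨(x, y), hxy, rfl⟩
  rw [← List.toFinset_card_of_nodup hL, ← Set.ncard_coe_finset]
  exact (Set.ncard_le_ncard h1 (Set.toFinite _)).trans (Set.ncard_image_le (Set.toFinite _))

theorem ncard_edgeSet_le_numHierarchyArcs (G : SimpleGraph (Fin n)) (π : Equiv.Perm (Fin n)) :
    G.edgeSet.ncard ≤ numHierarchyArcs G π := by
  have h : G.edgeSet ⊆ (fun p : Fin n × Fin n => s(p.1, p.2)) ''
      {p | (upwardHierarchy G π).Adj p.1 p.2} := by
    intro e he
    induction e using Sym2.ind with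
    | _ a b =>
      have hab : G.Adj a b := he
      have key : ∀ a b, G.Adj a b → π.symm a < π.symm b → (upwardHierarchy G π).Adj a b :=
        fun a b h h' => ⟨SimpleGraph.iSup_adj.2 ⟨0, h⟩, h'⟩
      rcases lt_or_gt_of_ne fun e => hab.ne (π.symm.injective e) with h | h
      · exact ⟨(a, b), key a b hab h, rfl⟩
      · exact ⟨(b, a), key b a hab.symm h, Sym2.eq_swap⟩
  exact (Set.ncard_le_ncard h (Set.toFinite _)).trans (Set.ncard_image_le (Set.toFinite _))

theorem IsEdgeList.length_eq {E : List (Fin n × Fin n)} (h : IsEdgeList G E) :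
    E.length = G.edgeSet.ncard := by
  have h1 : G.edgeSet = ((E.map fun p => s(p.1, p.2)).toFinset : Set (Sym2 (Fin n))) := by
    ext e
    rw [← h.2 e]
    simp
  rw [h1, Set.ncard_coe_finset, List.toFinset_card_of_nodup h.1, List.length_map]

theorem one_le_inverseAckermann (hn : 2 ≤ n) : 1 ≤ inverseAckermann n := by
  by_contra hcon
  have h1 : n ≤ ack (inverseAckermann n) (inverseAckermann n) :=
    Nat.find_spec (exists_le_ack_diag n)
  have h0 : inverseAckermann n = 0 := by omega
  rw [h0] at h1
  simp at h1
  omega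

theorem le_fastGrowing_inverseAckermann (n : ℕ) :
    n ≤ UnionFind.fastGrowing (inverseAckermann n + 1) 1 :=
  (Nat.find_spec (exists_le_ack_diag n)).trans (UnionFind.ack_diag_le_fastGrowing _)

/-! ### The algorithm -/

open RAM UnionFind

variable {N M A : ℕ}

theorem reports_emit {s : State Reg Arr} {x : ℕ} (hxs : s.reg .x = x) (hx : x < N) (hN : n ≤ N) :
    Reports N n (.emit (val .x) (val .v)) s
      (fun ks _ _ out => out = s.out ++ ks.map fun v => (x, v)) := by
  intro ks s' T Q hF hJ hv hlen hT hQ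
  have hx' : s'.reg .x = x := hF.x.trans hxs
  rw [runs_emit]
  refine ⟨by simp [hx', hx], by simp; omega, by simp; omega, hQ _ _ (by simp; omega) ?_
    (fun _ _ => rfl) fun _ _ => rfl⟩
  have : s'.out = s.out ++ ks.map fun v => (x, v) := hJ
  simp [View, this, hx']

/-- The loop over all vertices. The relation `core i` is the core graph after `i` contractions, and
`K` is a bound on the number of arcs. -/
theorem runs_contractAll (hA : n ≤ fastGrowing A 1) (hN : n < N) (hN2 : 2 ≤ N) (hM : M < N)
    {core : ℕ → ℕ → ℕ → Prop} {order : ℕ → ℕ} (ho : ∀ i < n, order i < n)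
    (hinj : ∀ i < n, ∀ j < n, order i = order j → i = j)
    (hsymm : ∀ a b, core 0 a b → core 0 b a) (hirr : ∀ a b, core 0 a b → a ≠ b)
    (hcore : ∀ i < n, core (i + 1) = fun u w => u ≠ w ∧ u ≠ order i ∧ w ≠ order i ∧
      (core i u w ∨ (core i (order i) u ∧ core i (order i) w)))
    {K : ℕ} (hK : ∀ L : List (ℕ × ℕ), L.Nodup →
      (∀ p ∈ L, ∃ j < n, p.1 = order j ∧ core j p.1 p.2) → L.length ≤ K)
    {s : State Reg Arr} {ℓ : ℕ → List ℕ} (hn : s.reg .numVertices = n)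
    (hord : s.arr .order = order) (hout : s.out = []) (h : Tidy n M s.arr id ℓ)
    (hR : Refs (core 0) (s.arr .target) id ℓ) (hb : ∀ v < n, s.arr .isSuper v = 0) {T : ℕ}
    (hT : setCredit A n s.arr + listCredit A n ∅ ℓ + 2 * (refCost A * K) + 100 * n + 10 ≤ T)
    {Q : ℕ → State Reg Arr → Prop}
    (hQ : ∀ T' s', s'.out.Nodup →
      (∀ p : ℕ × ℕ, p ∈ s'.out ↔ ∃ j < n, p.1 = order j ∧ core j p.1 p.2) → Q T' s') :
    Runs N (.block [.assign .i zero,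
      .while (.lt (val .i) (val .numVertices)) (.block
        [ .assign .x (at' .order .i),
          contract,
          enumerateNeighbors (.emit (val .x) (val .v)),
          increment .i ])]) T s Q := by
  simp only [runs_block_cons, runs_assign, zero, Expr.Fits, Expr.eval, Expr.cost]
  refine ⟨by omega, by omega, ?_⟩
  refine runs_while (fun T' s' => ∃ i k S rep ℓ q, i + k = n ∧ s'.reg .i = i ∧
    s'.reg .numVertices = n ∧ s'.arr .order = order ∧ (∀ v, v ∈ S ↔ ∃ j < i, order j = v) ∧
    IsContraction (core 0) (core i) S rep ∧ Tidy n M s'.arr rep ℓ ∧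
    Refs (core 0) (s'.arr .target) rep ℓ ∧
    (∀ v < n, s'.arr .isSuper v = if v ∈ S then 1 else 0) ∧ s'.out.Nodup ∧
    (∀ p : ℕ × ℕ, p ∈ s'.out ↔ ∃ j < i, p.1 = order j ∧ core j p.1 p.2) ∧
    s'.out.length + q = K ∧
    setCredit A n s'.arr + listCredit A n S ℓ + 2 * (refCost A * q) + 100 * k + 4 ≤ T') ?_
    ⟨0, n, ∅, id, ℓ, K, by omega, by simp, by simpa using hn, hord, by simp,
      isContraction_empty hirr, h, hR, by simpa using hb, by simp [hout], by simp [hout],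
      by simp [hout], by simp only; omega⟩
  rintro T' s' ⟨i, k, S, rep, ℓ, q, a1, a2, a3, a4, a5, a6, a7, a8, a9, a10, a11, a12, a13⟩
  refine ⟨by simp [a2, a3]; omega, by simp; omega, fun hc => ?_, fun hc => ?_⟩
  swap
  · have hc' : ¬ i < n := by simpa [a2, a3] using hc
    have hin : i = n := by omega
    subst hin
    rw [runs_block_nil]
    exact ⟨by simp; omega, hQ _ _ a10 a11⟩
  have hi : i < n := by simpa [a2, a3] using hc
  obtain ⟨x, hx⟩ : ∃ x, x = order i := ⟨_, rfl⟩
  have hxn : x < n := hx ▸ ho i hi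
  have hxS : x ∉ S := by
    rw [a5]
    rintro ⟨j, hj, e⟩
    have := hinj j (by omega) i hi (e.trans hx)
    omega
  have hrx := a6.fix x hxS
  rw [runs_block_cons, runs_assign]
  refine ⟨by simp [a2, a4, ← hx]; omega, by simp; omega, ?_⟩
  rw [runs_block_cons]
  refine runs_contract (x := x) (S := S) (C := 2 * (refCost A * q) + 100 * k - 60) hA hN hN2 hM
    (by simp [a2, a4, hx]) hxn hxS hrx a6.idem (by exact a7) (by exact a8) (by exact a9)
    (by simp only [val, at', Cond.cost, Expr.cost]; omega) ?_
  intro T₁ s₁ rep' ℓ' b1 b2 b3 b4 b5 b6 b7 b8 b9 b10 b11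
  have hrep' : ∀ v, rep' v = x ↔ v = x ∨ rep v ∈ S ∧ ∃ b, core 0 x b ∧ rep b = rep v := by
    intro v
    rw [b5, a6.rep_eq_iff hxS]
    refine or_congr_right ?_
    constructor
    · rintro ⟨h1, h2, h3⟩
      obtain ⟨a, b, ha, hab, hb⟩ := (a8.exists_target_iff h1).1 h3
      rw [a6.rep_eq_iff hxS] at ha
      exact ⟨h2, b, ha ▸ hab, hb⟩
    · rintro ⟨h2, b, h3, h4⟩
      have h1 : rep v ≠ x := fun e => hxS (e ▸ h2)
      exact ⟨h1, h2, (a8.exists_target_iff h1).2 ⟨x, b, hrx, h3, h4⟩⟩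
  obtain ⟨c1, c2⟩ := a6.contract hsymm hxS b4 hrep'
  rw [hx, ← hcore i hi, ← hx] at c1
  have hrx' : rep' x = x := (hrep' x).2 (.inl rfl)
  rw [runs_block_cons]
  have hcx : refCredit A (insert x S) x = 2 * refCost A := if_pos (Finset.mem_insert_self _ _)
  rw [listCredit_eq _ ℓ' hxn, hcx, Nat.mul_assoc] at b1
  refine runs_enumerateNeighbors (C := listCreditExcept A n (insert x S) ℓ' x +
    2 * (refCost A * q) + 100 * k - 90) hA hN.le hN2 hM b9 hxn hrx' b2
    (reports_emit b9 (by omega) hN.le) (by simp [View]) (by omega) ?_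
  intro T₂ s₂ l d1 d2 d3 d4 d5
  have d5 : s₂.out = s₁.out ++ (l.map fun e => rep' (s₁.arr .target e)).map fun v => (x, v) := d5
  obtain ⟨ks, hks⟩ : ∃ ks, ks = l.map fun e => rep' (s₁.arr .target e) := ⟨_, rfl⟩
  rw [← hks, b11] at d5
  have hmem : ∀ v, v ∈ ks ↔ core i x v := by
    intro v
    rw [hks, d3.mem_iff, ← c2 v]
    refine and_congr_right fun hv => ?_
    exact b3.exists_target_iff hv
  have hmem' : ∀ p : ℕ × ℕ, p ∈ s₂.out ↔ ∃ j < i + 1, p.1 = order j ∧ core j p.1 p.2 := by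
    intro p
    rw [d5, List.mem_append]
    constructor
    · rintro (hp | hp)
      · obtain ⟨j, hj, h1, h2⟩ := (a11 p).1 hp
        exact ⟨j, by omega, h1, h2⟩
      · obtain ⟨v, hv, rfl⟩ := List.mem_map.1 hp
        exact ⟨i, by omega, hx, (hmem v).1 hv⟩
    · rintro ⟨j, hj, h1, h2⟩
      by_cases hji : j = i
      · subst hji
        rw [← hx] at h1
        rw [h1] at h2
        exact .inr (List.mem_map.2 ⟨p.2, (hmem _).2 h2, by rw [← h1]⟩)
      · exact .inl ((a11 p).2 ⟨j, by omega, h1, h2⟩)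
  have hnd : s₂.out.Nodup := by
    rw [d5, List.nodup_append]
    refine ⟨a10, ?_, ?_⟩
    · rw [hks]
      exact d3.nodup.map fun a b e => congrArg Prod.snd e
    · rintro p hp p' hp' rfl
      obtain ⟨j, hj, h1, _⟩ := (a11 p).1 hp
      obtain ⟨v, _, rfl⟩ := List.mem_map.1 hp'
      have := hinj i hi j (by omega) (hx ▸ h1)
      omega
  have hlen := hK _ hnd fun p hp => by
    obtain ⟨j, hj, h1⟩ := (hmem' p).1 hp
    exact ⟨j, by omega, h1⟩
  have hlen2 : s₂.out.length = s'.out.length + l.length := by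
    rw [d5, hks, List.length_append, List.length_map, List.length_map]
  obtain ⟨q', rfl⟩ : ∃ q', q = l.length + q' := ⟨q - l.length, by omega⟩
  have hi₂ : s₂.reg .i = i := by rw [d2.i, b8]; simp [a2]
  simp only [increment, runs_block_cons, runs_assign, runs_block_nil, val, one, Expr.Fits,
    Expr.eval, Expr.cost, hi₂]
  rw [Nat.mul_add] at d1
  refine ⟨⟨by omega, by omega, by omega⟩, by omega, by omega, i + 1, k - 1, insert x S, rep',
    Function.update ℓ' x l, q', by omega, by simp, ?_, ?_, ?_, c1, d4, ?_, ?_, hnd, hmem',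
    by omega, ?_⟩
  · simp [d2.numVertices, b7, a3]
  · simp [d2.order, b10, a4]
  · intro v
    rw [Finset.mem_insert, a5]
    constructor
    · rintro (rfl | ⟨j, hj, e⟩)
      · exact ⟨i, by omega, hx.symm⟩
      · exact ⟨j, by omega, e⟩
    · rintro ⟨j, hj, e⟩
      by_cases hji : j = i
      · subst hji
        exact .inl (e.symm.trans hx.symm)
      · exact .inr ⟨j, by omega, e⟩
  · simp only [d2.target]
    exact b3.clean d3
  · simp only [d2.isSuper]
    exact b6
  · have h2 : listCreditExcept A n (insert x S) (Function.update ℓ' x l) x =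
        listCreditExcept A n (insert x S) ℓ' x :=
      listCreditExcept_congr (fun _ _ => Iff.rfl) fun v hv => by simp [hv]
    rw [listCredit_eq _ _ hxn, hcx, h2, Function.update_self, Nat.mul_assoc]
    omega

/-- The algorithm is correct on a machine of `2 * m + n + 2` words per array, and its running time
is bounded by the saved time of the initial lists and of the arcs. -/
theorem runs_enumerateArcs (hn : 1 ≤ n) (hA : n ≤ fastGrowing A 1)
    {E : List (Fin n × Fin n)} {s : State Reg Arr} (hE : IsEdgeList G E) (hs : IsInput E π s) :
    Runs (2 * E.length + n + 2) enumerateArcs (130 * n + 100 * E.length + 40 +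
      (4 * refCost A + (mergeCost A + 12)) * (2 * E.length) +
      2 * (refCost A * numHierarchyArcs G π)) s
      fun _ s' => EnumeratesArcs (upwardHierarchy G π) s'.out := by
  obtain ⟨h1, h2, h3, h4, h5⟩ := hs
  have hadj : ∀ a b, wordAdj G a b → a < n ∧ b < n := fun a b h => ⟨h.1, h.2.1⟩
  have hsymm : ∀ a b, wordAdj G a b → wordAdj G b a := fun a b ⟨ha, hb, h⟩ => ⟨hb, ha, h.symm⟩
  have hirr : ∀ a b, wordAdj G a b → a ≠ b := by
    rintro a b ⟨ha, hb, h⟩ rfl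
    exact h.ne rfl
  have horder : ∀ i (hi : i < n), s.arr .order i = π ⟨i, hi⟩ := fun i hi => h4 ⟨i, hi⟩
  unfold enumerateArcs
  rw [runs_block_cons]
  refine runs_initVertices (C := 100 * n + 100 * E.length + 30 +
      (4 * refCost A + (mergeCost A + 12)) * (2 * E.length) +
      2 * (refCost A * numHierarchyArcs G π)) (by omega) h1 (by omega) ?_
  intro T₁ s₁ a1 a2 a3
  rw [runs_block_cons]
  refine runs_initLists (n := n) (A := A) (m := E.length) (C := 100 * n + 20 +
      (4 * refCost A + (mergeCost A + 12)) * (2 * E.length) +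
      2 * (refCost A * numHierarchyArcs G π)) (by omega) (by omega) (a2.numEdges.trans h2)
      hadj hsymm ?_ ?_ a3 (by omega) ?_
  · intro j hj
    obtain ⟨g1, g2⟩ := h3 ⟨j, hj⟩
    rw [a2.edgeFst, a2.edgeSnd, g1, g2]
    refine ⟨Fin.is_lt _, Fin.is_lt _, ?_⟩
    exact (hE.2 _).1 (List.mem_map.2 ⟨_, List.get_mem E ⟨j, hj⟩, rfl⟩)
  · rintro a b ⟨ha, hb, hab⟩
    obtain ⟨p, hp, hpe⟩ := List.mem_map.1 ((hE.2 s(⟨a, ha⟩, ⟨b, hb⟩)).2 hab)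
    obtain ⟨j, rfl⟩ := List.get_of_mem hp
    obtain ⟨g1, g2⟩ := h3 j
    refine ⟨j, j.2, ?_⟩
    rw [a2.edgeFst, a2.edgeSnd, g1, g2]
    rcases Sym2.eq_iff.1 hpe with ⟨e1, e2⟩ | ⟨e1, e2⟩
    · exact .inl ⟨congrArg Fin.val e1, congrArg Fin.val e2⟩
    · exact .inr ⟨congrArg Fin.val e2, congrArg Fin.val e1⟩
  intro T₂ s₂ ℓ b1 b2 b3 b4 b5 b6 b7
  refine runs_contractAll (core := fun i => wordAdj (coreGraph G π i)) (order := s.arr .order)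
    (K := numHierarchyArcs G π) (A := A) (M := 2 * E.length) hA (by omega) (by omega) (by omega)
    ?_ ?_ hsymm hirr ?_ ?_ (b7.numVertices.trans (a2.numVertices.trans h1))
    (b7.order.trans a2.order) (b7.out.trans (a2.out.trans h5)) b2 b3 b6 (by omega) ?_
  · intro i hi
    rw [horder i hi]
    exact Fin.is_lt _
  · intro i hi j hj e
    rw [horder i hi, horder j hj] at e
    exact congrArg Fin.val (π.injective (Fin.ext e))
  · intro i hi
    simp only [coreGraph_succ hi, horder i hi]
    exact wordAdj_contractVertex _
  · intro L hL hmem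
    exact length_le_numHierarchyArcs hL fun p hp => (exists_rank_iff h4 p).1 (hmem p hp)
  · intro T' s' c1 c2
    exact ⟨c1, fun p => (c2 p).trans (exists_rank_iff h4 p)⟩

end ContractionGraph

theorem mainTheorem9 :
    ∃ C : ℕ, ∀ (n : ℕ) (G : SimpleGraph (Fin n)) (π : Equiv.Perm (Fin n))
      (E : List (Fin n × Fin n)) (s : RAM.State ContractionGraph.Reg ContractionGraph.Arr),
      2 ≤ n → G.Connected → ContractionGraph.IsEdgeList G E → ContractionGraph.IsInput E π s →
      ∃ (N t : ℕ) (s' : RAM.State ContractionGraph.Reg ContractionGraph.Arr),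
        RAM.Exec N ContractionGraph.enumerateArcs s t s' ∧
        ContractionGraph.EnumeratesArcs (upwardHierarchy G π) s'.out ∧
        t ≤ C * (numHierarchyArcs G π * inverseAckermann n) ∧
        RAM.memoryWords ContractionGraph.Reg ContractionGraph.Arr N ≤ C * G.edgeSet.ncard := by
  refine ⟨3000, fun n G π E s hn hG hE hs => ?_⟩
  obtain ⟨t, s', T', h1, h2, h3⟩ := ContractionGraph.runs_enumerateArcs (by omega)
    (ContractionGraph.le_fastGrowing_inverseAckermann n) hE hs
  have hα := ContractionGraph.one_le_inverseAckermann hn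
  have hm := hE.length_eq
  have hmm := ContractionGraph.ncard_edgeSet_le_numHierarchyArcs G π
  have hconn : n ≤ G.edgeSet.ncard + 1 := by
    have := hG.card_vert_le_card_edgeSet_add_one
    rwa [Nat.card_eq_fintype_card, Fintype.card_fin, Nat.card_coe_set_eq] at this
  refine ⟨_, t, s', h1, h3, ?_, ?_⟩
  · rw [hm] at h2
    simp only [ContractionGraph.refCost, ContractionGraph.mergeCost] at h2
    generalize inverseAckermann n = α at *
    generalize G.edgeSet.ncard = m at *
    generalize numHierarchyArcs G π = k at *
    have e1 : m * α ≤ k * α := Nat.mul_le_mul_right _ hmm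
    have e2 : k * 1 ≤ k * α := Nat.mul_le_mul_left _ hα
    have e3 : (4 * (20 * (α + 1 + 6)) + (20 * (3 * (α + 1) + 10) + 12)) * (2 * m) +
        2 * (20 * (α + 1 + 6) * k) = 280 * (m * α) + 1664 * m + 40 * (k * α) + 280 * k := by ring
    omega
  · have hR : Fintype.card ContractionGraph.Reg = 15 := rfl
    have hAr : Fintype.card ContractionGraph.Arr = 13 := rfl
    rw [RAM.memoryWords, hR, hAr]
    omega
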